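/- **Setting.** Let $B_R=\{x\in\mathbb R^3: |x|\le R\}$, $\dot B_R=B_R\setminus\{0\}$, $S_1=\{|x|=1\}$, $r(x)=\sqrt{x_1^2+x_2^2}$, and let $S$ be the set consisting of all rotations about the $x_3$-axis and of the reflection $(x_1,x_2,x_3)\mapsto(x_1,x_2,-x_3)$. Let $C_S(B_3)$ be the set of $f\in C(B_3)$ with $f(Ax)=f(x)$ for all $A\in S$, $x\in B_3$. Let - $X$ be the space of all $f\in C_S(B_3)$ with $f(0)=0$, $f\in C^1(\dot B_3)$, $\nabla f$ bounded on $\dot B_3$, and such that $\lim_{t\searrow0}\nabla f(tx)$ exists uniformly in $x\in S_1$, with norm $\|f\|_X=\sup_{x\in\dot B_3}|\nabla f(x)|$; - $Y$ be the space of all $f\in C_S(B_3)$ with $f(0)=0$, $f\in C^1(B_3)$, $|\nabla f(x)|\le C|x|$ on $B_3$ for some $C>0$, and such that $\lim_{t\searrow0}\nabla f(tx)/t$ exists uniformly in $x\in S_1$, with norm $\|f\|_Y=\sup_{x\in\dot B_3}|\nabla f(x)|/|x|$. Let $\varphi,\psi:\mathbb R\to[0,\infty)$, $E_0\in\mathbb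 R$ and $U_0:\mathbb R^3\to\mathbb R$ satisfy the following. - $\varphi\in L^p_{loc}(\mathbb R)$ for some $p>2$, $\varphi(E)=0$ for a.e. $E\ge E_0$, and $\varphi(E)>0$ for a.e. $E<E_0$. - $f_0(x,v)=\varphi(\tfrac12|v|^2+U_0(x))$ is a nontrivial spherically symmetric static solution of the Vlasov–Poisson system with potential $U_0$; that is, $U_0\in C^2(\mathbb R^3)$ depends only on $|x|$, $U_0(x)\to0$ as $|x|\to\infty$, the density $\rho_0(x)=\int f_0(x,v)\,dv$ is in $C^1(\mathbb R^3)$ with $\operatorname{supp}\rho_0=B_1$, and $\Delta U_0=4\pi\rho_0$. - $\psi\in C^2(\mathbb R)$, $\psi'(0)=0$, and $\psi(P)=1$ if and only if $P=0$. Put $$h(\gamma,r,u)=2\pi\int_u^{E_0}\varphi(E)\int_{-\sqrt{2(E-u)}}^{\sqrt{2(E-u)}}\psi(\gamma r s)\,ds\,dE\ \text{ if } u<E_0,\qquad h(\gamma,r,u)=0\ \text{ if } u\ge E_0.$$ For $\zeta\in X$ let $g_\zeta(x)=x+\zeta(x)\,x/|x|$ for $x\in\dot B_3$ and $g_\zeta(0)=0$.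 Fix a radius $0<\varrho\le\frac13$ and let $\Omega=\{\zeta\in X:\|\zeta\|_X<\varrho\}$. **Proposition 3.1.** For every $\zeta\in\Omega$ the map $g_\zeta$ is injective on $B_3$ and $B_2\subset g_\zeta(B_3)$, so that $U_\zeta(y):=U_0(g_\zeta^{-1}(y))$ is defined for $y\in B_2$. All integrals and the derivatives $\partial_uh(\gamma,r(y),U_\zeta(y))$ and $\nabla U_\zeta(y)$ in the two formulas below exist, and the formula $$T(\gamma,\zeta)(x)=U_0(x)+\int_{B_2}\frac{h(\gamma,r(y),U_\zeta(y))}{|g_\zeta(x)-y|}\,dy-U_0(0)-\int_{B_2}\frac{h(\gamma,r(y),U_\zeta(y))}{|y|}\,dy,\qquad x\in B_3,$$ defines a continuous map $T:\,]-1,1[\,\times\Omega\to Y$. It is continuously Fréchet-differentiable with respect to $\zeta$, i.e. for each $\gamma\in\,]-1,1[$ the map $T(\gamma,\cdot):\Omega\to Y$ is Fréchet-differentiable, and $(\gamma,\zeta)\mapsto\partial_\zeta T(\gamma,\zeta)$ is continuous from $]-1,1[\,\times\Omega$ to the space of bounded linear operators $X\to Y$ with the operator norm. For $\gamma\in\,]-1,1[$,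 $\zeta\in\Omega$, $\xi\in X$ and $x\in B_3$, $$\begin{aligned}[\partial_\zeta T(\gamma,\zeta)\xi](x)=&-\int_{B_2}\Big(\frac1{|g_\zeta(x)-y|}-\frac1{|y|}\Big)\,\partial_uh(\gamma,r(y),U_\zeta(y))\,\nabla U_\zeta(y)\cdot\frac{g_\zeta^{-1}(y)}{|g_\zeta^{-1}(y)|}\,\xi(g_\zeta^{-1}(y))\,dy\\&-\int_{B_2}\frac{g_\zeta(x)-y}{|g_\zeta(x)-y|^3}\,h(\gamma,r(y),U_\zeta(y))\,dy\cdot\frac{x}{|x|}\,\xi(x),\end{aligned}$$ where the last term is read as $0$ at $x=0$. -/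

import Mathlib

open Set Filter Topology MeasureTheory Metric

noncomputable section

namespace VlasovPoisson

/-- Three-dimensional Euclidean space. -/
abbrev E3 : Type := EuclideanSpace ℝ (Fin 3)

/-- The closed ball of radius `R` around the origin. -/
abbrev B (R : ℝ) : Set E3 := closedBall (0 : E3) R

/-- The closed ball of radius `R` with its centre removed. -/
abbrev dotB (R : ℝ) : Set E3 := B R \ {0}

/-! ### The symmetry class -/

/-- Rotation about the third coordinate axis by the angle `θ`. -/
def rotation3 (θ : ℝ) (x : E3) : E3 :=
  !₂[Real.cos θ * x 0 - Real.sin θ * x 1, Real.sin θ * x 0 + Real.cos θ * x 1, x 2]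

/-- Reflection in the plane on which the third coordinate vanishes. -/
def reflection3 (x : E3) : E3 := !₂[x 0, x 1, -x 2]

/-- All rotations about the third axis, together with the reflection of the third coordinate. -/
def symS : Set (E3 → E3) := Set.range rotation3 ∪ {reflection3}

/-! ### The spaces `X` and `Y`

Functions on the closed ball `B 3` are represented by their extension by zero to `E3`
(field `zero_off`). All conditions and the norms only see the values on `B 3`. -/

/-- The gradient of a function on `B 3`, as a linear functional (its operator norm is the
Euclidean length of the gradient vector). It only depends on the values of `f` on `B 3`. -/
def grad (f : E3 → ℝ) (x : E3) : E3 →L[ℝ] ℝ := fderivWithin ℝ f (B 3) x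

/-- Membership in the space `X`. -/
structure MemX (f : E3 → ℝ) : Prop where
  zero_off : ∀ x, x ∉ B 3 → f x = 0
  cont : ContinuousOn f (B 3)
  symm : ∀ A ∈ symS, ∀ x ∈ B 3, f (A x) = f x
  map_zero : f 0 = 0
  smooth : ContDiffOn ℝ 1 f (dotB 3)
  bdd : ∃ C > 0, ∀ x ∈ dotB 3, ‖grad f x‖ ≤ C
  lim : ∃ G : E3 → (E3 →L[ℝ] ℝ),
    TendstoUniformlyOn (fun (t : ℝ) x => grad f (t • x)) G (𝓝[>] 0) (sphere 0 1)

/-- Membership in the space `Y`. -/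
structure MemY (f : E3 → ℝ) : Prop where
  zero_off : ∀ x, x ∉ B 3 → f x = 0
  cont : ContinuousOn f (B 3)
  symm : ∀ A ∈ symS, ∀ x ∈ B 3, f (A x) = f x
  map_zero : f 0 = 0
  smooth : ContDiffOn ℝ 1 f (B 3)
  bdd : ∃ C > 0, ∀ x ∈ B 3, ‖grad f x‖ ≤ C * ‖x‖
  lim : ∃ G : E3 → (E3 →L[ℝ] ℝ),
    TendstoUniformlyOn (fun (t : ℝ) x => t⁻¹ • grad f (t • x)) G (𝓝[>] 0) (sphere 0 1)

theorem dotB_mem_nhdsWithin {x : E3} (hx : x ∈ dotB 3) : dotB 3 ∈ 𝓝[B 3] x :=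
  inter_mem self_mem_nhdsWithin (mem_nhdsWithin_of_mem_nhds
    (isOpen_compl_singleton.mem_nhds hx.2))

theorem diffWithin_of_smooth {f : E3 → ℝ} (hf : ContDiffOn ℝ 1 f (dotB 3)) {x : E3}
    (hx : x ∈ dotB 3) : DifferentiableWithinAt ℝ f (B 3) x :=
  ((hf.differentiableOn one_ne_zero) x hx).mono_of_mem_nhdsWithin (dotB_mem_nhdsWithin hx)

theorem uniqueDiff_B3 {x : E3} (hx : x ∈ B 3) : UniqueDiffWithinAt ℝ (B 3) x := by
  refine (uniqueDiffOn_convex (convex_closedBall _ _) ?_) x hx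
  rw [interior_closedBall _ (by norm_num)]
  exact ⟨0, by simp⟩

theorem zero_mem_B3 : (0 : E3) ∈ B 3 := by simp

theorem smul_mem_dotB {x : E3} (hx : x ∈ sphere (0 : E3) 1) {t : ℝ} (h0 : 0 < t) (h3 : t < 3) :
    t • x ∈ dotB 3 := by
  have hx1 : ‖x‖ = 1 := by simpa using hx
  refine ⟨?_, ?_⟩
  · simp [norm_smul, hx1, abs_of_pos h0, h3.le]
  · have : x ≠ 0 := by rintro rfl; simp at hx1
    simp [h0.ne', this]

theorem eventually_small : ∀ᶠ t : ℝ in 𝓝[>] 0, 0 < t ∧ t < 3 :=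
  Ioo_mem_nhdsGT (by norm_num : (0 : ℝ) < 3)

theorem grad_add {f g : E3 → ℝ} (hf : ContDiffOn ℝ 1 f (dotB 3)) (hg : ContDiffOn ℝ 1 g (dotB 3))
    {x : E3} (hx : x ∈ dotB 3) : grad (f + g) x = grad f x + grad g x :=
  fderivWithin_add (uniqueDiff_B3 hx.1) (diffWithin_of_smooth hf hx) (diffWithin_of_smooth hg hx)

theorem grad_smul {f : E3 → ℝ} (c : ℝ) (hf : ContDiffOn ℝ 1 f (dotB 3))
    {x : E3} (hx : x ∈ dotB 3) : grad (c • f) x = c • grad f x :=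
  fderivWithin_const_smul (uniqueDiff_B3 hx.1) (diffWithin_of_smooth hf hx) c

theorem grad_zero (x : E3) : grad 0 x = 0 := by
  show fderivWithin ℝ (fun _ => (0 : ℝ)) (B 3) x = 0
  simp

/-- A function that vanishes at the origin and has zero gradient off the origin vanishes. -/
theorem eq_zero_of_grad {f : E3 → ℝ} (hoff : ∀ x, x ∉ B 3 → f x = 0) (hc : ContinuousOn f (B 3))
    (h0 : f 0 = 0) (hf : ContDiffOn ℝ 1 f (dotB 3)) (hg : ∀ x ∈ dotB 3, grad f x = 0) : f = 0 := by
  funext x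
  by_cases hx : x ∈ B 3
  swap
  · exact hoff x hx
  by_cases hx0 : x = 0
  · rw [hx0]; exact h0
  have hxn : ‖x‖ ≤ 3 := by simpa using hx
  have hxp : 0 < ‖x‖ := norm_pos_iff.2 hx0
  have hcont : ContinuousOn (fun t : ℝ => f (t • x)) (Icc 0 1) := by
    refine hc.comp (by fun_prop) ?_
    intro t ht
    have : |t| * ‖x‖ ≤ 1 * 3 := by
      rw [abs_of_nonneg ht.1]
      exact mul_le_mul ht.2 hxn hxp.le zero_le_one
    simpa [norm_smul] using this
  have hder : ∀ t ∈ Ioo (0 : ℝ) 1, HasDerivAt (fun t : ℝ => f (t • x)) ((fun _ => (0 : ℝ)) t) t := by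
    intro t ht
    have hlt : ‖t • x‖ < 3 := by
      rw [norm_smul, Real.norm_of_nonneg ht.1.le]
      nlinarith [ht.1, ht.2]
    have hmem : t • x ∈ dotB 3 :=
      ⟨by simpa using hlt.le, by simp [ht.1.ne', hx0]⟩
    have hn : B 3 ∈ 𝓝 (t • x) := closedBall_mem_nhds_of_mem (by simpa using hlt)
    have h1 := (diffWithin_of_smooth hf hmem).hasFDerivWithinAt.hasFDerivAt hn
    have h2 : fderivWithin ℝ f (B 3) (t • x) = 0 := hg _ hmem
    rw [h2] at h1
    have h3 : HasDerivAt (fun t : ℝ => t • x) ((1 : ℝ) • x) t := (hasDerivAt_id t).smul_const x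
    exact h1.comp_hasDerivAt t h3
  obtain ⟨c, -, hc⟩ := exists_hasDerivAt_eq_slope (fun t : ℝ => f (t • x)) (fun _ => 0)
    zero_lt_one hcont hder
  simp only [one_smul, zero_smul, h0] at hc
  simpa using hc.symm

theorem MemX.zero : MemX 0 where
  zero_off := by simp
  cont := continuousOn_const
  symm := by simp
  map_zero := rfl
  smooth := contDiffOn_const
  bdd := ⟨1, one_pos, fun x _ => by simp [grad_zero]⟩
  lim := ⟨0, by
    simp only [grad_zero]
    exact fun u hu => Eventually.of_forall fun _ _ _ => refl_mem_uniformity hu⟩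

theorem MemX.add {f g : E3 → ℝ} (hf : MemX f) (hg : MemX g) : MemX (f + g) where
  zero_off x hx := by simp [hf.zero_off x hx, hg.zero_off x hx]
  cont := hf.cont.add hg.cont
  symm A hA x hx := by simp [hf.symm A hA x hx, hg.symm A hA x hx]
  map_zero := by simp [hf.map_zero, hg.map_zero]
  smooth := hf.smooth.add hg.smooth
  bdd := by
    obtain ⟨C, hC, h⟩ := hf.bdd
    obtain ⟨D, hD, k⟩ := hg.bdd
    refine ⟨C + D, add_pos hC hD, fun x hx => ?_⟩
    rw [grad_add hf.smooth hg.smooth hx]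
    exact (norm_add_le _ _).trans (add_le_add (h x hx) (k x hx))
  lim := by
    obtain ⟨G, hG⟩ := hf.lim
    obtain ⟨H, hH⟩ := hg.lim
    refine ⟨G + H, (hG.add hH).congr ?_⟩
    filter_upwards [eventually_small] with t ht x hx
    exact (grad_add hf.smooth hg.smooth (smul_mem_dotB hx ht.1 ht.2)).symm

theorem MemX.smul {f : E3 → ℝ} (c : ℝ) (hf : MemX f) : MemX (c • f) where
  zero_off x hx := by simp [hf.zero_off x hx]
  cont := hf.cont.const_smul c
  symm A hA x hx := by simp [hf.symm A hA x hx]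
  map_zero := by simp [hf.map_zero]
  smooth := hf.smooth.const_smul c
  bdd := by
    obtain ⟨C, hC, h⟩ := hf.bdd
    refine ⟨|c| * C + 1, by positivity, fun x hx => ?_⟩
    rw [grad_smul c hf.smooth hx, norm_smul, Real.norm_eq_abs]
    nlinarith [mul_le_mul_of_nonneg_left (h x hx) (abs_nonneg c)]
  lim := by
    obtain ⟨G, hG⟩ := hf.lim
    refine ⟨fun x => c • G x, ?_⟩
    have := (uniformContinuous_const_smul (M := ℝ) (X := E3 →L[ℝ] ℝ) c).comp_tendstoUniformlyOn hG
    refine this.congr ?_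
    filter_upwards [eventually_small] with t ht x hx
    exact (grad_smul c hf.smooth (smul_mem_dotB hx ht.1 ht.2)).symm

theorem MemY.smooth' {f : E3 → ℝ} (hf : MemY f) : ContDiffOn ℝ 1 f (dotB 3) :=
  hf.smooth.mono sdiff_subset

theorem MemY.zero : MemY 0 where
  zero_off := by simp
  cont := continuousOn_const
  symm := by simp
  map_zero := rfl
  smooth := contDiffOn_const
  bdd := ⟨1, one_pos, fun x _ => by simp [grad_zero]⟩
  lim := ⟨0, by
    simp only [grad_zero, smul_zero]
    exact fun u hu => Eventually.of_forall fun _ _ _ => refl_mem_uniformity hu⟩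

theorem MemY.add {f g : E3 → ℝ} (hf : MemY f) (hg : MemY g) : MemY (f + g) where
  zero_off x hx := by simp [hf.zero_off x hx, hg.zero_off x hx]
  cont := hf.cont.add hg.cont
  symm A hA x hx := by simp [hf.symm A hA x hx, hg.symm A hA x hx]
  map_zero := by simp [hf.map_zero, hg.map_zero]
  smooth := hf.smooth.add hg.smooth
  bdd := by
    obtain ⟨C, hC, h⟩ := hf.bdd
    obtain ⟨D, hD, k⟩ := hg.bdd
    refine ⟨C + D, add_pos hC hD, fun x hx => ?_⟩
    have : grad (f + g) x = grad f x + grad g x :=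
      fderivWithin_add (uniqueDiff_B3 hx) (hf.smooth.differentiableOn one_ne_zero x hx)
        (hg.smooth.differentiableOn one_ne_zero x hx)
    rw [this, add_mul]
    exact (norm_add_le _ _).trans (add_le_add (h x hx) (k x hx))
  lim := by
    obtain ⟨G, hG⟩ := hf.lim
    obtain ⟨H, hH⟩ := hg.lim
    refine ⟨G + H, (hG.add hH).congr ?_⟩
    filter_upwards [eventually_small] with t ht x hx
    show t⁻¹ • grad f (t • x) + t⁻¹ • grad g (t • x) = t⁻¹ • grad (f + g) (t • x)
    rw [grad_add hf.smooth' hg.smooth' (smul_mem_dotB hx ht.1 ht.2), smul_add]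

theorem MemY.smul {f : E3 → ℝ} (c : ℝ) (hf : MemY f) : MemY (c • f) where
  zero_off x hx := by simp [hf.zero_off x hx]
  cont := hf.cont.const_smul c
  symm A hA x hx := by simp [hf.symm A hA x hx]
  map_zero := by simp [hf.map_zero]
  smooth := hf.smooth.const_smul c
  bdd := by
    obtain ⟨C, hC, h⟩ := hf.bdd
    refine ⟨|c| * C + 1, by positivity, fun x hx => ?_⟩
    have : grad (c • f) x = c • grad f x :=
      fderivWithin_const_smul (uniqueDiff_B3 hx) (hf.smooth.differentiableOn one_ne_zero x hx) c
    rw [this, norm_smul, Real.norm_eq_abs]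
    nlinarith [mul_le_mul_of_nonneg_left (h x hx) (abs_nonneg c), norm_nonneg x]
  lim := by
    obtain ⟨G, hG⟩ := hf.lim
    refine ⟨fun x => c • G x, ?_⟩
    have := (uniformContinuous_const_smul (M := ℝ) (X := E3 →L[ℝ] ℝ) c).comp_tendstoUniformlyOn hG
    refine this.congr ?_
    filter_upwards [eventually_small] with t ht x hx
    show c • (t⁻¹ • grad f (t • x)) = t⁻¹ • grad (c • f) (t • x)
    rw [grad_smul c hf.smooth' (smul_mem_dotB hx ht.1 ht.2), smul_comm]

/-- The functions in `X`, as a linear subspace of all functions. -/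
def submoduleX : Submodule ℝ (E3 → ℝ) where
  carrier := {f | MemX f}
  zero_mem' := MemX.zero
  add_mem' := MemX.add
  smul_mem' c _ hf := MemX.smul c hf

/-- The functions in `Y`, as a linear subspace of all functions. -/
def submoduleY : Submodule ℝ (E3 → ℝ) where
  carrier := {f | MemY f}
  zero_mem' := MemY.zero
  add_mem' := MemY.add
  smul_mem' c _ hf := MemY.smul c hf

/-- The space `X`. -/
def SpaceX : Type := submoduleX

/-- The space `Y`. -/
def SpaceY : Type := submoduleY

instance : AddCommGroup SpaceX := inferInstanceAs (AddCommGroup submoduleX)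
instance : Module ℝ SpaceX := inferInstanceAs (Module ℝ submoduleX)
instance : AddCommGroup SpaceY := inferInstanceAs (AddCommGroup submoduleY)
instance : Module ℝ SpaceY := inferInstanceAs (Module ℝ submoduleY)

instance : CoeFun SpaceX (fun _ => E3 → ℝ) := ⟨fun f => f.1⟩
instance : CoeFun SpaceY (fun _ => E3 → ℝ) := ⟨fun f => f.1⟩

/-- `‖f‖_X` is the supremum of `|∇f(x)|` over the punctured ball. -/
instance : Norm SpaceX := ⟨fun f => ⨆ x : dotB 3, ‖grad f x‖⟩

/-- `‖f‖_Y` is the supremum of `|∇f(x)| / |x|` over the punctured ball. -/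
instance : Norm SpaceY := ⟨fun f => ⨆ x : dotB 3, ‖grad f x‖ / ‖(x : E3)‖⟩

theorem bddAboveX (f : SpaceX) : BddAbove (Set.range fun x : dotB 3 => ‖grad f x‖) := by
  obtain ⟨C, -, h⟩ := MemX.bdd f.2
  exact ⟨C, by rintro _ ⟨x, rfl⟩; exact h x x.2⟩

theorem bddAboveY (f : SpaceY) :
    BddAbove (Set.range fun x : dotB 3 => ‖grad f x‖ / ‖(x : E3)‖) := by
  obtain ⟨C, -, h⟩ := MemY.bdd f.2
  refine ⟨C, ?_⟩
  rintro _ ⟨x, rfl⟩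
  exact (div_le_iff₀ (norm_pos_iff.2 x.2.2)).2 (h x x.2.1)

instance : Nonempty (dotB 3) := by
  refine ⟨⟨EuclideanSpace.single 0 1, ?_, ?_⟩⟩
  · simp
  · simp

theorem coreX : NormedSpace.Core ℝ SpaceX where
  norm_nonneg f := Real.iSup_nonneg fun _ => norm_nonneg _
  norm_smul c f := by
    show (⨆ x : dotB 3, ‖grad (c • f.1) x‖) = ‖c‖ * ⨆ x : dotB 3, ‖grad f.1 x‖
    rw [Real.mul_iSup_of_nonneg (norm_nonneg c)]
    refine iSup_congr fun x => ?_
    rw [grad_smul c (MemX.smooth f.2) x.2, norm_smul]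
  norm_triangle f g := by
    refine ciSup_le fun x => ?_
    have h : grad (f.1 + g.1) x = grad f.1 x + grad g.1 x :=
      grad_add (MemX.smooth f.2) (MemX.smooth g.2) x.2
    show ‖grad (f.1 + g.1) x‖ ≤ _
    rw [h]
    exact (norm_add_le _ _).trans (add_le_add (le_ciSup (bddAboveX f) x) (le_ciSup (bddAboveX g) x))
  norm_eq_zero_iff f := by
    constructor
    · intro h
      refine Subtype.ext (eq_zero_of_grad (MemX.zero_off f.2) (MemX.cont f.2) (MemX.map_zero f.2)
        (MemX.smooth f.2) fun x hx => ?_)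
      have := (le_ciSup (bddAboveX f) ⟨x, hx⟩).trans h.le
      exact norm_le_zero_iff.1 this
    · rintro rfl
      show (⨆ x : dotB 3, ‖grad 0 x‖) = 0
      simp [grad_zero]

theorem coreY : NormedSpace.Core ℝ SpaceY where
  norm_nonneg f := Real.iSup_nonneg fun _ => by positivity
  norm_smul c f := by
    show (⨆ x : dotB 3, ‖grad (c • f.1) x‖ / ‖(x : E3)‖)
      = ‖c‖ * ⨆ x : dotB 3, ‖grad f.1 x‖ / ‖(x : E3)‖
    rw [Real.mul_iSup_of_nonneg (norm_nonneg c)]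
    refine iSup_congr fun x => ?_
    rw [grad_smul c (MemY.smooth' f.2) x.2, norm_smul, mul_div_assoc]
  norm_triangle f g := by
    refine ciSup_le fun x => ?_
    have h : grad (f.1 + g.1) x = grad f.1 x + grad g.1 x :=
      grad_add (MemY.smooth' f.2) (MemY.smooth' g.2) x.2
    show ‖grad (f.1 + g.1) x‖ / ‖(x : E3)‖ ≤ _
    rw [h]
    refine (div_le_div_of_nonneg_right (norm_add_le _ _) (norm_nonneg _)).trans ?_
    rw [add_div]
    exact add_le_add (le_ciSup (bddAboveY f) x) (le_ciSup (bddAboveY g) x)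
  norm_eq_zero_iff f := by
    constructor
    · intro h
      refine Subtype.ext (eq_zero_of_grad (MemY.zero_off f.2) (MemY.cont f.2) (MemY.map_zero f.2)
        (MemY.smooth' f.2) fun x hx => ?_)
      have h1 : ‖grad f x‖ / ‖x‖ ≤ 0 := (le_ciSup (bddAboveY f) ⟨x, hx⟩).trans h.le
      rw [div_le_iff₀ (norm_pos_iff.2 hx.2), zero_mul] at h1
      exact norm_le_zero_iff.1 h1
    · rintro rfl
      show (⨆ x : dotB 3, ‖grad 0 x‖ / ‖(x : E3)‖) = 0
      simp [grad_zero]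

instance : NormedAddCommGroup SpaceX := NormedAddCommGroup.ofCore coreX
instance : NormedSpace ℝ SpaceX := NormedSpace.ofCore coreX
instance : NormedAddCommGroup SpaceY := NormedAddCommGroup.ofCore coreY
instance : NormedSpace ℝ SpaceY := NormedSpace.ofCore coreY

/-! ### The ansatz functions and the spherically symmetric steady state -/

/-- The energy profile `φ` with cut-off energy `E0`. -/
structure IsEnergyProfile (φ : ℝ → ℝ) (E0 : ℝ) : Prop where
  nonneg : ∀ E, 0 ≤ φ E
  locLp : ∃ p : ENNReal, 2 < p ∧ ∀ K : Set ℝ, IsCompact K → MemLp φ p (volume.restrict K)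
  zero : ∀ᵐ E, E0 ≤ E → φ E = 0
  pos : ∀ᵐ E, E < E0 → 0 < φ E

/-- The angular momentum profile `ψ`. -/
structure IsAngularProfile (ψ : ℝ → ℝ) : Prop where
  nonneg : ∀ P, 0 ≤ ψ P
  smooth : ContDiff ℝ 2 ψ
  deriv_zero : deriv ψ 0 = 0
  eq_one_iff : ∀ P, ψ P = 1 ↔ P = 0

/-- The phase space density `f₀(x, v) = φ(|v|² / 2 + U₀(x))`. -/
def phaseDensity (φ : ℝ → ℝ) (U0 : E3 → ℝ) (x v : E3) : ℝ := φ (‖v‖ ^ 2 / 2 + U0 x)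

/-- The spatial density `ρ₀(x) = ∫ f₀(x, v) dv`. -/
def density (φ : ℝ → ℝ) (U0 : E3 → ℝ) (x : E3) : ℝ := ∫ v : E3, phaseDensity φ U0 x v

/-- `U₀` is the potential of a nontrivial, spherically symmetric static solution
`(f₀, ρ₀, U₀)` of the Vlasov-Poisson system with `f₀ = φ(E)` and `supp ρ₀ = B 1`.

Since `f₀` is a function of the particle energy, it is constant along the characteristics of the
Vlasov equation, and since it is even in `v` its average velocity vanishes; what remains of the
system is the Poisson equation for the induced density. -/
structure IsSteadyState (φ : ℝ → ℝ) (U0 : E3 → ℝ) : Prop where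
  radial : ∀ x y : E3, ‖x‖ = ‖y‖ → U0 x = U0 y
  potential_smooth : ContDiff ℝ 2 U0
  decay : Tendsto U0 (cocompact E3) (𝓝 0)
  density_smooth : ContDiff ℝ 1 (density φ U0)
  support : tsupport (density φ U0) = B 1
  poisson : ∀ x, Laplacian.laplacian U0 x = 4 * Real.pi * density φ U0 x

/-- The distance to the third axis. -/
def cylRadius (x : E3) : ℝ := √(x 0 ^ 2 + x 1 ^ 2)

/-- The spatial density as a function `h(γ, r, u)` of the parameter `γ`, the distance `r` to the
axis and the value `u` of the potential. -/
def hDens (φ ψ : ℝ → ℝ) (E0 γ r u : ℝ) : ℝ :=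
  if u < E0 then
    2 * Real.pi * ∫ E in u..E0, φ E * ∫ s in (-√(2 * (E - u)))..(√(2 * (E - u))), ψ (γ * r * s)
  else 0

/-- The partial derivative of `h` with respect to its last argument. -/
def dhDens (φ ψ : ℝ → ℝ) (E0 γ r u : ℝ) : ℝ := deriv (fun w => hDens φ ψ E0 γ r w) u

/-! ### Deformations and the operator `T` -/

/-- The direction `x / |x|` (which is zero at the origin). -/
def unitDir (x : E3) : E3 := ‖x‖⁻¹ • x

/-- The deformation `g_ζ(x) = x + ζ(x) x / |x|`, with `g_ζ(0) = 0`. -/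
def deform (ζ : SpaceX) (x : E3) : E3 := x + ζ x • unitDir x

/-- The inverse of `g_ζ` on `B 3`, as a map on the image `g_ζ(B 3)`. -/
def deformInv (ζ : SpaceX) : E3 → E3 := Function.invFunOn (deform ζ) (B 3)

/-- The deformed potential `U_ζ = U₀ ∘ g_ζ⁻¹`. -/
def defPot (U0 : E3 → ℝ) (ζ : SpaceX) (y : E3) : ℝ := U0 (deformInv ζ y)

/-- The density `h(γ, r(y), U_ζ(y))` induced by the deformed potential. -/
def defDensity (φ ψ : ℝ → ℝ) (E0 : ℝ) (U0 : E3 → ℝ) (γ : ℝ) (ζ : SpaceX) (y : E3) : ℝ :=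
  hDens φ ψ E0 γ (cylRadius y) (defPot U0 ζ y)

/-- The value `T(γ, ζ)(x)`. -/
def opT (φ ψ : ℝ → ℝ) (E0 : ℝ) (U0 : E3 → ℝ) (γ : ℝ) (ζ : SpaceX) (x : E3) : ℝ :=
  U0 x + (∫ y in B 2, defDensity φ ψ E0 U0 γ ζ y / ‖deform ζ x - y‖)
    - U0 0 - ∫ y in B 2, defDensity φ ψ E0 U0 γ ζ y / ‖y‖

/-- The integrand of the first term of the derivative; `fderiv ℝ (defPot U0 ζ) y v` is
`∇U_ζ(y) · v`. -/
def dKernel (φ ψ : ℝ → ℝ) (E0 : ℝ) (U0 : E3 → ℝ) (γ : ℝ) (ζ ξ : SpaceX) (x y : E3) : ℝ :=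
  (1 / ‖deform ζ x - y‖ - 1 / ‖y‖) * dhDens φ ψ E0 γ (cylRadius y) (defPot U0 ζ y)
    * fderiv ℝ (defPot U0 ζ) y (unitDir (deformInv ζ y)) * ξ (deformInv ζ y)

/-- The integrand of the (vector valued) integral in the second term of the derivative. -/
def fieldKernel (φ ψ : ℝ → ℝ) (E0 : ℝ) (U0 : E3 → ℝ) (γ : ℝ) (ζ : SpaceX) (x y : E3) : E3 :=
  (defDensity φ ψ E0 U0 γ ζ y / ‖deform ζ x - y‖ ^ 3) • (deform ζ x - y)

/-- The value at `x` of the asserted derivative of `T(γ, ·)` at `ζ` in the direction `ξ`. -/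
def opDT (φ ψ : ℝ → ℝ) (E0 : ℝ) (U0 : E3 → ℝ) (γ : ℝ) (ζ ξ : SpaceX) (x : E3) : ℝ :=
  -(∫ y in B 2, dKernel φ ψ E0 U0 γ ζ ξ x y)
    - inner ℝ (∫ y in B 2, fieldKernel φ ψ E0 U0 γ ζ x y) (unitDir x) * ξ x

end VlasovPoisson

end

open VlasovPoisson

/-!
Write `ρ_{γ,ζ}(y) = h(γ, r(y), U_ζ(y))` for the density induced by the deformed potential. Up to
an additive constant, `T(γ, ζ)` is `U₀` plus the Newtonian potential of `ρ_{γ,ζ}` composed with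
`g_ζ`. The proof separates three questions: how regular `ρ_{γ,ζ}` is, what this says about its
potential, and how potentials composed with deformations behave in the spaces `X` and `Y`.

*The density.* One has `h(γ, r, u) = H(γ r, u)`, and `H` is of class `C¹`. The delicate derivative
is the one in `u`, where `φ(E) / √(E - u)` has to be integrated; since `φ` is locally in `L^p`
with `p > 2` and `1 / √e` is locally in `L^s` for the conjugate exponent `s < 2`, Hölder's
inequality makes the contribution of energies close to `u` small uniformly in `u`
(`profile_rootKer`), which gives continuity of the derivative (`continuous_energyRoot`). A
deformation `g_ζ` with `‖ζ‖ < 1 / 3` is the identity plus a radial field with Lipschitz constant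
`2 ‖ζ‖ < 2 / 3`. It is therefore injective with an inverse that has Lipschitz constant `3`
(`deform_expand`), and its image is found by the intermediate value theorem on rays
(`mem_image_deform`). The gradient of `U_ζ = U₀ ∘ g_ζ⁻¹` is jointly continuous in `ζ` and `y`,
also at the origin, where `∇U₀` vanishes (`continuousOn_dPot_uncurry`). Since `∂_c H(0, u) = 0`,
the kink of `r(y)` on the axis does no harm, and since `U₀ ≥ E₀` outside the unit ball
(`le_potential_of_one_lt`) the density vanishes near the boundary of `B 2`. Hence it is a `C¹`
function with compact support (`contDiff_rho`). Its derivative in the direction `ξ` is a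
continuous function `σ` with `|σ(y)| ≤ C ‖ξ‖ |y|`, because `|ξ(x)| ≤ ‖ξ‖ |x|`.

*The potentials.* Taylor expansions of the kernel `1 / |a|` and of its gradient, in which part of
the smallness is traded for the integrable singularity `|a|^(-5/2)`, give all that is needed. The
potential of a continuous density is `C¹` (`hasFDerivAt_pot`). If moreover `|σ(y)| ≤ M |y|`, its
gradient is differentiable at the origin (`differentiableAt_field_zero`), and its increments
between points of `B R` are controlled with a factor `R` (`field_weighted`). The potential of a
`C¹` density with compact support is `C²` (`contDiff_field`), with a bound by the derivative of
the density. All the densities are symmetric, so the gradients of their potentials vanish at the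
origin (`gradient_zero_of_symm`).

*The spaces.* If `W` is a symmetric `C¹` potential whose gradient `G` is differentiable at the
origin, then `W ∘ g_ζ - W(0)` belongs to `Y` (`memY_compY`), and if `G` is `C¹`, so does the
function `G(g_ζ(x)) · x / |x| ξ(x)` (`memY_pairY`). Applied to `W` the potential of `ρ_{γ,ζ}` or
of `σ`, this puts `T(γ, ζ)` and the two terms of the asserted derivative into `Y`. The differences
of such elements of `Y` are bounded by those of the fields and of the deformations, which gives
the continuity of `T` (`continuousOn_opY`) and of the asserted derivative in the operator norm
(`continuousAt_dOp`).

*Differentiability.* For fixed `x` the real function `s ↦ T(γ, ζ + s ξ)(x)` has the asserted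
derivative (`hasDerivAt_opY_line`). The norm of `f ∈ Y` is controlled by the numbers `M` with
`|f(x) - f(x')| ≤ M R |x - x'|` on `B R` for all `R` (`SpaceY.norm_le_of_lipschitz`); so the mean
value theorem, applied to differences of values at two points, and the continuity of the asserted
derivative yield Fréchet differentiability (`hasFDerivAt_opY`).
-/

noncomputable section

namespace VlasovPoisson

/-! ### The Newtonian kernel -/

/-- The gradient `-a / |a|³` of the Newtonian kernel `1 / |a|`; its value at `a = 0` is zero. -/
def newtonKer (a : E3) : E3 := -(‖a‖⁻¹ ^ 3) • a

/-- The derivative of `newtonKer`, that is, the second derivative of `1 / |a|`; its value at `a = 0`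
is zero. -/
def newtonHess (a : E3) : E3 →L[ℝ] E3 :=
  (-(‖a‖⁻¹ ^ 3)) • ContinuousLinearMap.id ℝ E3 + (3 * ‖a‖⁻¹ ^ 5) • (innerSL ℝ a).smulRight a

/-- The singularity `|a|^(-5/2)`, which is integrable near the origin of the three dimensional
space. It is written with square roots in order to avoid real exponents; its value at `a = 0` is
zero. -/
def sing (a : E3) : ℝ := (√‖a‖)⁻¹ ^ 5

theorem sing_nonneg (a : E3) : 0 ≤ sing a := by unfold sing; positivity

theorem pow_mul_pow_le_add {α β : ℝ} (hα : 0 ≤ α) (hβ : 0 ≤ β) (i j : ℕ) :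
    α ^ i * β ^ j ≤ α ^ (i + j) + β ^ (i + j) := by
  rcases le_total α β with h | h
  · have : α ^ i * β ^ j ≤ β ^ i * β ^ j := by gcongr
    rw [← pow_add] at this
    have h2 : 0 ≤ α ^ (i + j) := by positivity
    linarith
  · have : α ^ i * β ^ j ≤ α ^ i * α ^ j := by gcongr
    rw [← pow_add] at this
    have h2 : 0 ≤ β ^ (i + j) := by positivity
    linarith

theorem inv_norm_eq (a : E3) : ‖a‖⁻¹ = (√‖a‖)⁻¹ ^ 2 := by
  rw [inv_pow, Real.sq_sqrt (norm_nonneg a)]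

theorem inv_norm_le_sing (a : E3) : ‖a‖⁻¹ ≤ 1 + sing a := by
  rw [inv_norm_eq, sing]
  set t := (√‖a‖)⁻¹
  have ht : 0 ≤ t := by positivity
  rcases le_total t 1 with h | h
  · have := pow_le_one₀ (n := 2) ht h
    have : 0 ≤ t ^ 5 := by positivity
    linarith
  · have := pow_le_pow_right₀ h (show 2 ≤ 5 by norm_num)
    linarith

theorem inv_norm_sq_le_sing (a : E3) : ‖a‖⁻¹ ^ 2 ≤ 1 + sing a := by
  rw [inv_norm_eq, sing]
  set t := (√‖a‖)⁻¹
  have ht : 0 ≤ t := by positivity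
  rw [← pow_mul]
  rcases le_total t 1 with h | h
  · have := pow_le_one₀ (n := 4) ht h
    have : 0 ≤ t ^ 5 := by positivity
    norm_num
    linarith
  · have := pow_le_pow_right₀ h (show 2 * 2 ≤ 5 by norm_num)
    linarith

/-- Trading half a power of `‖b - a‖` for an integrable singularity. -/
theorem norm_sub_mul_inv_le {a b : E3} (ha : a ≠ 0) (hb : b ≠ 0) :
    ‖b - a‖ * (‖a‖⁻¹ ^ 2 * ‖b‖⁻¹) ≤ 2 * √‖b - a‖ * (sing a + sing b) := by
  have hA : 0 < √‖a‖ := Real.sqrt_pos.2 (norm_pos_iff.2 ha)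
  have hB : 0 < √‖b‖ := Real.sqrt_pos.2 (norm_pos_iff.2 hb)
  have hw : √‖b - a‖ ≤ √‖a‖ + √‖b‖ := by
    rw [Real.sqrt_le_left (by positivity)]
    have h1 := norm_sub_le b a
    have h2 := Real.sq_sqrt (norm_nonneg a)
    have h3 := Real.sq_sqrt (norm_nonneg b)
    nlinarith
  have h0 : ‖b - a‖ = √‖b - a‖ * √‖b - a‖ := (Real.mul_self_sqrt (norm_nonneg _)).symm
  rw [inv_norm_eq a, inv_norm_eq b, sing, sing]
  rw [h0]
  simp only [Real.sqrt_mul_self (Real.sqrt_nonneg _)]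
  set s := √‖b - a‖
  set A := √‖a‖
  set B := √‖b‖
  have hs : 0 ≤ s := Real.sqrt_nonneg _
  have e1 := pow_mul_pow_le_add (inv_nonneg.2 hA.le) (inv_nonneg.2 hB.le) 3 2
  have e2 := pow_mul_pow_le_add (inv_nonneg.2 hA.le) (inv_nonneg.2 hB.le) 4 1
  calc s * s * ((A⁻¹ ^ 2) ^ 2 * B⁻¹ ^ 2)
      ≤ s * (A + B) * ((A⁻¹ ^ 2) ^ 2 * B⁻¹ ^ 2) := by gcongr
    _ = s * (A⁻¹ ^ 3 * B⁻¹ ^ 2 + A⁻¹ ^ 4 * B⁻¹ ^ 1) := by field_simp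
    _ ≤ s * (2 * (A⁻¹ ^ 5 + B⁻¹ ^ 5)) := by gcongr; linarith
    _ = _ := by ring

theorem norm_sub_mul_inv_le' {a b : E3} (ha : a ≠ 0) (hb : b ≠ 0) :
    ‖b - a‖ * (‖a‖⁻¹ * ‖b‖⁻¹ ^ 2) ≤ 2 * √‖b - a‖ * (sing a + sing b) := by
  have := norm_sub_mul_inv_le hb ha
  rw [norm_sub_rev] at this
  linarith

theorem abs_inv_norm_sub_le {a b : E3} (ha : a ≠ 0) (hb : b ≠ 0) :
    |‖b‖⁻¹ - ‖a‖⁻¹| ≤ ‖b - a‖ * (‖a‖⁻¹ * ‖b‖⁻¹) := by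
  have hA : 0 < ‖a‖ := norm_pos_iff.2 ha
  have hB : 0 < ‖b‖ := norm_pos_iff.2 hb
  have : ‖b‖⁻¹ - ‖a‖⁻¹ = (‖a‖ - ‖b‖) * (‖a‖⁻¹ * ‖b‖⁻¹) := by field_simp
  rw [this, abs_mul, abs_of_nonneg (show 0 ≤ ‖a‖⁻¹ * ‖b‖⁻¹ by positivity)]
  gcongr
  rw [norm_sub_rev]
  exact abs_norm_sub_norm_le a b

theorem abs_inv_norm_sub_le_sing {a b : E3} (ha : a ≠ 0) (hb : b ≠ 0) :
    |‖b‖⁻¹ - ‖a‖⁻¹| ≤ ‖b - a‖ * (2 + sing a + sing b) := by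
  refine (abs_inv_norm_sub_le ha hb).trans ?_
  gcongr
  have h1 := inv_norm_sq_le_sing a
  have h2 := inv_norm_sq_le_sing b
  nlinarith [sq_nonneg (‖a‖⁻¹ - ‖b‖⁻¹), sing_nonneg a, sing_nonneg b]

theorem inner_newtonKer (a w : E3) : inner ℝ (newtonKer a) w = -(‖a‖⁻¹ ^ 3) * inner ℝ a w := by
  simp [newtonKer, inner_smul_left]

theorem newtonHess_apply (a w : E3) : newtonHess a w =
    -(‖a‖⁻¹ ^ 3) • w + (3 * ‖a‖⁻¹ ^ 5 * inner ℝ a w) • a := by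
  simp [newtonHess, mul_smul]

/-- The first order Taylor estimate for `1 / |a|`, valid for arbitrary nonzero points: the segment
between them may pass through the origin. -/
theorem inv_norm_taylor {a b : E3} (ha : a ≠ 0) (hb : b ≠ 0) :
    |‖b‖⁻¹ - ‖a‖⁻¹ - inner ℝ (newtonKer a) (b - a)| ≤ 3 * ‖b - a‖ ^ 2 * (‖a‖⁻¹ ^ 2 * ‖b‖⁻¹) := by
  have hA : 0 < ‖a‖ := norm_pos_iff.2 ha
  have hB : 0 < ‖b‖ := norm_pos_iff.2 hb
  have hb2 : ‖b‖ ^ 2 = ‖a‖ ^ 2 + 2 * inner ℝ a (b - a) + ‖b - a‖ ^ 2 := by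
    rw [← norm_add_sq_real]; simp
  have hip := abs_real_inner_le_norm a (b - a)
  have hd : |‖b‖ - ‖a‖| ≤ ‖b - a‖ := abs_norm_sub_norm_le b a
  rw [inner_newtonKer]
  set ip : ℝ := inner ℝ a (b - a)
  set W := ‖b - a‖
  set A := ‖a‖
  set B := ‖b‖
  have hW : 0 ≤ W := norm_nonneg _
  have key : B⁻¹ - A⁻¹ - -(A⁻¹ ^ 3) * ip
      = (-(W ^ 2 * A ^ 2) + ip * ((B - A) * (B + 2 * A))) / (A ^ 3 * B * (A + B)) := by
    field_simp
    linear_combination (-A ^ 2) * hb2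
  have hn : |-(W ^ 2 * A ^ 2) + ip * ((B - A) * (B + 2 * A))| ≤ 3 * W ^ 2 * A * (A + B) := by
    have h1 : |ip * ((B - A) * (B + 2 * A))| ≤ (A * W) * (W * (2 * (A + B))) := by
      rw [abs_mul, abs_mul]
      gcongr
      rw [abs_of_pos (by positivity)]
      linarith
    have h2 : |-(W ^ 2 * A ^ 2)| = W ^ 2 * A ^ 2 := by rw [abs_neg, abs_of_nonneg (by positivity)]
    refine (abs_add_le _ _).trans ?_
    rw [h2]
    have : 0 ≤ W ^ 2 * (A * B) := by positivity
    nlinarith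
  rw [key, abs_div, abs_of_pos (show 0 < A ^ 3 * B * (A + B) by positivity),
    div_le_iff₀ (by positivity)]
  refine hn.trans (le_of_eq ?_)
  field_simp

/-- The first order Taylor estimate for `1 / |a|` with an integrable majorant: the remainder is of
order `3 / 2`, which is enough for differentiability of potentials. -/
theorem inv_norm_taylor_sing {a b : E3} (ha : a ≠ 0) (hb : b ≠ 0) :
    |‖b‖⁻¹ - ‖a‖⁻¹ - inner ℝ (newtonKer a) (b - a)| ≤ 6 * (‖b - a‖ * √‖b - a‖)
      * (sing a + sing b) := by
  refine (inv_norm_taylor ha hb).trans ?_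
  have := norm_sub_mul_inv_le ha hb
  nlinarith [mul_le_mul_of_nonneg_left this (norm_nonneg (b - a))]

theorem norm_newtonKer (a : E3) : ‖newtonKer a‖ = ‖a‖⁻¹ ^ 2 := by
  rw [newtonKer, norm_smul, norm_neg, Real.norm_of_nonneg (by positivity)]
  by_cases h : ‖a‖ = 0
  · simp [h]
  · field_simp

/-- The difference of the kernels is estimated by means of the inversion `a ↦ a / |a|²`, for which
the distance of the images is known exactly. -/
theorem norm_newtonKer_sub_le {a b : E3} (ha : a ≠ 0) (hb : b ≠ 0) :
    ‖newtonKer b - newtonKer a‖ ≤ ‖b - a‖ * (‖a‖⁻¹ ^ 2 * ‖b‖⁻¹ + ‖a‖⁻¹ * ‖b‖⁻¹ ^ 2) := by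
  have hA : 0 < ‖a‖ := norm_pos_iff.2 ha
  have hB : 0 < ‖b‖ := norm_pos_iff.2 hb
  have h1 : newtonKer b - newtonKer a = -(‖a‖⁻¹ • ((‖b‖⁻¹ ^ 2) • b - (‖a‖⁻¹ ^ 2) • a)
      + (‖b‖⁻¹ - ‖a‖⁻¹) • ((‖b‖⁻¹ ^ 2) • b)) := by
    unfold newtonKer
    module
  have h2 : ‖(‖b‖⁻¹ ^ 2) • b - (‖a‖⁻¹ ^ 2) • a‖ = ‖b - a‖ * (‖a‖⁻¹ * ‖b‖⁻¹) := by
    have := dist_div_norm_sq_smul hb ha 1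
    rw [dist_eq_norm, dist_eq_norm] at this
    simp only [one_div] at this
    rw [this]
    field_simp
  have h3 : ‖(‖b‖⁻¹ ^ 2) • b‖ = ‖b‖⁻¹ := by
    rw [norm_smul, Real.norm_of_nonneg (by positivity)]; field_simp
  rw [h1, norm_neg]
  refine (norm_add_le _ _).trans ?_
  rw [norm_smul, norm_smul, h2, h3, Real.norm_eq_abs,
    Real.norm_eq_abs, abs_of_pos (inv_pos.2 hA)]
  have := mul_le_mul_of_nonneg_right (abs_inv_norm_sub_le ha hb) (inv_pos.2 hB).le
  nlinarith

theorem norm_newtonKer_sub_le_sing {a b : E3} (ha : a ≠ 0) (hb : b ≠ 0) :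
    ‖newtonKer b - newtonKer a‖ ≤ 4 * √‖b - a‖ * (sing a + sing b) := by
  have h := norm_newtonKer_sub_le ha hb
  have h1 := norm_sub_mul_inv_le ha hb
  have h2 := norm_sub_mul_inv_le' ha hb
  linarith

/-- The first order Taylor estimate for the gradient of `1 / |a|`. The remainder alone has a
singularity that is not integrable; the weight `|a|` makes up for one power. -/
theorem newtonKer_taylor {a b : E3} (ha : a ≠ 0) (hb : b ≠ 0) :
    ‖a‖ * ‖newtonKer b - newtonKer a - newtonHess a (b - a)‖
      ≤ 60 * (‖b - a‖ * √‖b - a‖) * (sing a + sing b) := by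
  have hA : 0 < ‖a‖ := norm_pos_iff.2 ha
  have hB : 0 < ‖b‖ := norm_pos_iff.2 hb
  have hK := inv_norm_taylor ha hb
  rw [inner_newtonKer] at hK
  have hD := abs_inv_norm_sub_le ha hb
  have hip := abs_real_inner_le_norm a (b - a)
  have hpA : ‖a‖ = (‖a‖⁻¹)⁻¹ := (inv_inv _).symm
  have hqB : ‖b‖ = (‖b‖⁻¹)⁻¹ := (inv_inv _).symm
  have s1 := norm_sub_mul_inv_le ha hb
  have s2 := norm_sub_mul_inv_le' ha hb
  set ip : ℝ := inner ℝ a (b - a) with hipdef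
  set w := b - a with hw
  set p := ‖a‖⁻¹ with hp
  set q := ‖b‖⁻¹ with hq
  have hp0 : 0 < p := inv_pos.2 hA
  have hq0 : 0 < q := inv_pos.2 hB
  have hW : 0 ≤ ‖w‖ := norm_nonneg _
  set c := q ^ 3 - p ^ 3 + 3 * ip * p ^ 5 with hc
  have hcb : |c| ≤ ‖w‖ ^ 2 * (p ^ 2 * q ^ 2 * (q + 2 * p) + 9 * p ^ 4 * q) := by
    have : c = (q - p) ^ 2 * (q + 2 * p) + 3 * p ^ 2 * (q - p - -p ^ 3 * ip) := by
      rw [hc]; ring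
    rw [this]
    refine (abs_add_le _ _).trans ?_
    rw [abs_mul, abs_mul, abs_of_pos (show 0 < q + 2 * p by positivity),
      abs_of_pos (show 0 < 3 * p ^ 2 by positivity), abs_pow]
    calc |q - p| ^ 2 * (q + 2 * p) + 3 * p ^ 2 * |q - p - -p ^ 3 * ip|
        ≤ (‖w‖ * (p * q)) ^ 2 * (q + 2 * p) + 3 * p ^ 2 * (3 * ‖w‖ ^ 2 * (p ^ 2 * q)) := by
          gcongr
      _ = _ := by ring
  -- The difference is expanded in `a` and `w` if `‖a‖ ≤ ‖b‖`, in `b` and `w` if `‖b‖ ≤ ‖a‖`, so that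
  -- the coefficient `c` multiplies the shorter of the two vectors.
  have hmain : ‖a‖ * ‖newtonKer b - newtonKer a - newtonHess a w‖
      ≤ 15 * ‖w‖ ^ 2 * (p ^ 2 * q + p * q ^ 2) := by
    rcases le_total q p with hqp | hpq
    · have e1 : newtonKer b - newtonKer a - newtonHess a w
          = -((q ^ 3 - p ^ 3) • w + c • a) := by
        have : b = a + w := by rw [hw]; abel
        rw [newtonHess_apply, newtonKer, newtonKer, ← hp, ← hq, this, hc, hipdef]
        module
      have e2 : |q ^ 3 - p ^ 3| ≤ ‖w‖ * (p * q) * (q ^ 2 + q * p + p ^ 2) := by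
        have : q ^ 3 - p ^ 3 = (q - p) * (q ^ 2 + q * p + p ^ 2) := by ring
        rw [this, abs_mul, abs_of_pos (show 0 < q ^ 2 + q * p + p ^ 2 by positivity)]
        gcongr
      have e3 : ‖newtonKer b - newtonKer a - newtonHess a w‖
          ≤ ‖w‖ * (p * q) * (q ^ 2 + q * p + p ^ 2) * ‖w‖
            + ‖w‖ ^ 2 * (p ^ 2 * q ^ 2 * (q + 2 * p) + 9 * p ^ 4 * q) * ‖a‖ := by
        rw [e1, norm_neg]
        refine (norm_add_le _ _).trans ?_
        rw [norm_smul, norm_smul, Real.norm_eq_abs,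
          Real.norm_eq_abs]
        gcongr
      refine (mul_le_mul_of_nonneg_left e3 hA.le).trans ?_
      rw [hpA]
      have : p⁻¹ * (‖w‖ * (p * q) * (q ^ 2 + q * p + p ^ 2) * ‖w‖
            + ‖w‖ ^ 2 * (p ^ 2 * q ^ 2 * (q + 2 * p) + 9 * p ^ 4 * q) * p⁻¹)
          = ‖w‖ ^ 2 * (2 * q ^ 2 * q + 3 * p * q ^ 2 + 10 * p ^ 2 * q) := by
        field_simp; ring
      rw [this]
      have h5 : q ^ 2 * q ≤ p * q ^ 2 := by nlinarith [sq_nonneg q]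
      have h6 : 0 ≤ p ^ 2 * q := by positivity
      have h7 : 0 ≤ p * q ^ 2 := by positivity
      have : 2 * q ^ 2 * q + 3 * p * q ^ 2 + 10 * p ^ 2 * q ≤ 15 * (p ^ 2 * q + p * q ^ 2) := by
        linarith
      refine (mul_le_mul_of_nonneg_left this (sq_nonneg ‖w‖)).trans (le_of_eq (by ring))
    · have e1 : newtonKer b - newtonKer a - newtonHess a w
          = -(c • b + (-(3 * ip * p ^ 5)) • w) := by
        have : b = a + w := by rw [hw]; abel
        rw [newtonHess_apply, newtonKer, newtonKer, ← hp, ← hq, this, hc, hipdef]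
        module
      have e2 : |-(3 * ip * p ^ 5)| ≤ 3 * (‖a‖ * ‖w‖) * p ^ 5 := by
        rw [abs_neg, abs_mul, abs_mul, abs_of_pos (show (0 : ℝ) < 3 by norm_num),
          abs_of_pos (show 0 < p ^ 5 by positivity)]
        gcongr
      have e3 : ‖newtonKer b - newtonKer a - newtonHess a w‖
          ≤ ‖w‖ ^ 2 * (p ^ 2 * q ^ 2 * (q + 2 * p) + 9 * p ^ 4 * q) * ‖b‖
            + 3 * (‖a‖ * ‖w‖) * p ^ 5 * ‖w‖ := by
        rw [e1, norm_neg]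
        refine (norm_add_le _ _).trans ?_
        rw [norm_smul, norm_smul, Real.norm_eq_abs,
          Real.norm_eq_abs]
        gcongr
      refine (mul_le_mul_of_nonneg_left e3 hA.le).trans ?_
      rw [hpA, hqB]
      have : p⁻¹ * (‖w‖ ^ 2 * (p ^ 2 * q ^ 2 * (q + 2 * p) + 9 * p ^ 4 * q) * q⁻¹
            + 3 * (p⁻¹ * ‖w‖) * p ^ 5 * ‖w‖)
          = ‖w‖ ^ 2 * (p * q ^ 2 + 2 * p ^ 2 * q + 12 * (p ^ 2 * p)) := by
        field_simp; ring
      rw [this]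
      have h5 : p ^ 2 * p ≤ p ^ 2 * q := by gcongr
      have h6 : 0 ≤ p ^ 2 * q := by positivity
      have h7 : 0 ≤ p * q ^ 2 := by positivity
      have : p * q ^ 2 + 2 * p ^ 2 * q + 12 * (p ^ 2 * p) ≤ 15 * (p ^ 2 * q + p * q ^ 2) := by
        linarith
      refine (mul_le_mul_of_nonneg_left this (sq_nonneg ‖w‖)).trans (le_of_eq (by ring))
  refine hmain.trans ?_
  calc 15 * ‖w‖ ^ 2 * (p ^ 2 * q + p * q ^ 2)
      = 15 * ‖w‖ * (‖w‖ * (p ^ 2 * q) + ‖w‖ * (p * q ^ 2)) := by ring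
    _ ≤ 15 * ‖w‖ * (2 * √‖w‖ * (sing a + sing b) + 2 * √‖w‖ * (sing a + sing b)) := by gcongr
    _ = _ := by ring

/-! ### Integrals with an integrable singularity -/

theorem integrableOn_sing_ball : IntegrableOn (sing : E3 → ℝ) (ball 0 1) := by
  have := integrableOn_fun_norm_addHaar (E := E3) volume (f := fun t => (√t)⁻¹ ^ 5) (r := 1)
  refine this.2 ?_
  have h : IntegrableOn (fun x : ℝ => x ^ (-(1 / 2) : ℝ)) (Ioo 0 1) :=
    (intervalIntegral.integrableOn_Ioo_rpow_iff one_pos).2 (by norm_num)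
  refine h.congr_fun (fun x hx => ?_) measurableSet_Ioo
  have h0 : 0 < √x := Real.sqrt_pos.2 hx.1
  have h1 : x = √x ^ 2 := (Real.sq_sqrt hx.1.le).symm
  simp only [finrank_euclideanSpace, Fintype.card_fin, smul_eq_mul]
  rw [Real.rpow_neg hx.1.le, ← Real.sqrt_eq_rpow]
  rw [show x ^ (3 - 1) = (√x ^ 2) ^ 2 by rw [← h1]]
  field_simp

/-- The singularity `sing` restricted to the unit ball; it is integrable on the whole space. -/
def singTrunc (a : E3) : ℝ := (ball (0 : E3) 1).indicator sing a

theorem integrable_singTrunc : Integrable singTrunc :=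
  (integrable_indicator_iff measurableSet_ball).2 integrableOn_sing_ball

theorem sing_le_singTrunc (a : E3) : sing a ≤ singTrunc a + 1 := by
  unfold singTrunc
  by_cases h : a ∈ ball (0 : E3) 1
  · rw [indicator_of_mem h]; linarith
  · rw [indicator_of_notMem h, sing]
    have h1 : 1 ≤ ‖a‖ := by simpa using h
    have h2 : 1 ≤ √‖a‖ := by rwa [Real.one_le_sqrt]
    have := pow_le_one₀ (n := 5) (by positivity) (inv_le_one_of_one_le₀ h2)
    linarith

theorem singTrunc_nonneg (a : E3) : 0 ≤ singTrunc a :=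
  indicator_nonneg (fun a _ => sing_nonneg a) a

theorem measurable_sing : Measurable sing := by
  unfold sing; fun_prop

/-- The volume of the ball `B 2`, on which the densities live. -/
def ballVol : ℝ := volume.real (B 2)

theorem ballVol_nonneg : 0 ≤ ballVol := measureReal_nonneg

/-- A bound for the integrals of `sing (z - y)` over `y ∈ B 2`, uniformly in `z`. -/
def singC : ℝ := (∫ a, singTrunc a) + ballVol

theorem volume_B2_lt_top : volume (B 2) < ⊤ := (isCompact_closedBall _ _).measure_lt_top

theorem singC_nonneg : 0 ≤ singC :=
  add_nonneg (integral_nonneg singTrunc_nonneg) ballVol_nonneg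

theorem integrableOn_const_B2 {F : Type*} [NormedAddCommGroup F] (c : F) :
    IntegrableOn (fun _ : E3 => c) (B 2) :=
  integrableOn_const volume_B2_lt_top.ne

theorem integrableOn_sing (z : E3) : IntegrableOn (fun y => sing (z - y)) (B 2) := by
  refine Integrable.mono' (g := fun y => singTrunc (z - y) + 1) ?_ ?_ ?_
  · exact ((integrable_singTrunc.comp_sub_left z).integrableOn).add (integrableOn_const_B2 1)
  · exact (measurable_sing.comp (measurable_const.sub measurable_id)).aestronglyMeasurable
  · refine Eventually.of_forall fun y => ?_
    rw [Real.norm_of_nonneg (sing_nonneg _)]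
    exact sing_le_singTrunc _

theorem integral_sing_le (z : E3) : ∫ y in B 2, sing (z - y) ≤ singC := by
  have hi : IntegrableOn (fun y => singTrunc (z - y)) (B 2) :=
    (integrable_singTrunc.comp_sub_left z).integrableOn
  calc ∫ y in B 2, sing (z - y) ≤ ∫ y in B 2, (singTrunc (z - y) + 1) :=
        integral_mono (integrableOn_sing z) (hi.add (integrableOn_const_B2 1))
          fun y => sing_le_singTrunc _
    _ = (∫ y in B 2, singTrunc (z - y)) + ballVol := by
        rw [integral_add hi (integrableOn_const_B2 1)]; simp [ballVol]
    _ ≤ (∫ y, singTrunc (z - y)) + ballVol := by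
        gcongr ?_ + _
        exact setIntegral_le_integral (integrable_singTrunc.comp_sub_left z)
          (Eventually.of_forall fun y => singTrunc_nonneg _)
    _ = singC := by rw [integral_sub_left_eq_self singTrunc volume z, singC]

section Bounds
variable {F : Type*} [NormedAddCommGroup F]

theorem ae_ne_pair (z z' : E3) : ∀ᵐ y ∂(volume.restrict (B 2)),
    y ∈ B 2 ∧ z - y ≠ 0 ∧ z' - y ≠ 0 := by
  have h1 : ∀ᵐ y ∂(volume.restrict (B 2)), y ≠ z := by
    simp [ae_iff, measure_singleton]
  have h2 : ∀ᵐ y ∂(volume.restrict (B 2)), y ≠ z' := by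
    simp [ae_iff, measure_singleton]
  filter_upwards [h1, h2, ae_restrict_mem measurableSet_closedBall] with y h1 h2 h3
  exact ⟨h3, sub_ne_zero.2 h1.symm, sub_ne_zero.2 h2.symm⟩

theorem integrableOn_sing_bound (z z' : E3) (c₀ c₁ : ℝ) :
    IntegrableOn (fun y => c₀ + c₁ * (sing (z - y) + sing (z' - y))) (B 2) :=
  (integrableOn_const_B2 c₀).add
    (((integrableOn_sing z).add (integrableOn_sing z')).const_mul c₁)

/-- Integrals with singularities at two points are bounded uniformly in the position of these
points. This turns each pointwise estimate of the Newtonian kernel into an estimate of a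
potential. -/
theorem norm_integral_le_sing [NormedSpace ℝ F] {f : E3 → F} (z z' : E3) {c₀ c₁ : ℝ} (hc : 0 ≤ c₁)
    (h : ∀ y ∈ B 2, z - y ≠ 0 → z' - y ≠ 0 → ‖f y‖ ≤ c₀ + c₁ * (sing (z - y) + sing (z' - y))) :
    ‖∫ y in B 2, f y‖ ≤ c₀ * ballVol + c₁ * (2 * singC) := by
  have hI := integrableOn_sing_bound z z' c₀ c₁
  have hs : IntegrableOn (fun y => sing (z - y) + sing (z' - y)) (B 2) :=
    (integrableOn_sing z).add (integrableOn_sing z')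
  refine (norm_integral_le_of_norm_le hI ?_).trans ?_
  · filter_upwards [ae_ne_pair z z'] with y hy using h y hy.1 hy.2.1 hy.2.2
  · have e : ∫ y in B 2, (c₀ + c₁ * (sing (z - y) + sing (z' - y)))
        = c₀ * ballVol + c₁ * ((∫ y in B 2, sing (z - y)) + ∫ y in B 2, sing (z' - y)) := by
      rw [integral_add (integrableOn_const_B2 c₀) (hs.const_mul c₁), integral_const_mul,
        integral_add (integrableOn_sing z) (integrableOn_sing z')]
      simp [ballVol, mul_comm]
    rw [e]
    gcongr
    linarith [integral_sing_le z, integral_sing_le z']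

theorem integrableOn_of_le_sing {f : E3 → F} (z z' : E3) {c₀ c₁ : ℝ}
    (hf : AEStronglyMeasurable f (volume.restrict (B 2)))
    (h : ∀ y ∈ B 2, z - y ≠ 0 → z' - y ≠ 0 → ‖f y‖ ≤ c₀ + c₁ * (sing (z - y) + sing (z' - y))) :
    IntegrableOn f (B 2) := by
  refine (integrableOn_sing_bound z z' c₀ c₁).mono' hf ?_
  filter_upwards [ae_ne_pair z z'] with y hy using h y hy.1 hy.2.1 hy.2.2

/-- A remainder of order `3 / 2` gives differentiability. -/
theorem hasFDerivAt_of_sqrt_bound [NormedSpace ℝ F] {f : E3 → F} {A : E3 →L[ℝ] F} {z : E3} {C : ℝ}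
    (h : ∀ z', ‖f z' - f z - A (z' - z)‖ ≤ C * (‖z' - z‖ * √‖z' - z‖)) : HasFDerivAt f A z := by
  rw [hasFDerivAt_iff_isLittleO]
  have h1 : (fun z' => f z' - f z - A (z' - z)) =O[𝓝 z] fun z' => √‖z' - z‖ * ‖z' - z‖ := by
    refine Asymptotics.IsBigO.of_bound C (Eventually.of_forall fun z' => (h z').trans (le_of_eq ?_))
    rw [Real.norm_of_nonneg (by positivity), mul_comm (√‖z' - z‖)]
  refine h1.trans_isLittleO ?_
  have h2 : (fun z' : E3 => √‖z' - z‖) =o[𝓝 z] fun _ => (1 : ℝ) := by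
    rw [Asymptotics.isLittleO_one_iff]
    have : Continuous fun z' : E3 => √‖z' - z‖ := by fun_prop
    simpa using this.tendsto z
  have h3 := h2.mul_isBigO (Asymptotics.isBigO_refl (fun z' : E3 => ‖z' - z‖) (𝓝 z))
  simp only [one_mul] at h3
  exact h3.of_norm_right

end Bounds

/-! ### Newtonian potentials -/

/-- The potential of a density on `B 2`, without the minus sign that is usual in physics. -/
def pot (σ : E3 → ℝ) (z : E3) : ℝ := ∫ y in B 2, σ y / ‖z - y‖

/-- The gradient of the potential of a density on `B 2`, see `hasFDerivAt_pot`. -/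
def field (σ : E3 → ℝ) (z : E3) : E3 := ∫ y in B 2, σ y • newtonKer (z - y)

theorem measurable_newtonKer : Measurable newtonKer := by
  unfold newtonKer
  fun_prop

theorem measurable_newtonHess : Measurable newtonHess := by
  unfold newtonHess
  have h : Continuous fun a : E3 => (innerSL ℝ a).smulRight a :=
    isBoundedBilinearMap_smulRight.continuous.comp
      ((innerSL ℝ).continuous.prodMk continuous_id)
  exact ((by fun_prop : Measurable fun a : E3 => -(‖a‖⁻¹ ^ 3)).smul measurable_const).add
    ((by fun_prop : Measurable fun a : E3 => 3 * ‖a‖⁻¹ ^ 5).smul h.measurable)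

section Potential
variable {σ τ : E3 → ℝ} {M : ℝ}

theorem aesm_B2 {F : Type*} [NormedAddCommGroup F] {σ : E3 → F} (hσ : ContinuousOn σ (B 2)) :
    AEStronglyMeasurable σ (volume.restrict (B 2)) :=
  hσ.aestronglyMeasurable measurableSet_closedBall

theorem aesm_field (hσ : ContinuousOn σ (B 2)) (z : E3) :
    AEStronglyMeasurable (fun y => σ y • newtonKer (z - y)) (volume.restrict (B 2)) :=
  (aesm_B2 hσ).smul
    (measurable_newtonKer.comp (measurable_const.sub measurable_id)).aestronglyMeasurable

theorem exists_bound_B2 (hσ : ContinuousOn σ (B 2)) : ∃ M, 0 ≤ M ∧ ∀ y ∈ B 2, |σ y| ≤ M := by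
  obtain ⟨M, hM⟩ := (isCompact_closedBall (0 : E3) 2).exists_bound_of_continuousOn hσ
  exact ⟨M, (norm_nonneg _).trans (hM 0 (by simp)), hM⟩

theorem integrableOn_pot (hσ : ContinuousOn σ (B 2)) (z : E3) :
    IntegrableOn (fun y => σ y / ‖z - y‖) (B 2) := by
  obtain ⟨M, hM0, hM⟩ := exists_bound_B2 hσ
  refine integrableOn_of_le_sing z z (c₀ := M) (c₁ := M) ?_ ?_
  · simp only [div_eq_mul_inv]
    exact (aesm_B2 hσ).mul (by fun_prop : Measurable fun y : E3 => ‖z - y‖⁻¹).aestronglyMeasurable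
  · intro y hy _ _
    rw [Real.norm_eq_abs, abs_div, abs_norm, div_eq_mul_inv]
    have h1 := inv_norm_le_sing (z - y)
    have h2 := sing_nonneg (z - y)
    calc |σ y| * ‖z - y‖⁻¹ ≤ M * (1 + sing (z - y)) := by gcongr; exact hM y hy
      _ ≤ _ := by nlinarith

theorem integrableOn_field (hσ : ContinuousOn σ (B 2)) (z : E3) :
    IntegrableOn (fun y => σ y • newtonKer (z - y)) (B 2) := by
  obtain ⟨M, hM0, hM⟩ := exists_bound_B2 hσ
  refine integrableOn_of_le_sing z z (c₀ := M) (c₁ := M) (aesm_field hσ z) ?_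
  intro y hy _ _
  rw [norm_smul, norm_newtonKer, Real.norm_eq_abs]
  have h1 := inv_norm_sq_le_sing (z - y)
  have h2 := sing_nonneg (z - y)
  calc |σ y| * ‖z - y‖⁻¹ ^ 2 ≤ M * (1 + sing (z - y)) := by gcongr; exact hM y hy
    _ ≤ _ := by nlinarith

theorem pot_sub (hσ : ContinuousOn σ (B 2)) (hτ : ContinuousOn τ (B 2)) (z : E3) :
    pot (fun y => σ y - τ y) z = pot σ z - pot τ z := by
  unfold pot
  rw [← integral_sub (integrableOn_pot hσ z) (integrableOn_pot hτ z)]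
  simp only [sub_div]

theorem field_sub (hσ : ContinuousOn σ (B 2)) (hτ : ContinuousOn τ (B 2)) (z : E3) :
    field (fun y => σ y - τ y) z = field σ z - field τ z := by
  unfold field
  rw [← integral_sub (integrableOn_field hσ z) (integrableOn_field hτ z)]
  simp only [sub_smul]

theorem pot_lipschitz (hσ : ContinuousOn σ (B 2)) (hM0 : 0 ≤ M) (hM : ∀ y ∈ B 2, |σ y| ≤ M)
    (z z' : E3) : |pot σ z' - pot σ z| ≤ M * (2 * ballVol + 2 * singC) * ‖z' - z‖ := by
  unfold pot
  rw [← integral_sub (integrableOn_pot hσ z') (integrableOn_pot hσ z), ← Real.norm_eq_abs]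
  refine (norm_integral_le_sing z z' (c₀ := M * ‖z' - z‖ * 2) (c₁ := M * ‖z' - z‖)
    (by positivity) fun y hy h1 h2 => ?_).trans (le_of_eq (by ring))
  rw [div_eq_mul_inv, div_eq_mul_inv, ← mul_sub, Real.norm_eq_abs, abs_mul]
  have := abs_inv_norm_sub_le_sing h1 h2
  rw [show z' - y - (z - y) = z' - z by abel] at this
  calc |σ y| * |‖z' - y‖⁻¹ - ‖z - y‖⁻¹|
      ≤ M * (‖z' - z‖ * (2 + sing (z - y) + sing (z' - y))) := by gcongr; exact hM y hy
    _ = _ := by ring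

/-- The potential of a continuous density is differentiable everywhere, with gradient `field`. -/
theorem hasFDerivAt_pot (hσ : ContinuousOn σ (B 2)) (z : E3) :
    HasFDerivAt (pot σ) (innerSL ℝ (field σ z)) z := by
  obtain ⟨M, hM0, hM⟩ := exists_bound_B2 hσ
  refine hasFDerivAt_of_sqrt_bound (C := M * 12 * singC) fun z' => ?_
  have e : pot σ z' - pot σ z - innerSL ℝ (field σ z) (z' - z)
      = ∫ y in B 2, σ y * (‖z' - y‖⁻¹ - ‖z - y‖⁻¹ - inner ℝ (newtonKer (z - y)) (z' - z)) := by
    have hi := integrableOn_field hσ z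
    have h1 : innerSL ℝ (field σ z) (z' - z)
        = ∫ y in B 2, inner ℝ (z' - z) (σ y • newtonKer (z - y)) := by
      rw [integral_inner hi, innerSL_apply_apply, real_inner_comm, field]
    have h2 : IntegrableOn (fun y => inner ℝ (z' - z) (σ y • newtonKer (z - y))) (B 2) :=
      hi.const_inner _
    have h3 : IntegrableOn (fun y => σ y / ‖z' - y‖ - σ y / ‖z - y‖) (B 2) :=
      (integrableOn_pot hσ z').sub (integrableOn_pot hσ z)
    rw [h1, pot, pot, ← integral_sub (integrableOn_pot hσ z') (integrableOn_pot hσ z),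
      ← integral_sub h3 h2]
    congr 1
    funext y
    rw [inner_smul_right, real_inner_comm]
    ring
  rw [e]
  refine (norm_integral_le_sing z z' (c₀ := 0) (c₁ := M * (6 * (‖z' - z‖ * √‖z' - z‖)))
    (by positivity) ?_).trans (le_of_eq (by ring))
  intro y hy h1 h2
  rw [Real.norm_eq_abs, abs_mul]
  have := inv_norm_taylor_sing h1 h2
  rw [show z' - y - (z - y) = z' - z by abel] at this
  calc _ ≤ M * (6 * (‖z' - z‖ * √‖z' - z‖) * (sing (z - y) + sing (z' - y))) := by
        gcongr; exact hM y hy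
    _ = _ := by ring

/-- The field of a bounded density is Hölder continuous with exponent `1 / 2`. -/
theorem field_holder (hσ : ContinuousOn σ (B 2)) (hM0 : 0 ≤ M) (hM : ∀ y ∈ B 2, |σ y| ≤ M)
    (z z' : E3) : ‖field σ z' - field σ z‖ ≤ M * 8 * singC * √‖z' - z‖ := by
  unfold field
  rw [← integral_sub (integrableOn_field hσ z') (integrableOn_field hσ z)]
  refine (norm_integral_le_sing z z' (c₀ := 0) (c₁ := M * (4 * √‖z' - z‖))
    (by positivity) ?_).trans (le_of_eq (by ring))
  intro y hy h1 h2
  rw [← smul_sub, norm_smul, Real.norm_eq_abs]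
  have := norm_newtonKer_sub_le_sing h1 h2
  rw [show z' - y - (z - y) = z' - z by abel] at this
  calc _ ≤ M * (4 * √‖z' - z‖ * (sing (z - y) + sing (z' - y))) := by
        gcongr; exact hM y hy
    _ = _ := by ring

theorem continuous_field (hσ : ContinuousOn σ (B 2)) : Continuous (field σ) := by
  obtain ⟨M, hM0, hM⟩ := exists_bound_B2 hσ
  rw [continuous_iff_continuousAt]
  intro z
  rw [ContinuousAt, tendsto_iff_norm_sub_tendsto_zero]
  have : Continuous fun z' : E3 => M * 8 * singC * √‖z' - z‖ := by fun_prop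
  refine squeeze_zero (fun _ => norm_nonneg _) (fun z' => field_holder hσ hM0 hM z z') ?_
  simpa using this.tendsto z

/-- If the density is bounded by a multiple of `|y|`, increments of its field between points of
`B R` come with a factor `R`, up to a Lipschitz term. The reason is `|y| ≤ |z - y| + R`, where the
first summand lowers the order of the singularity. -/
theorem field_weighted (hσ : ContinuousOn σ (B 2)) (hM0 : 0 ≤ M)
    (hM : ∀ y ∈ B 2, |σ y| ≤ M * ‖y‖) {R : ℝ} {z z' : E3} (hz : ‖z‖ ≤ R) (hz' : ‖z'‖ ≤ R) :
    ‖field σ z' - field σ z‖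
      ≤ M * ((2 * ballVol + 2 * singC) * ‖z' - z‖ + 8 * singC * (R * √‖z' - z‖)) := by
  have hR : 0 ≤ R := (norm_nonneg _).trans hz
  unfold field
  rw [← integral_sub (integrableOn_field hσ z') (integrableOn_field hσ z)]
  refine (norm_integral_le_sing z z' (c₀ := M * (2 * ‖z' - z‖))
    (c₁ := M * (‖z' - z‖ + 4 * R * √‖z' - z‖)) (by positivity) ?_).trans (le_of_eq (by ring))
  intro y hy h1 h2
  rw [← smul_sub, norm_smul, Real.norm_eq_abs]
  have hK := norm_newtonKer_sub_le h1 h2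
  have s1 := norm_sub_mul_inv_le h1 h2
  have s2 := norm_sub_mul_inv_le' h1 h2
  have t1 := inv_norm_sq_le_sing (z - y)
  have t2 := inv_norm_sq_le_sing (z' - y)
  have n1 : ‖y‖ ≤ ‖z - y‖ + R := by
    have := norm_sub_le z (z - y); rw [sub_sub_cancel] at this; linarith
  have n2 : ‖y‖ ≤ ‖z' - y‖ + R := by
    have := norm_sub_le z' (z' - y); rw [sub_sub_cancel] at this; linarith
  rw [show z' - y - (z - y) = z' - z by abel] at hK s1 s2
  have ha : 0 < ‖z - y‖ := norm_pos_iff.2 h1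
  have hb : 0 < ‖z' - y‖ := norm_pos_iff.2 h2
  have p1 : ‖z - y‖ * ‖z - y‖⁻¹ = 1 := mul_inv_cancel₀ ha.ne'
  have p2 : ‖z' - y‖ * ‖z' - y‖⁻¹ = 1 := mul_inv_cancel₀ hb.ne'
  set p := ‖z - y‖⁻¹
  set q := ‖z' - y‖⁻¹
  have hp : 0 < p := inv_pos.2 ha
  have hq : 0 < q := inv_pos.2 hb
  set d := ‖z' - z‖
  have hd : 0 ≤ d := norm_nonneg _
  calc |σ y| * ‖newtonKer (z' - y) - newtonKer (z - y)‖
      ≤ (M * ‖y‖) * (d * (p ^ 2 * q + p * q ^ 2)) := by gcongr; exact hM y hy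
    _ = M * (d * (p ^ 2 * q) * ‖y‖ + d * (p * q ^ 2) * ‖y‖) := by ring
    _ ≤ M * (d * (p ^ 2 * q) * (‖z - y‖ + R) + d * (p * q ^ 2) * (‖z' - y‖ + R)) := by gcongr
    _ = M * (d * (2 * p * q) + R * (d * (p ^ 2 * q) + d * (p * q ^ 2))) := by
        linear_combination M * d * p * q * (p1 + p2)
    _ ≤ M * (d * (2 + sing (z - y) + sing (z' - y))
        + R * (2 * √d * (sing (z - y) + sing (z' - y))
          + 2 * √d * (sing (z - y) + sing (z' - y)))) := by
        gcongr
        nlinarith [sq_nonneg (p - q)]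
    _ = _ := by ring

theorem norm_newtonHess_le (a : E3) : ‖newtonHess a‖ ≤ 4 * ‖a‖⁻¹ ^ 3 := by
  refine ContinuousLinearMap.opNorm_le_bound _ (by positivity) fun w => ?_
  rw [newtonHess_apply]
  have h2 := abs_real_inner_le_norm a w
  refine (norm_add_le _ _).trans ?_
  rw [norm_smul, norm_smul, norm_neg, norm_mul, Real.norm_of_nonneg
    (show 0 ≤ ‖a‖⁻¹ ^ 3 by positivity),
    Real.norm_of_nonneg (show 0 ≤ 3 * ‖a‖⁻¹ ^ 5 by positivity), Real.norm_eq_abs]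
  calc _ ≤ ‖a‖⁻¹ ^ 3 * ‖w‖ + 3 * ‖a‖⁻¹ ^ 5 * (‖a‖ * ‖w‖) * ‖a‖ := by gcongr
    _ = 4 * ‖a‖⁻¹ ^ 3 * ‖w‖ := by
      by_cases h : ‖a‖ = 0
      · simp [h]
      · field_simp; ring

/-- If the density is bounded by a multiple of `|y|`, its field is differentiable at the origin,
although the density need not be Hölder continuous elsewhere. -/
theorem differentiableAt_field_zero (hσ : ContinuousOn σ (B 2)) (hM0 : 0 ≤ M)
    (hM : ∀ y ∈ B 2, |σ y| ≤ M * ‖y‖) : DifferentiableAt ℝ (field σ) 0 := by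
  have hi : IntegrableOn (fun y => σ y • newtonHess (0 - y)) (B 2) := by
    refine integrableOn_of_le_sing 0 0 (c₀ := M * 4) (c₁ := M * 4) ?_ ?_
    · exact (aesm_B2 hσ).smul
        (measurable_newtonHess.comp (measurable_const.sub measurable_id)).aestronglyMeasurable
    · intro y hy h _
      have h1 := inv_norm_sq_le_sing (0 - y)
      have h2 := sing_nonneg (0 - y)
      have h3 : ‖y‖ * ‖0 - y‖⁻¹ = 1 := by
        rw [zero_sub, norm_neg] at *
        exact mul_inv_cancel₀ (norm_ne_zero_iff.2 (by simpa using h))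
      rw [norm_smul, Real.norm_eq_abs]
      calc _ ≤ (M * ‖y‖) * (4 * ‖0 - y‖⁻¹ ^ 3) := by
            gcongr
            · exact hM y hy
            · exact norm_newtonHess_le _
        _ = M * 4 * ‖0 - y‖⁻¹ ^ 2 := by linear_combination M * 4 * ‖0 - y‖⁻¹ ^ 2 * h3
        _ ≤ M * 4 * (1 + sing (0 - y)) := by gcongr
        _ ≤ _ := by nlinarith
  refine (hasFDerivAt_of_sqrt_bound (A := ∫ y in B 2, σ y • newtonHess (0 - y))
    (C := M * 120 * singC) fun z' => ?_).differentiableAt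
  have e : field σ z' - field σ 0 - (∫ y in B 2, σ y • newtonHess (0 - y)) (z' - 0)
      = ∫ y in B 2, σ y • (newtonKer (z' - y) - newtonKer (0 - y) - newtonHess (0 - y)
        (z' - 0)) := by
    have h2 : IntegrableOn (fun y => (σ y • newtonHess (0 - y)) (z' - 0)) (B 2) :=
      hi.apply_continuousLinearMap _
    have h3 : IntegrableOn (fun y => σ y • newtonKer (z' - y) - σ y • newtonKer (0 - y)) (B 2) :=
      (integrableOn_field hσ z').sub (integrableOn_field hσ 0)
    rw [ContinuousLinearMap.integral_apply hi, field, field,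
      ← integral_sub (integrableOn_field hσ z') (integrableOn_field hσ 0),
      ← integral_sub h3 h2]
    congr 1
    funext y
    simp only [smul_apply, smul_sub]
  rw [e]
  refine (norm_integral_le_sing 0 z' (c₀ := 0) (c₁ := M * (60 * (‖z' - 0‖ * √‖z' - 0‖)))
    (by positivity) ?_).trans (le_of_eq (by ring))
  intro y hy h1 h2
  rw [norm_smul, Real.norm_eq_abs]
  have := newtonKer_taylor h1 h2
  rw [show z' - y - (0 - y) = z' - 0 by abel] at this
  have h3 : ‖y‖ = ‖0 - y‖ := by simp
  calc _ ≤ (M * ‖y‖) * ‖newtonKer (z' - y) - newtonKer (0 - y) - newtonHess (0 - y) (z' - 0)‖ := by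
        gcongr; exact hM y hy
    _ = M * (‖0 - y‖ * ‖newtonKer (z' - y) - newtonKer (0 - y) - newtonHess (0 - y) (z' - 0)‖) := by
        rw [mul_assoc, ← h3]
    _ ≤ M * (60 * (‖z' - 0‖ * √‖z' - 0‖) * (sing (0 - y) + sing (z' - y))) := by gcongr
    _ = _ := by ring

end Potential

/-! ### Potentials of continuously differentiable densities -/

theorem locallyIntegrable_newtonKer : LocallyIntegrable newtonKer volume := by
  have h : LocallyIntegrable (fun a : E3 => 2 + singTrunc a) volume :=
    (locallyIntegrable_const 2).add integrable_singTrunc.locallyIntegrable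
  refine h.mono measurable_newtonKer.aestronglyMeasurable (Eventually.of_forall fun a => ?_)
  rw [norm_newtonKer, Real.norm_of_nonneg (by linarith [singTrunc_nonneg a])]
  linarith [inv_norm_sq_le_sing a, sing_le_singTrunc a]

theorem field_eq_convolution {ρ : E3 → ℝ} (h0 : ∀ y, y ∉ B 2 → ρ y = 0) :
    field ρ = convolution newtonKer ρ (ContinuousLinearMap.lsmul ℝ ℝ).flip volume := by
  funext z
  rw [convolution, field, setIntegral_eq_integral_of_forall_compl_eq_zero
    (fun y hy => by rw [h0 y hy, zero_smul]),
    ← integral_sub_left_eq_self (fun y => ρ y • newtonKer (z - y)) volume z]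
  simp

theorem contDiff_field {ρ : E3 → ℝ} (hρ : ContDiff ℝ 1 ρ) (h0 : ∀ y, y ∉ B 2 → ρ y = 0) :
    ContDiff ℝ 1 (field ρ) := by
  rw [field_eq_convolution h0]
  have hc : HasCompactSupport ρ := HasCompactSupport.intro (isCompact_closedBall _ _) fun y hy =>
    h0 y hy
  exact hc.contDiff_convolution_right _ locallyIntegrable_newtonKer hρ

/-- The field of a Lipschitz continuous density is Lipschitz continuous: in the convolution the
difference can be moved from the kernel to the density. -/
theorem field_lipschitz {ρ : E3 → ℝ} (hc : Continuous ρ) (h0 : ∀ y, y ∉ B 2 → ρ y = 0) {M : ℝ}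
    (hM0 : 0 ≤ M) (hM : ∀ y y', |ρ y - ρ y'| ≤ M * ‖y - y'‖) (z z' : E3) :
    ‖field ρ z' - field ρ z‖ ≤ M * (2 * ballVol + 4 * singC) * ‖z' - z‖ := by
  have hint : ∀ z, Integrable (fun t => ρ (z - t) • newtonKer t) := by
    intro z
    have h := (integrableOn_field hc.continuousOn z)
    have h1 : Integrable (fun y => ρ y • newtonKer (z - y)) := by
      refine (integrableOn_iff_integrable_of_support_subset fun y hy => ?_).1 h
      by_contra hy2
      exact hy (by simp [h0 y hy2])
    simpa using h1.comp_sub_left z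
  have hval : ∀ z, field ρ z = ∫ t, ρ (z - t) • newtonKer t := by
    intro z
    rw [field, setIntegral_eq_integral_of_forall_compl_eq_zero
      (fun y hy => by rw [h0 y hy, zero_smul]),
      ← integral_sub_left_eq_self (fun y => ρ y • newtonKer (z - y)) volume z]
    simp
  -- in the variable `t = z - y` the integrand of the difference lives on the union of two balls
  let k : E3 → E3 → ℝ := fun z t => (B 2).indicator (fun _ => ‖newtonKer t‖) (z - t)
  have hk : ∀ z, Integrable (k z) ∧ ∫ t, k z t ≤ ballVol + 2 * singC := by
    intro z
    have e : ∀ y, k z (z - y) = (B 2).indicator (fun y => ‖newtonKer (z - y)‖) y := by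
      intro y
      simp only [k, sub_sub_cancel]
      by_cases hy : y ∈ B 2
      · rw [indicator_of_mem hy, indicator_of_mem hy]
      · rw [indicator_of_notMem hy, indicator_of_notMem hy]
    have hi : IntegrableOn (fun y => ‖newtonKer (z - y)‖) (B 2) := by
      have := (integrableOn_field (σ := fun _ => 1) continuousOn_const z).norm
      simpa [IntegrableOn] using this
    have hi' : Integrable fun y => k z (z - y) := by
      simp only [e]
      exact (integrable_indicator_iff measurableSet_closedBall).2 hi
    refine ⟨by simpa using hi'.comp_sub_left z, ?_⟩
    rw [← integral_sub_left_eq_self (k z) volume z]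
    simp only [e]
    rw [integral_indicator measurableSet_closedBall]
    refine (Real.le_norm_self _).trans ?_
    refine (norm_integral_le_sing z z (c₀ := 1) (c₁ := 1) zero_le_one
      fun y hy _ _ => ?_).trans (le_of_eq (by ring))
    rw [norm_norm, norm_newtonKer]
    linarith [inv_norm_sq_le_sing (z - y), sing_nonneg (z - y)]
  rw [hval, hval, ← integral_sub (hint z') (hint z)]
  have hb : ∀ t, ‖ρ (z' - t) • newtonKer t - ρ (z - t) • newtonKer t‖
      ≤ M * ‖z' - z‖ * (k z t + k z' t) := by
    intro t
    rw [← sub_smul, norm_smul, Real.norm_eq_abs]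
    have hkn : ∀ z, 0 ≤ k z t := fun z => indicator_nonneg (fun _ _ => norm_nonneg _) _
    by_cases h : z - t ∈ B 2 ∨ z' - t ∈ B 2
    · have h1 : ‖newtonKer t‖ ≤ k z t + k z' t := by
        rcases h with h | h
        · have : k z t = ‖newtonKer t‖ := indicator_of_mem h _
          linarith [hkn z']
        · have : k z' t = ‖newtonKer t‖ := indicator_of_mem h _
          linarith [hkn z]
      have h2 := hM (z' - t) (z - t)
      rw [sub_sub_sub_cancel_right] at h2
      gcongr
    · push Not at h
      rw [h0 _ h.1, h0 _ h.2]
      simp only [sub_self, abs_zero, zero_mul]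
      exact mul_nonneg (by positivity) (add_nonneg (hkn z) (hkn z'))
  refine (norm_integral_le_of_norm_le (((hk z).1.add (hk z').1).const_mul _)
    (Eventually.of_forall hb)).trans ?_
  rw [integral_const_mul]
  simp only [Pi.add_apply]
  rw [integral_add (hk z).1 (hk z').1]
  have : 0 ≤ M * ‖z' - z‖ := by positivity
  nlinarith [(hk z).2, (hk z').2]

theorem norm_fderiv_field_le {ρ : E3 → ℝ} (hρ : ContDiff ℝ 1 ρ) (h0 : ∀ y, y ∉ B 2 → ρ y = 0)
    {M : ℝ} (hM0 : 0 ≤ M) (hM : ∀ y, ‖fderiv ℝ ρ y‖ ≤ M) (z : E3) :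
    ‖fderiv ℝ (field ρ) z‖ ≤ M * (2 * ballVol + 4 * singC) := by
  have hL : ∀ y y', |ρ y - ρ y'| ≤ M * ‖y - y'‖ := fun y y' =>
    convex_univ.norm_image_sub_le_of_norm_fderiv_le (𝕜 := ℝ)
      (fun x _ => (hρ.differentiable one_ne_zero) x) (fun x _ => hM x) (mem_univ y') (mem_univ y)
  have hB := ballVol_nonneg
  have hS := singC_nonneg
  refine norm_fderiv_le_of_lip' ℝ (by positivity) (Eventually.of_forall fun z' => ?_)
  exact field_lipschitz hρ.continuous h0 hM0 hL z z'

/-! ### Symmetric densities -/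

theorem measurableSet_B2 : MeasurableSet (B 2) := measurableSet_closedBall

/-- The potential inherits the symmetries of the density. -/
theorem pot_comp_isometry (L : E3 ≃ₗᵢ[ℝ] E3) {σ : E3 → ℝ} (hσ : ∀ y ∈ B 2, σ (L y) = σ y) (z : E3) :
    pot σ (L z) = pot σ z := by
  unfold pot
  have hmp := L.measurePreserving
  have hpre : L ⁻¹' B 2 = B 2 := by ext y; simp
  rw [← hmp.setIntegral_preimage_emb L.toHomeomorph.measurableEmbedding _ (B 2), hpre]
  refine setIntegral_congr_fun measurableSet_B2 fun y hy => ?_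
  show σ (L y) / ‖L z - L y‖ = σ y / ‖z - y‖
  rw [hσ y hy, ← map_sub, L.norm_map]

/-- The rotations about the third axis as linear isometries. -/
theorem rotation3_isometry (θ : ℝ) : ∃ L : E3 ≃ₗᵢ[ℝ] E3, ∀ x, rotation3 θ x = L x := by
  let l : E3 →ₗ[ℝ] E3 :=
    { toFun := rotation3 θ
      map_add' := fun x y => by
        ext i; fin_cases i <;> simp [rotation3] <;> ring
      map_smul' := fun c x => by
        ext i; fin_cases i <;> simp [rotation3] <;> ring }
  let li : E3 →ₗᵢ[ℝ] E3 := ⟨l, fun x => by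
    show ‖rotation3 θ x‖ = ‖x‖
    rw [EuclideanSpace.norm_eq, EuclideanSpace.norm_eq]
    congr 1
    simp only [Fin.sum_univ_three, Real.norm_eq_abs, sq_abs, rotation3]
    simp
    linear_combination (x 0 ^ 2 + x 1 ^ 2) * Real.sin_sq_add_cos_sq θ⟩
  exact ⟨li.toLinearIsometryEquiv rfl, fun x => rfl⟩

theorem reflection3_isometry : ∃ L : E3 ≃ₗᵢ[ℝ] E3, ∀ x, reflection3 x = L x := by
  let l : E3 →ₗ[ℝ] E3 :=
    { toFun := reflection3
      map_add' := fun x y => by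
        ext i; fin_cases i <;> simp [reflection3]
        ring
      map_smul' := fun c x => by
        ext i; fin_cases i <;> simp [reflection3] }
  let li : E3 →ₗᵢ[ℝ] E3 := ⟨l, fun x => by
    show ‖reflection3 x‖ = ‖x‖
    rw [EuclideanSpace.norm_eq, EuclideanSpace.norm_eq]
    congr 1
    simp [Fin.sum_univ_three, reflection3]⟩
  exact ⟨li.toLinearIsometryEquiv rfl, fun x => rfl⟩

theorem symS_isometry {A : E3 → E3} (hA : A ∈ symS) : ∃ L : E3 ≃ₗᵢ[ℝ] E3, ∀ x, A x = L x := by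
  rcases hA with ⟨θ, rfl⟩ | hA
  · exact rotation3_isometry θ
  · rw [mem_singleton_iff.1 hA]
    exact reflection3_isometry

theorem cylRadius_symS {A : E3 → E3} (hA : A ∈ symS) (x : E3) : cylRadius (A x) = cylRadius x := by
  rcases hA with ⟨θ, rfl⟩ | hA
  · unfold cylRadius
    congr 1
    simp [rotation3]
    linear_combination (x 0 ^ 2 + x 1 ^ 2) * Real.sin_sq_add_cos_sq θ
  · rw [mem_singleton_iff.1 hA]
    simp [cylRadius, reflection3]

/-- The symmetry class contains `x ↦ -x`, up to composition. -/
theorem neg_eq_symS (x : E3) : reflection3 (rotation3 Real.pi x) = -x := by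
  ext i; fin_cases i <;> simp [reflection3, rotation3]

theorem rotation3_mem (θ : ℝ) : rotation3 θ ∈ symS := Or.inl ⟨θ, rfl⟩

theorem reflection3_mem : reflection3 ∈ symS := Or.inr rfl

/-- The gradient of a symmetric function vanishes at the origin. -/
theorem gradient_zero_of_symm {W : E3 → ℝ} (hW : ∀ A ∈ symS, ∀ x, W (A x) = W x) {v : E3}
    (hv : HasFDerivAt W (innerSL ℝ v) 0) : v = 0 := by
  have heven : ∀ x, W (-x) = W x := fun x => by
    rw [← neg_eq_symS, hW _ reflection3_mem, hW _ (rotation3_mem _)]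
  have h1 : HasFDerivAt (fun x => W (-x)) ((innerSL ℝ v).comp (-ContinuousLinearMap.id ℝ E3))
      0 := by
    have hn : HasFDerivAt (fun x : E3 => -x) (-ContinuousLinearMap.id ℝ E3) 0 :=
      (hasFDerivAt_id 0).neg
    exact HasFDerivAt.comp (0 : E3) (f := fun x : E3 => -x) (by simpa using hv) hn
  simp only [heven] at h1
  have h2 := congrArg (fun l : E3 →L[ℝ] ℝ => l v) (h1.unique hv)
  simp at h2
  have h3 : 0 ≤ ‖v‖ := norm_nonneg v
  have : ‖v‖ ^ 2 = 0 := by linarith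
  simpa using this

/-! ### Energy integrals -/

/-- Twice the even part of `ψ` at `c a`, which is all that enters the integral of `ψ(c s)` over
`[-a, a]`. -/
def angSum (ψ : ℝ → ℝ) (c a : ℝ) : ℝ := ψ (c * a) + ψ (-(c * a))

/-- The integral of `ψ(c s)` over `[-a, a]`, see `integral_symm_eq_angInt`. -/
def angInt (ψ : ℝ → ℝ) (c a : ℝ) : ℝ := ∫ s in (0 : ℝ)..a, angSum ψ c s

/-- The derivative of `angSum` with respect to `c`. -/
def angSum' (ψ : ℝ → ℝ) (c a : ℝ) : ℝ := a * deriv ψ (c * a) - a * deriv ψ (-(c * a))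

/-- The derivative of `angInt` with respect to `c`. -/
def angInt' (ψ : ℝ → ℝ) (c a : ℝ) : ℝ := ∫ s in (0 : ℝ)..a, angSum' ψ c s

/-- The integral of `φ(E) F(c, √(2 (E - u)))` over energies in `[m, E0]`. The lower limit `m` does
not depend on `u`: for the functions `F` used here, which vanish at `a = 0`, the energies `E < u` do
not contribute, since the square root of a negative number is zero. -/
def energyInt (φ : ℝ → ℝ) (E0 m : ℝ) (F : ℝ → ℝ → ℝ) (c u : ℝ) : ℝ :=
  ∫ E in Icc m E0, φ E * F c (√(2 * (E - u)))

theorem integral_symm_eq_angInt {ψ : ℝ → ℝ} (hψ : Continuous ψ) (c a : ℝ) :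
    ∫ s in (-a)..a, ψ (c * s) = angInt ψ c a := by
  have hi : ∀ x y : ℝ, IntervalIntegrable (fun s => ψ (c * s)) volume x y := fun x y =>
    (by fun_prop : Continuous fun s => ψ (c * s)).intervalIntegrable _ _
  have hi' : ∀ x y : ℝ, IntervalIntegrable (fun s => ψ (-(c * s))) volume x y := fun x y =>
    (by fun_prop : Continuous fun s => ψ (-(c * s))).intervalIntegrable _ _
  unfold angInt angSum
  rw [intervalIntegral.integral_add (hi _ _) (hi' _ _),
    ← intervalIntegral.integral_add_adjacent_intervals (hi (-a) 0) (hi 0 a), add_comm]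
  congr 1
  have := intervalIntegral.integral_comp_neg (fun s => ψ (c * s)) (a := 0) (b := a)
  simp only [mul_neg, neg_zero] at this
  exact this.symm

section
variable {φ ψ : ℝ → ℝ} {E0 : ℝ}

/-- Local integrability of the profile with a finite exponent `q > 2`, which is what Hölder's
inequality is stated for. -/
theorem exists_real_exponent (hφ : IsEnergyProfile φ E0) : ∃ q : ℝ, 2 < q ∧
    ∀ a b : ℝ, MemLp φ (ENNReal.ofReal q) (volume.restrict (Icc a b)) := by
  obtain ⟨p, hp, h⟩ := hφ.locLp
  obtain ⟨q, hq1, hq2⟩ := exists_between hp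
  have hqt : q ≠ ⊤ := (hq2.trans_le le_top).ne
  refine ⟨q.toReal, ?_, fun a b => ?_⟩
  · have := (ENNReal.toReal_lt_toReal (by norm_num) hqt).2 hq1
    simpa using this
  · rw [ENNReal.ofReal_toReal hqt]
    exact (h _ isCompact_Icc).mono_exponent hq2.le

theorem integrableOn_profile (hφ : IsEnergyProfile φ E0) (a b : ℝ) : IntegrableOn φ (Icc a b) := by
  obtain ⟨q, hq, h⟩ := exists_real_exponent hφ
  have h1 : (1 : ENNReal) ≤ ENNReal.ofReal q := by
    rw [← ENNReal.ofReal_one]; exact ENNReal.ofReal_le_ofReal (by linarith)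
  exact (h a b).integrable h1

/-- The singular kernel `1 / √(2e)` on `0 < e < δ`. -/
def rootKer (δ e : ℝ) : ℝ := (Ioo 0 δ).indicator (fun e => (√(2 * e))⁻¹) e

theorem rootKer_nonneg (δ e : ℝ) : 0 ≤ rootKer δ e := by
  unfold rootKer; exact indicator_nonneg (fun _ _ => by positivity) _

theorem measurable_rootKer (δ : ℝ) : Measurable (rootKer δ) := by
  unfold rootKer
  exact (by fun_prop : Measurable fun e : ℝ => (√(2 * e))⁻¹).indicator measurableSet_Ioo

theorem rootKer_rpow_le {δ s : ℝ} (hs : 0 < s) (e : ℝ) :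
    rootKer δ e ^ s ≤ (Ioo 0 δ).indicator (fun e => e ^ (-(s / 2))) e := by
  unfold rootKer
  by_cases he : e ∈ Ioo 0 δ
  · rw [indicator_of_mem he, indicator_of_mem he]
    have h2 : 0 < 2 * e := by linarith [he.1]
    rw [Real.sqrt_eq_rpow, ← Real.rpow_neg h2.le, ← Real.rpow_mul h2.le,
      show -(1 / 2) * s = -(s / 2) by ring]
    exact Real.rpow_le_rpow_of_nonpos he.1 (by linarith [he.1]) (by linarith)
  · rw [indicator_of_notMem he, indicator_of_notMem he, Real.zero_rpow hs.ne']

theorem integrable_indicator_rpow {δ r : ℝ} (hδ : 0 < δ) (hr : -1 < r) :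
    Integrable ((Ioo 0 δ).indicator fun e : ℝ => e ^ r) :=
  (integrable_indicator_iff measurableSet_Ioo).2
    ((intervalIntegral.integrableOn_Ioo_rpow_iff hδ).2 hr)

theorem integral_indicator_rpow {δ r : ℝ} (hδ : 0 < δ) (hr : -1 < r) :
    ∫ e, (Ioo 0 δ).indicator (fun e : ℝ => e ^ r) e = δ ^ (r + 1) / (r + 1) := by
  rw [integral_indicator measurableSet_Ioo, ← integral_Ioc_eq_integral_Ioo,
    ← intervalIntegral.integral_of_le hδ.le, integral_rpow (Or.inl hr),
    Real.zero_rpow (by linarith), sub_zero]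

/-- The singular kernel is in `L^s` for `s < 2`, with a norm that is independent of the position of
the singularity and tends to zero with `δ`. -/
theorem rootKer_memLp {s δ : ℝ} (hs1 : 1 < s) (hs2 : s < 2) (hδ : 0 < δ) (u : ℝ) (I : Set ℝ) :
    MemLp (fun E => rootKer δ (E - u)) (ENNReal.ofReal s) (volume.restrict I) ∧
      ∫ E in I, rootKer δ (E - u) ^ s ≤ δ ^ (1 - s / 2) / (1 - s / 2) := by
  have hmeas : Measurable fun E => rootKer δ (E - u) :=
    (measurable_rootKer δ).comp (measurable_id.sub_const u)
  have hd : Integrable fun E => (Ioo 0 δ).indicator (fun e : ℝ => e ^ (-(s / 2))) (E - u) :=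
    (integrable_indicator_rpow hδ (by linarith)).comp_sub_right u
  have hle : ∀ E, rootKer δ (E - u) ^ s ≤ (Ioo 0 δ).indicator (fun e : ℝ => e ^ (-(s / 2)))
      (E - u) :=
    fun E => rootKer_rpow_le (by linarith) _
  have hn : ∀ E, 0 ≤ rootKer δ (E - u) ^ s := fun E => Real.rpow_nonneg (rootKer_nonneg _ _) _
  have hint : Integrable fun E => rootKer δ (E - u) ^ s := by
    refine hd.mono' (hmeas.pow_const s).aestronglyMeasurable (Eventually.of_forall fun E => ?_)
    rw [Real.norm_of_nonneg (hn E)]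
    exact hle E
  constructor
  · have h0 : ENNReal.ofReal s ≠ 0 := by simp; linarith
    rw [← integrable_norm_rpow_iff hmeas.aestronglyMeasurable h0 ENNReal.ofReal_ne_top,
      ENNReal.toReal_ofReal (by linarith)]
    simp only [Real.norm_of_nonneg (rootKer_nonneg _ _)]
    exact hint.integrableOn
  · calc ∫ E in I, rootKer δ (E - u) ^ s ≤ ∫ E, rootKer δ (E - u) ^ s :=
        setIntegral_le_integral hint (Eventually.of_forall hn)
      _ ≤ ∫ E, (Ioo 0 δ).indicator (fun e : ℝ => e ^ (-(s / 2))) (E - u) :=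
        integral_mono hint hd hle
      _ = _ := by
        rw [integral_sub_right_eq_self (fun E => (Ioo 0 δ).indicator (fun e : ℝ => e ^ (-(s / 2)))
          E) u,
          integral_indicator_rpow hδ (by linarith)]
        ring_nf

/-- By Hölder's inequality the integral of `φ(E) / √(2 (E - u))` over `u < E < u + δ` exists, and it
is small for small `δ`, uniformly in `u`. This is where the exponent `p > 2` enters. -/
theorem profile_rootKer (hφ : IsEnergyProfile φ E0) (m : ℝ) :
    (∀ δ > 0, ∀ u, IntegrableOn (fun E => φ E * rootKer δ (E - u)) (Icc m E0)) ∧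
      ∀ ε > 0, ∃ δ > 0, ∀ u, ∫ E in Icc m E0, φ E * rootKer δ (E - u) ≤ ε := by
  obtain ⟨q, hq, hL⟩ := exists_real_exponent hφ
  have hc : q.HolderConjugate (q / (q - 1)) := Real.HolderConjugate.conjExponent (by linarith)
  set s := q / (q - 1) with hs
  have hs1 : 1 < s := by rw [hs, one_lt_div (by linarith)]; linarith
  have hs2 : s < 2 := by rw [hs, div_lt_iff₀ (by linarith)]; linarith
  constructor
  · intro δ hδ u
    have : (ENNReal.ofReal q).HolderConjugate (ENNReal.ofReal s) :=
        Real.HolderConjugate.ennrealOfReal hc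
    exact (hL m E0).integrable_mul (rootKer_memLp hs1 hs2 hδ u _).1
  · intro ε hε
    set N := (∫ E in Icc m E0, φ E ^ q) ^ (1 / q) with hN
    have hN0 : 0 ≤ N := Real.rpow_nonneg (setIntegral_nonneg measurableSet_Icc
      fun E _ => Real.rpow_nonneg (hφ.nonneg E) _) _
    have ht : Tendsto (fun δ : ℝ => N * (δ ^ (1 - s / 2) / (1 - s / 2)) ^ (1 / s)) (𝓝 0) (𝓝 0) := by
      have h1 : ContinuousAt (fun δ : ℝ => δ ^ (1 - s / 2)) 0 :=
        Real.continuousAt_rpow_const _ _ (Or.inr (by linarith))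
      have h2 : ContinuousAt (fun δ : ℝ => (δ ^ (1 - s / 2) / (1 - s / 2)) ^ (1 / s)) 0 :=
        (h1.div_const _).rpow_const (Or.inr (by positivity))
      have h3 := (h2.const_mul N : ContinuousAt (fun δ : ℝ => N * (δ ^ (1 - s / 2) / (1 - s / 2))
          ^ (1 / s)) 0)
      have h4 := h3.tendsto
      rw [Real.zero_rpow (by linarith), zero_div, Real.zero_rpow (by positivity), mul_zero] at h4
      exact h4
    have he : ∀ᶠ δ in 𝓝[>] (0 : ℝ), N * (δ ^ (1 - s / 2) / (1 - s / 2)) ^ (1 / s) < ε :=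
      (ht.mono_left nhdsWithin_le_nhds).eventually_lt_const hε
    obtain ⟨δ, hδε, hδ⟩ := (he.and self_mem_nhdsWithin).exists
    have hδ : 0 < δ := hδ
    refine ⟨δ, hδ, fun u => ?_⟩
    obtain ⟨hm, hi⟩ := rootKer_memLp hs1 hs2 hδ u (Icc m E0)
    refine (integral_mul_le_Lp_mul_Lq_of_nonneg hc (Eventually.of_forall hφ.nonneg)
      (Eventually.of_forall fun E => rootKer_nonneg _ _) (hL m E0) hm).trans (le_trans ?_ hδε.le)
    rw [← hN]
    gcongr
    exact setIntegral_nonneg measurableSet_Icc fun E _ => Real.rpow_nonneg (rootKer_nonneg _ _) _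

/-! ### Regularity of energy integrals -/

theorem exists_bound_sqrt {F : ℝ → ℝ → ℝ} (hF : Continuous fun p : ℝ × ℝ => F p.1 p.2)
    (E0 m c₀ u₀ : ℝ) : ∃ C, 0 ≤ C ∧ ∀ c ∈ closedBall c₀ 1, ∀ u ∈ closedBall u₀ 1, ∀ E ∈ Icc m E0,
      |F c (√(2 * (E - u)))| ≤ C := by
  have hc : IsCompact (closedBall c₀ 1 ×ˢ (closedBall u₀ 1 ×ˢ Icc m E0)) :=
    (isCompact_closedBall _ _).prod ((isCompact_closedBall _ _).prod isCompact_Icc)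
  have hF' : Continuous fun p : ℝ × ℝ × ℝ => F p.1 (√(2 * (p.2.2 - p.2.1))) :=
    hF.comp (by fun_prop : Continuous fun p : ℝ × ℝ × ℝ => (p.1, √(2 * (p.2.2 - p.2.1))))
  obtain ⟨C, hC⟩ := hc.exists_bound_of_continuousOn hF'.continuousOn
  exact ⟨max C 0, le_max_right _ _, fun c hc u hu E hE => (hC (c, u, E) ⟨hc, hu, hE⟩).trans
    (le_max_left _ _)⟩

theorem aesm_energy (hφ : IsEnergyProfile φ E0) (m : ℝ) {F : ℝ → ℝ → ℝ}
    (hF : Continuous fun p : ℝ × ℝ => F p.1 p.2) (c u : ℝ) :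
    AEStronglyMeasurable (fun E => φ E * F c (√(2 * (E - u)))) (volume.restrict (Icc m E0)) := by
  have h : Continuous fun E => F c (√(2 * (E - u))) :=
    hF.comp (by fun_prop : Continuous fun E : ℝ => (c, √(2 * (E - u))))
  exact (integrableOn_profile hφ m E0).aestronglyMeasurable.mul h.aestronglyMeasurable

theorem integrableOn_energy (hφ : IsEnergyProfile φ E0) (m : ℝ) {F : ℝ → ℝ → ℝ}
    (hF : Continuous fun p : ℝ × ℝ => F p.1 p.2) (c u : ℝ) :
    IntegrableOn (fun E => φ E * F c (√(2 * (E - u)))) (Icc m E0) := by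
  obtain ⟨C, hC0, hC⟩ := exists_bound_sqrt hF E0 m c u
  refine ((integrableOn_profile hφ m E0).mul_const C).mono' (aesm_energy hφ m hF c u) ?_
  filter_upwards [ae_restrict_mem measurableSet_Icc] with E hE
  rw [norm_mul, Real.norm_of_nonneg (hφ.nonneg E)]
  exact mul_le_mul_of_nonneg_left (hC c (by simp) u (by simp) E hE) (hφ.nonneg E)

/-- Energy integrals with a continuous integrand are continuous, by dominated convergence. -/
theorem continuous_energyInt (hφ : IsEnergyProfile φ E0) (m : ℝ) {F : ℝ → ℝ → ℝ}
    (hF : Continuous fun p : ℝ × ℝ => F p.1 p.2) :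
    Continuous fun p : ℝ × ℝ => energyInt φ E0 m F p.1 p.2 := by
  rw [continuous_iff_continuousAt]
  rintro ⟨c₀, u₀⟩
  obtain ⟨C, hC0, hC⟩ := exists_bound_sqrt hF E0 m c₀ u₀
  unfold energyInt
  refine continuousAt_of_dominated (bound := fun E => φ E * C) ?_ ?_
    ((integrableOn_profile hφ m E0).mul_const C) ?_
  · exact Eventually.of_forall fun p => aesm_energy hφ m hF p.1 p.2
  · filter_upwards [prod_mem_nhds (closedBall_mem_nhds c₀ one_pos) (closedBall_mem_nhds u₀ one_pos)]
      with p hp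
    filter_upwards [ae_restrict_mem measurableSet_Icc] with E hE
    rw [norm_mul, Real.norm_of_nonneg (hφ.nonneg E)]
    exact mul_le_mul_of_nonneg_left (hC p.1 hp.1 p.2 hp.2 E hE) (hφ.nonneg E)
  · refine Eventually.of_forall fun E => Continuous.continuousAt ?_
    exact continuous_const.mul
      (hF.comp (by fun_prop : Continuous fun p : ℝ × ℝ => (p.1, √(2 * (E - p.2)))))

theorem continuous_angSum (hψ : Continuous ψ) : Continuous fun p : ℝ × ℝ => angSum ψ p.1 p.2 := by
  unfold angSum; fun_prop

theorem continuous_angSum' (hψ : ContDiff ℝ 1 ψ) :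
    Continuous fun p : ℝ × ℝ => angSum' ψ p.1 p.2 := by
  have := hψ.continuous_deriv le_rfl
  unfold angSum'; fun_prop

theorem continuous_integral_zero {f : ℝ → ℝ → ℝ} (hf : Continuous fun p : ℝ × ℝ => f p.1 p.2) :
    Continuous fun p : ℝ × ℝ => ∫ s in (0 : ℝ)..p.2, f p.1 s := by
  refine intervalIntegral.continuous_parametric_intervalIntegral_of_continuous
    (f := fun (p : ℝ × ℝ) s => f p.1 s) ?_ continuous_snd
  exact hf.comp (by fun_prop : Continuous fun q : (ℝ × ℝ) × ℝ => (q.1.1, q.2))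

theorem hasDerivAt_angSum (hψ : ContDiff ℝ 1 ψ) (c a : ℝ) :
    HasDerivAt (fun c => angSum ψ c a) (angSum' ψ c a) c := by
  have h1 : ∀ x, HasDerivAt ψ (deriv ψ x) x := fun x =>
    ((hψ.differentiable one_ne_zero) x).hasDerivAt
  have h2 : HasDerivAt (fun c : ℝ => c * a) a c := hasDerivAt_mul_const a
  have h3 := (h1 (c * a)).comp c h2
  have h4 := (h1 (-(c * a))).comp c h2.neg
  refine (h3.add h4).congr_deriv ?_
  unfold angSum'; ring

theorem hasDerivAt_angInt_left (hψ : ContDiff ℝ 1 ψ) (c a : ℝ) :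
    HasDerivAt (fun c => angInt ψ c a) (angInt' ψ c a) c := by
  have hcs := continuous_angSum hψ.continuous
  have hcs' := continuous_angSum' hψ
  have hK : IsCompact (closedBall c 1 ×ˢ uIcc 0 a) := (isCompact_closedBall _ _).prod isCompact_uIcc
  obtain ⟨C, hC⟩ := hK.exists_bound_of_continuousOn hcs'.continuousOn
  refine (intervalIntegral.hasDerivAt_integral_of_dominated_loc_of_deriv_le
    (F := fun c s => angSum ψ c s) (F' := fun c s => angSum' ψ c s) (bound := fun _ => C)
    (ball_mem_nhds c one_pos) ?_ ?_ ?_ ?_ ?_ ?_).2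
  · exact Eventually.of_forall fun x =>
      (hcs.comp (by fun_prop : Continuous fun s : ℝ => (x, s))).aestronglyMeasurable
  · exact (hcs.comp (by fun_prop : Continuous fun s : ℝ => (c, s))).intervalIntegrable _ _
  · exact (hcs'.comp (by fun_prop : Continuous fun s : ℝ => (c, s))).aestronglyMeasurable
  · exact Eventually.of_forall fun s hs x hx => hC (x, s)
      ⟨ball_subset_closedBall hx, uIoc_subset_uIcc hs⟩
  · exact intervalIntegrable_const
  · exact Eventually.of_forall fun s _ x _ => hasDerivAt_angSum hψ x s

theorem hasDerivAt_angInt_right (hψ : Continuous ψ) (c a : ℝ) :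
    HasDerivAt (fun a => angInt ψ c a) (angSum ψ c a) a := by
  have hc : Continuous fun s => angSum ψ c s :=
    (continuous_angSum hψ).comp (by fun_prop : Continuous fun s : ℝ => (c, s))
  exact intervalIntegral.integral_hasDerivAt_right (hc.intervalIntegrable _ _)
    hc.aestronglyMeasurable.stronglyMeasurableAtFilter hc.continuousAt

end

/-! ### The density as a function of radius and potential -/

section
variable {φ ψ : ℝ → ℝ} {E0 : ℝ}

theorem continuous_angInt (hψ : Continuous ψ) : Continuous fun p : ℝ × ℝ => angInt ψ p.1 p.2 :=
  continuous_integral_zero (continuous_angSum hψ)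

theorem continuous_angInt' (hψ : ContDiff ℝ 1 ψ) : Continuous fun p : ℝ × ℝ => angInt' ψ p.1 p.2 :=
  continuous_integral_zero (continuous_angSum' hψ)

theorem hasDerivAt_energyInt_left (hφ : IsEnergyProfile φ E0) (hψ : ContDiff ℝ 1 ψ) (m c u : ℝ) :
    HasDerivAt (fun c => energyInt φ E0 m (angInt ψ) c u) (energyInt φ E0 m (angInt' ψ) c u) c := by
  have hQ := continuous_angInt hψ.continuous
  have hQ' := continuous_angInt' hψ
  obtain ⟨C, hC0, hC⟩ := exists_bound_sqrt hQ' E0 m c u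
  refine (hasDerivAt_integral_of_dominated_loc_of_deriv_le
    (F := fun c E => φ E * angInt ψ c (√(2 * (E - u))))
    (F' := fun c E => φ E * angInt' ψ c (√(2 * (E - u)))) (bound := fun E => φ E * C)
    (ball_mem_nhds c one_pos) ?_ ?_ ?_ ?_ ?_ ?_).2
  · exact Eventually.of_forall fun x => aesm_energy hφ m hQ x u
  · exact integrableOn_energy hφ m hQ c u
  · exact aesm_energy hφ m hQ' c u
  · filter_upwards [ae_restrict_mem measurableSet_Icc] with E hE x hx
    rw [norm_mul, Real.norm_of_nonneg (hφ.nonneg E)]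
    exact mul_le_mul_of_nonneg_left (hC x (ball_subset_closedBall hx) u (by simp) E hE)
      (hφ.nonneg E)
  · exact (integrableOn_profile hφ m E0).mul_const C
  · exact Eventually.of_forall fun E x _ => (hasDerivAt_angInt_left hψ x _).const_mul _

/-- Both sides are zero for `e ≤ 0`. -/
theorem inv_sqrt_eq_rootKer {δ e : ℝ} (h : e < δ) : (√(2 * e))⁻¹ = rootKer δ e := by
  unfold rootKer
  by_cases h0 : 0 < e
  · rw [indicator_of_mem (show e ∈ Ioo 0 δ from ⟨h0, h⟩)]
  · rw [indicator_of_notMem (show e ∉ Ioo 0 δ from fun h => h0 h.1),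
      Real.sqrt_eq_zero_of_nonpos (by linarith), inv_zero]

/-- The bound is one-sided: it needs `u < v` and fails if `v < u = E`, where the right-hand side is
zero. For this reason only right derivatives are computed by dominated convergence. -/
theorem sqrt_sub_sqrt_le {E u v : ℝ} (huv : u < v) :
    |√(2 * (E - v)) - √(2 * (E - u))| ≤ 2 * (v - u) * (√(2 * (E - u)))⁻¹ := by
  have hmono : √(2 * (E - v)) ≤ √(2 * (E - u)) := Real.sqrt_le_sqrt (by linarith)
  rw [abs_sub_comm, abs_of_nonneg (by linarith)]
  rcases le_or_gt E u with h | h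
  · rw [Real.sqrt_eq_zero_of_nonpos (show 2 * (E - u) ≤ 0 by linarith)] at *
    have := Real.sqrt_nonneg (2 * (E - v))
    rw [inv_zero, mul_zero]; linarith
  · have ha : 0 < √(2 * (E - u)) := Real.sqrt_pos.2 (by linarith)
    rw [← div_eq_mul_inv, le_div_iff₀ ha]
    have h1 : √(2 * (E - u)) ^ 2 = 2 * (E - u) := Real.sq_sqrt (by linarith)
    have h2 : 2 * (E - v) ≤ √(2 * (E - v)) ^ 2 := by
      rcases le_total 0 (2 * (E - v)) with h | h
      · rw [Real.sq_sqrt h]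
      · exact h.trans (sq_nonneg _)
    nlinarith [Real.sqrt_nonneg (2 * (E - v))]

/-- The integral of `φ(E) (ψ(c a) + ψ(-c a)) / a` with `a = √(2 (E - u))`, which is minus the
derivative of `energyInt φ E0 m (angInt ψ) c` at `u`. Energies `E ≤ u` do not contribute because
division by zero gives zero. -/
def energyRoot (φ ψ : ℝ → ℝ) (E0 m c u : ℝ) : ℝ :=
  energyInt φ E0 m (fun c a => angSum ψ c a / a) c u

theorem aesm_energyRoot (hφ : IsEnergyProfile φ E0) (hψ : Continuous ψ) (m c u : ℝ) :
    AEStronglyMeasurable (fun E => φ E * (angSum ψ c (√(2 * (E - u))) / √(2 * (E - u))))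
      (volume.restrict (Icc m E0)) := by
  have h : Measurable fun E => angSum ψ c (√(2 * (E - u))) :=
    ((continuous_angSum hψ).comp
      (by fun_prop : Continuous fun E : ℝ => (c, √(2 * (E - u))))).measurable
  exact (integrableOn_profile hφ m E0).aestronglyMeasurable.mul
    (h.div (by fun_prop)).aestronglyMeasurable

/-- The right derivative of an energy integral with respect to `u`. -/
theorem hasDerivWithinAt_energyInt (hφ : IsEnergyProfile φ E0) (hψ : ContDiff ℝ 1 ψ) (m c u : ℝ) :
    HasDerivWithinAt (fun u => energyInt φ E0 m (angInt ψ) c u) (-energyRoot φ ψ E0 m c u)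
      (Ici u) u := by
  rw [← hasDerivWithinAt_Ioi_iff_Ici, hasDerivWithinAt_iff_tendsto_slope' self_notMem_Ioi]
  have hQ := continuous_angInt hψ.continuous
  have hcs : Continuous fun s => angSum ψ c s :=
    (continuous_angSum hψ.continuous).comp (by fun_prop : Continuous fun s : ℝ => (c, s))
  obtain ⟨C, hC⟩ := (isCompact_Icc (a := (0 : ℝ))
      (b := √(2 * (E0 - u)))).exists_bound_of_continuousOn
    hcs.continuousOn
  have hC0 : 0 ≤ C := (norm_nonneg _).trans (hC 0 ⟨le_rfl, Real.sqrt_nonneg _⟩)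
  have hslope : ∀ v, slope (fun u => energyInt φ E0 m (angInt ψ) c u) u v
      = ∫ E in Icc m E0, φ E * ((v - u)⁻¹ *
        (angInt ψ c (√(2 * (E - v))) - angInt ψ c (√(2 * (E - u))))) := by
    intro v
    rw [slope_def_module, energyInt, energyInt, ← integral_sub (integrableOn_energy hφ m hQ c v)
      (integrableOn_energy hφ m hQ c u), ← integral_smul]
    congr 1
    funext E
    simp only [angInt, smul_eq_mul]
    ring
  have hlim : -energyRoot φ ψ E0 m c u
      = ∫ E in Icc m E0, -(φ E * (angSum ψ c (√(2 * (E - u))) / √(2 * (E - u)))) := by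
    rw [energyRoot, energyInt, integral_neg]
  rw [hlim, show slope (fun u => energyInt φ E0 m (angInt ψ) c u) u = _ from funext hslope]
  set δ := |E0 - u| + 1 with hδ
  have hδ0 : 0 < δ := by positivity
  refine tendsto_integral_filter_of_dominated_convergence
    (fun E => φ E * rootKer δ (E - u) * (2 * C)) ?_ ?_ ?_ ?_
  · refine Eventually.of_forall fun v => ?_
    have h : ∀ v, Continuous fun E => angInt ψ c (√(2 * (E - v))) := fun v =>
      hQ.comp (by fun_prop : Continuous fun E : ℝ => (c, √(2 * (E - v))))
    exact (integrableOn_profile hφ m E0).aestronglyMeasurable.mul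
      (continuous_const.mul ((h v).sub (h u))).aestronglyMeasurable
  · filter_upwards [self_mem_nhdsWithin] with v hv
    have hv : u < v := hv
    filter_upwards [ae_restrict_mem measurableSet_Icc] with E hE
    have hmem : ∀ w, u ≤ w → √(2 * (E - w)) ∈ Icc 0 (√(2 * (E0 - u))) := fun w hw =>
      ⟨Real.sqrt_nonneg _, Real.sqrt_le_sqrt (by linarith [hE.2])⟩
    have h1 : ‖angInt ψ c (√(2 * (E - v))) - angInt ψ c (√(2 * (E - u)))‖
        ≤ C * ‖√(2 * (E - v)) - √(2 * (E - u))‖ :=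
      (convex_Icc _ _).norm_image_sub_le_of_norm_hasDerivWithin_le
        (fun a _ => (hasDerivAt_angInt_right hψ.continuous c a).hasDerivWithinAt) hC
        (hmem u le_rfl) (hmem v hv.le)
    have h2 := sqrt_sub_sqrt_le (E := E) hv
    rw [inv_sqrt_eq_rootKer (δ := δ) (by linarith [hE.2, le_abs_self (E0 - u)])] at h2
    rw [norm_mul, norm_mul, Real.norm_of_nonneg (hφ.nonneg E), norm_inv,
      Real.norm_of_nonneg (show 0 ≤ v - u by linarith), mul_assoc]
    refine mul_le_mul_of_nonneg_left ?_ (hφ.nonneg E)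
    rw [inv_mul_le_iff₀ (by linarith)]
    calc _ ≤ C * (2 * (v - u) * rootKer δ (E - u)) := h1.trans (by gcongr; exact h2)
      _ = _ := by ring
  · exact ((profile_rootKer hφ m).1 δ hδ0 u).mul_const (2 * C)
  -- the difference quotients converge for every energy other than `u`
  · have hne : ∀ᵐ E ∂(volume.restrict (Icc m E0)), E ≠ u :=
      ae_restrict_of_ae (by simp [ae_iff, measure_singleton])
    filter_upwards [hne] with E hE
    rw [← mul_neg]
    refine Tendsto.const_mul _ ?_
    rcases lt_or_gt_of_ne hE with h | h
    · rw [Real.sqrt_eq_zero_of_nonpos (show 2 * (E - u) ≤ 0 by linarith), div_zero, neg_zero]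
      refine tendsto_const_nhds.congr' ?_
      filter_upwards [self_mem_nhdsWithin] with v hv
      have hv : u < v := hv
      rw [Real.sqrt_eq_zero_of_nonpos (show 2 * (E - v) ≤ 0 by linarith), sub_self, mul_zero]
    · have hpos : 0 < 2 * (E - u) := by linarith
      have hs : HasDerivAt (fun v => √(2 * (E - v))) (-(√(2 * (E - u)))⁻¹) u := by
        have h0 : HasDerivAt (fun v : ℝ => 2 * (E - v)) (2 * -1) u :=
          ((hasDerivAt_id u).const_sub E).const_mul 2
        refine (h0.sqrt hpos.ne').congr_deriv ?_
        have : 0 < √(2 * (E - u)) := Real.sqrt_pos.2 hpos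
        field_simp
      have hd := (hasDerivAt_angInt_right hψ.continuous c (√(2 * (E - u)))).comp u hs
      have ht := (hasDerivAt_iff_tendsto_slope.1 hd).mono_left
        (nhdsWithin_mono u (fun v (hv : u < v) => hv.ne'))
      rw [div_eq_mul_inv, ← mul_neg]
      refine ht.congr fun v => ?_
      rw [slope_def_module]
      rfl

/-- The singular integral is the locally uniform limit of integrals with continuous integrands,
obtained by truncating the kernel `1 / a` at `a = √(2 δ)`. -/
theorem continuous_energyRoot (hφ : IsEnergyProfile φ E0) (hψ : Continuous ψ) (m : ℝ) :
    Continuous fun p : ℝ × ℝ => energyRoot φ ψ E0 m p.1 p.2 := by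
  rw [continuous_iff_continuousAt]
  rintro ⟨c₀, u₀⟩
  have hS := continuous_angSum hψ
  obtain ⟨C, hC0, hC⟩ := exists_bound_sqrt hS E0 m c₀ u₀
  refine continuousAt_of_locally_uniform_approx_of_continuousAt fun U hU => ?_
  obtain ⟨ε, hε, hεU⟩ := Metric.mem_uniformity_dist.1 hU
  obtain ⟨δ, hδ, hδε⟩ := (profile_rootKer hφ m).2 (ε / (2 * (C + 1))) (by positivity)
  have hδ' : 0 < √(2 * δ) := Real.sqrt_pos.2 (by linarith)
  -- the kernel `1 / a` is replaced by a continuous one that agrees with it for `a ≥ √(2 δ)`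
  set F : ℝ → ℝ → ℝ := fun c a => angSum ψ c a * (a / (max a (√(2 * δ))) ^ 2) with hF
  have hpos : ∀ a : ℝ, 0 < max a (√(2 * δ)) := fun a => lt_max_of_lt_right hδ'
  have hFc : Continuous fun p : ℝ × ℝ => F p.1 p.2 := by
    refine hS.mul (Continuous.div (by fun_prop) (by fun_prop) fun p => ?_)
    exact (pow_pos (hpos _) 2).ne'
  refine ⟨_, prod_mem_nhds (closedBall_mem_nhds c₀ one_pos) (closedBall_mem_nhds u₀ one_pos),
    fun p => energyInt φ E0 m F p.1 p.2, (continuous_energyInt hφ m hFc).continuousAt, ?_⟩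
  rintro ⟨c, u⟩ ⟨hc, hu⟩
  refine hεU ?_
  have hpt : ∀ E ∈ Icc m E0, ‖φ E * (angSum ψ c (√(2 * (E - u))) / √(2 * (E - u)))
      - φ E * F c (√(2 * (E - u)))‖ ≤ φ E * rootKer δ (E - u) * C := by
    intro E hE
    rw [← mul_sub, norm_mul, Real.norm_of_nonneg (hφ.nonneg E), mul_assoc]
    refine mul_le_mul_of_nonneg_left ?_ (hφ.nonneg E)
    have hb := hC c hc u hu E hE
    rcases lt_or_ge (E - u) δ with h | h
    · have hk := inv_sqrt_eq_rootKer h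
      have ha : √(2 * (E - u)) ≤ √(2 * δ) := Real.sqrt_le_sqrt (by linarith)
      rw [← hk]
      have ha0 := Real.sqrt_nonneg (2 * (E - u))
      set a := √(2 * (E - u))
      have e : angSum ψ c a / a - F c a = angSum ψ c a * (a⁻¹ - a / (max a (√(2 * δ))) ^ 2) := by
        simp only [hF]; ring
      rw [e, norm_mul, mul_comm (a⁻¹), Real.norm_eq_abs]
      have h1 : a / (max a (√(2 * δ))) ^ 2 ≤ a⁻¹ := by
        rcases ha0.eq_or_lt with h | h
        · rw [← h]; simp
        · rw [div_le_iff₀ (pow_pos (hpos _) 2), ← div_eq_inv_mul, le_div_iff₀ h, ← sq]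
          gcongr
          exact le_max_left _ _
      have h2 : 0 ≤ a / (max a (√(2 * δ))) ^ 2 := by positivity
      gcongr
      rw [Real.norm_of_nonneg (by linarith)]
      linarith
    · have ha : √(2 * δ) ≤ √(2 * (E - u)) := Real.sqrt_le_sqrt (by linarith)
      have : F c (√(2 * (E - u))) = angSum ψ c (√(2 * (E - u))) / √(2 * (E - u)) := by
        simp only [hF]
        rw [max_eq_left ha]
        have : 0 < √(2 * (E - u)) := hδ'.trans_le ha
        field_simp
      rw [this, sub_self, norm_zero]
      exact mul_nonneg (rootKer_nonneg _ _) hC0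
  have hbi : IntegrableOn (fun E => φ E * rootKer δ (E - u) * C) (Icc m E0) :=
    ((profile_rootKer hφ m).1 δ hδ u).mul_const C
  have hae : ∀ᵐ E ∂(volume.restrict (Icc m E0)),
      ‖φ E * (angSum ψ c (√(2 * (E - u))) / √(2 * (E - u)))
      - φ E * F c (√(2 * (E - u)))‖ ≤ φ E * rootKer δ (E - u) * C := by
    filter_upwards [ae_restrict_mem measurableSet_Icc] with E hE using hpt E hE
  have hFi := integrableOn_energy hφ m hFc c u
  have hdi : IntegrableOn (fun E => φ E * (angSum ψ c (√(2 * (E - u))) / √(2 * (E - u)))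
      - φ E * F c (√(2 * (E - u)))) (Icc m E0) :=
    hbi.mono' ((aesm_energyRoot hφ hψ m c u).sub hFi.aestronglyMeasurable) hae
  have hri : IntegrableOn (fun E => φ E * (angSum ψ c (√(2 * (E - u))) / √(2 * (E - u))))
      (Icc m E0) := by
    refine (hdi.add hFi).congr (Eventually.of_forall fun E => ?_)
    simp
  rw [dist_eq_norm]
  simp only [energyRoot, energyInt]
  rw [← integral_sub hri hFi]
  refine (norm_integral_le_of_norm_le hbi hae).trans_lt ?_
  rw [integral_mul_const]
  calc _ ≤ ε / (2 * (C + 1)) * C := by gcongr; exact hδε u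
    _ < ε := by
      rw [div_mul_eq_mul_div, div_lt_iff₀ (by positivity)]
      nlinarith

/-- A continuous function with a continuous right derivative is differentiable. -/
theorem hasDerivAt_of_continuous_right_deriv {f f' : ℝ → ℝ} (hf : Continuous f)
    (hf' : Continuous f')
    (h : ∀ x, HasDerivWithinAt f (f' x) (Ici x) x) (x : ℝ) : HasDerivAt f (f' x) x := by
  have hp : ∀ y, HasDerivAt (fun y => ∫ t in x..y, f' t) (f' y) y := fun y =>
    intervalIntegral.integral_hasDerivAt_right (hf'.intervalIntegrable _ _)
      hf'.aestronglyMeasurable.stronglyMeasurableAtFilter hf'.continuousAt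
  have hc : ∀ y ∈ Icc (x - 1) (x + 1), f y - (∫ t in x..y, f' t)
      = f (x - 1) - (∫ t in x..(x - 1), f' t) := by
    refine constant_of_has_deriv_right_zero (f := fun y => f y - ∫ t in x..y, f' t) ?_ ?_
    · exact (hf.sub (continuous_iff_continuousAt.2 fun y => (hp y).continuousAt)).continuousOn
    · intro y _
      have := (h y).sub (hp y).hasDerivWithinAt (s := Ici y)
      rw [sub_self] at this
      exact this
  refine ((hp x).add_const (f (x - 1) - (∫ t in x..(x - 1), f' t))).congr_of_eventuallyEq ?_
  filter_upwards [Icc_mem_nhds (show x - 1 < x by linarith) (show x < x + 1 by linarith)] with y hy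
  linarith [hc y hy]

/-- The function `H(c, u)` with `h(γ, r, u) = H(γ r, u)`, for `u ≥ m`. -/
def hFun (φ ψ : ℝ → ℝ) (E0 m c u : ℝ) : ℝ := 2 * Real.pi * energyInt φ E0 m (angInt ψ) c u

/-- The partial derivative of `hFun` with respect to `c`. -/
def hFunC (φ ψ : ℝ → ℝ) (E0 m c u : ℝ) : ℝ := 2 * Real.pi * energyInt φ E0 m (angInt' ψ) c u

/-- The partial derivative of `hFun` with respect to `u`. -/
def hFunU (φ ψ : ℝ → ℝ) (E0 m c u : ℝ) : ℝ := -(2 * Real.pi * energyRoot φ ψ E0 m c u)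

theorem continuous_hFunC (hφ : IsEnergyProfile φ E0) (hψ : ContDiff ℝ 1 ψ) (m : ℝ) :
    Continuous fun p : ℝ × ℝ => hFunC φ ψ E0 m p.1 p.2 :=
  continuous_const.mul (continuous_energyInt hφ m (continuous_angInt' hψ))

theorem continuous_hFunU (hφ : IsEnergyProfile φ E0) (hψ : ContDiff ℝ 1 ψ) (m : ℝ) :
    Continuous fun p : ℝ × ℝ => hFunU φ ψ E0 m p.1 p.2 :=
  (continuous_const.mul (continuous_energyRoot hφ hψ.continuous m)).neg

theorem hasDerivAt_hFun_left (hφ : IsEnergyProfile φ E0) (hψ : ContDiff ℝ 1 ψ) (m c u : ℝ) :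
    HasDerivAt (fun c => hFun φ ψ E0 m c u) (hFunC φ ψ E0 m c u) c :=
  (hasDerivAt_energyInt_left hφ hψ m c u).const_mul _

theorem hasDerivAt_hFun_right (hφ : IsEnergyProfile φ E0) (hψ : ContDiff ℝ 1 ψ) (m c u : ℝ) :
    HasDerivAt (fun u => hFun φ ψ E0 m c u) (hFunU φ ψ E0 m c u) u := by
  have h := hasDerivAt_of_continuous_right_deriv (f := fun u => energyInt φ E0 m (angInt ψ) c u)
    (f' := fun u => -energyRoot φ ψ E0 m c u)
    ((continuous_energyInt hφ m (continuous_angInt hψ.continuous)).comp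
      (by fun_prop : Continuous fun u : ℝ => (c, u)))
    ((continuous_energyRoot hφ hψ.continuous m).comp
      (by fun_prop : Continuous fun u : ℝ => (c, u))).neg
    (fun u => hasDerivWithinAt_energyInt hφ hψ m c u) u
  refine (h.const_mul (2 * Real.pi)).congr_deriv ?_
  simp [hFunU]

theorem hasFDerivAt_hFun (hφ : IsEnergyProfile φ E0) (hψ : ContDiff ℝ 1 ψ) (m : ℝ) (p : ℝ × ℝ) :
    HasFDerivAt (fun p : ℝ × ℝ => hFun φ ψ E0 m p.1 p.2)
      (hFunC φ ψ E0 m p.1 p.2 • ContinuousLinearMap.fst ℝ ℝ ℝ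
        + hFunU φ ψ E0 m p.1 p.2 • ContinuousLinearMap.snd ℝ ℝ ℝ) p := by
  have hs : Continuous fun x : ℝ => ContinuousLinearMap.toSpanSingleton ℝ x := by
    have : (fun x : ℝ => ContinuousLinearMap.toSpanSingleton ℝ x)
        = fun x : ℝ => x • ContinuousLinearMap.id ℝ ℝ := by
      funext x; ext; simp
    rw [this]; fun_prop
  have h := hasStrictFDerivAt_uncurry_coprod (𝕜 := ℝ) (u := p) (f := hFun φ ψ E0 m)
    (f₁ := fun c u => ContinuousLinearMap.toSpanSingleton ℝ (hFunC φ ψ E0 m c u))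
    (f₂ := fun c u => ContinuousLinearMap.toSpanSingleton ℝ (hFunU φ ψ E0 m c u))
    (Eventually.of_forall fun v => (hasDerivAt_hFun_left hφ hψ m v.1 v.2).hasFDerivAt)
    (Eventually.of_forall fun v => (hasDerivAt_hFun_right hφ hψ m v.1 v.2).hasFDerivAt)
    (hs.comp (continuous_hFunC hφ hψ m)).continuousAt
    (hs.comp (continuous_hFunU hφ hψ m)).continuousAt
  refine h.hasFDerivAt.congr_fderiv ?_
  ext <;> simp [Function.HasUncurry.uncurry]

/-- The derivative in `c` vanishes at `c = 0` because the function is even in `c`. -/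
theorem hFunC_zero (m u : ℝ) : hFunC φ ψ E0 m 0 u = 0 := by
  have h : ∀ a, angInt' ψ 0 a = 0 := fun a => by simp [angInt', angSum']
  simp [hFunC, energyInt, h]

theorem energyInt_eq_zero {F : ℝ → ℝ → ℝ} (hF : ∀ c, F c 0 = 0) {u : ℝ} (hu : E0 ≤ u) (m c : ℝ) :
    energyInt φ E0 m F c u = 0 := by
  unfold energyInt
  refine setIntegral_eq_zero_of_forall_eq_zero fun E hE => ?_
  rw [Real.sqrt_eq_zero_of_nonpos (by linarith [hE.2]), hF, mul_zero]

theorem hFun_eq_zero {u : ℝ} (hu : E0 ≤ u) (m c : ℝ) : hFun φ ψ E0 m c u = 0 := by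
  rw [hFun, energyInt_eq_zero (fun c => by simp [angInt]) hu, mul_zero]

theorem hFunC_eq_zero {u : ℝ} (hu : E0 ≤ u) (m c : ℝ) : hFunC φ ψ E0 m c u = 0 := by
  rw [hFunC, energyInt_eq_zero (fun c => by simp [angInt']) hu, mul_zero]

theorem hFunU_eq_zero {u : ℝ} (hu : E0 ≤ u) (m c : ℝ) : hFunU φ ψ E0 m c u = 0 := by
  rw [hFunU, energyRoot, energyInt_eq_zero (fun c => by simp) hu, mul_zero, neg_zero]

theorem hDens_eq_hFun (hψ : Continuous ψ) {m u : ℝ} (hu : m ≤ u) (γ r : ℝ) :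
    hDens φ ψ E0 γ r u = hFun φ ψ E0 m (γ * r) u := by
  unfold hDens
  split_ifs with h
  · simp only [integral_symm_eq_angInt hψ]
    rw [hFun, energyInt, intervalIntegral.integral_of_le h.le]
    congr 1
    refine (setIntegral_eq_of_subset_of_forall_sdiff_eq_zero measurableSet_Icc
      (fun E hE => ⟨hu.trans hE.1.le, hE.2⟩) fun E hE => ?_).symm
    have : E ≤ u := by
      by_contra hlt
      exact hE.2 ⟨not_le.1 hlt, hE.1.2⟩
    rw [Real.sqrt_eq_zero_of_nonpos (by linarith)]
    simp [angInt]
  · rw [hFun_eq_zero (not_lt.1 h)]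

theorem hasDerivAt_hDens (hφ : IsEnergyProfile φ E0) (hψ : ContDiff ℝ 1 ψ) {m u : ℝ} (hu : m < u)
    (γ r : ℝ) : HasDerivAt (fun u => hDens φ ψ E0 γ r u) (hFunU φ ψ E0 m (γ * r) u) u := by
  refine (hasDerivAt_hFun_right hφ hψ m (γ * r) u).congr_of_eventuallyEq ?_
  filter_upwards [lt_mem_nhds hu] with w hw
  exact hDens_eq_hFun hψ.continuous hw.le γ r

/-! ### The potential outside the support of the density -/

/-- Where the density of the steady state vanishes, the potential is at least the cut-off energy,
because `φ` is positive below it. -/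
theorem le_potential_of_density_eq_zero (hφ : IsEnergyProfile φ E0) {U0 : E3 → ℝ} {x : E3}
    (hx : density φ U0 x = 0) : E0 ≤ U0 x := by
  by_contra hlt
  push Not at hlt
  set u := U0 x with hu
  -- the substitution `E = t² / 2 + u`
  have himg : (fun t : ℝ => t ^ 2 / 2 + u) '' Ioi 0 = Ioi u := by
    ext E
    constructor
    · rintro ⟨t, ht, rfl⟩
      have ht : 0 < t := ht
      show u < t ^ 2 / 2 + u
      have : 0 < t ^ 2 := by positivity
      linarith
    · intro hE
      have hE : u < E := hE
      refine ⟨√(2 * (E - u)), Real.sqrt_pos.2 (by linarith), ?_⟩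
      simp only
      rw [Real.sq_sqrt (by linarith)]; ring
  have hder : ∀ t ∈ Ioi (0 : ℝ), HasDerivWithinAt (fun t : ℝ => t ^ 2 / 2 + u) t (Ioi 0) t := by
    intro t _
    have := (((hasDerivAt_id t).pow 2).div_const 2).add_const u
    refine (this.congr_deriv ?_).hasDerivWithinAt
    simp
  have hinj : InjOn (fun t : ℝ => t ^ 2 / 2 + u) (Ioi 0) := by
    intro s hs t ht hst
    have hs : 0 < s := hs
    have ht : 0 < t := ht
    simp only at hst
    exact (pow_left_inj₀ hs.le ht.le two_ne_zero).1 (by linarith)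
  set g : ℝ → ℝ := fun E => √(2 * (E - u)) * φ E with hg
  have hgi : IntegrableOn g (Ioi u) := by
    have h1 : IntegrableOn g (Icc u E0) :=
      (integrableOn_profile hφ u E0).continuousOn_mul (by fun_prop) isCompact_Icc
    have h2 : IntegrableOn g (Ici E0) := by
      refine (integrableOn_zero (μ := volume) (s := Ici E0)).congr ?_
      filter_upwards [ae_restrict_mem measurableSet_Ici, ae_restrict_of_ae hφ.zero] with E hE hz
      simp [hg, hz hE]
    refine (h1.union h2).mono_set fun E hE => ?_
    rcases le_total E E0 with h | h
    · exact Or.inl ⟨le_of_lt hE, h⟩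
    · exact Or.inr h
  have heq : ∀ t ∈ Ioi (0 : ℝ), |t| • g (t ^ 2 / 2 + u) = t ^ 2 * φ (t ^ 2 / 2 + u) := by
    intro t ht
    have ht : 0 < t := ht
    simp only [hg, smul_eq_mul]
    rw [show 2 * (t ^ 2 / 2 + u - u) = t ^ 2 by ring, Real.sqrt_sq ht.le, abs_of_pos ht]
    ring
  have hi := integral_fun_norm_addHaar (E := E3) volume fun t => φ (t ^ 2 / 2 + u)
  have hcv := integral_image_eq_integral_abs_deriv_smul measurableSet_Ioi hder hinj g
  rw [himg, setIntegral_congr_fun measurableSet_Ioi heq] at hcv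
  have h0 : ∫ E in Ioi u, g E = 0 := by
    rw [hcv]
    have h1 : density φ U0 x = ∫ v : E3, φ (‖v‖ ^ 2 / 2 + u) := rfl
    rw [h1, hi] at hx
    have hvol : (volume : Measure E3).real (ball 0 1) ≠ 0 := by
      rw [Measure.real, ENNReal.toReal_ne_zero]
      exact ⟨(measure_ball_pos _ _ one_pos).ne', measure_ball_lt_top.ne⟩
    simpa [hvol] using hx
  have hg0 : ∀ E, 0 ≤ g E := fun E => mul_nonneg (Real.sqrt_nonneg _) (hφ.nonneg E)
  have hz := (setIntegral_eq_zero_iff_of_nonneg_ae (Eventually.of_forall hg0) hgi).1 h0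
  have hfalse : ∀ᵐ E ∂(volume.restrict (Ioo u E0)), False := by
    have hz' : ∀ᵐ E ∂(volume.restrict (Ioo u E0)), g E = 0 :=
      ae_restrict_of_ae_restrict_of_subset (fun E hE => hE.1) hz
    filter_upwards [hz', ae_restrict_of_ae hφ.pos, ae_restrict_mem measurableSet_Ioo] with
      E h1 h2 h3
    have h4 : 0 < g E := mul_pos (Real.sqrt_pos.2 (by linarith [h3.1])) (h2 h3.2)
    exact h4.ne' h1
  rw [eventually_false_iff_eq_bot, ae_eq_bot, Measure.restrict_eq_zero, Real.volume_Ioo] at hfalse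
  simp at hfalse
  linarith

theorem le_potential_of_one_lt (hφ : IsEnergyProfile φ E0) {U0 : E3 → ℝ} (hU : IsSteadyState φ U0)
    {x : E3} (hx : 1 < ‖x‖) : E0 ≤ U0 x := by
  refine le_potential_of_density_eq_zero hφ (image_eq_zero_of_notMem_tsupport ?_)
  rw [hU.support]
  simpa using hx

end

/-! ### Lipschitz bounds across the origin -/

/-- A bound for the derivative away from the origin gives a Lipschitz bound, also for points whose
connecting segment passes through the origin. -/
theorem lipschitz_of_punctured_deriv {F : Type*} [NormedAddCommGroup F] [NormedSpace ℝ F]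
    {s : Set E3} (hs : Convex ℝ s) (h0 : (0 : E3) ∈ s) {f : E3 → F} {f' : E3 → E3 →L[ℝ] F} {C : ℝ}
    (hf : ContinuousOn f s) (hd : ∀ x ∈ s, x ≠ 0 → HasFDerivWithinAt f (f' x) s x)
    (hC : ∀ x ∈ s, x ≠ 0 → ‖f' x‖ ≤ C) {x y : E3} (hx : x ∈ s) (hy : y ∈ s) :
    ‖f x - f y‖ ≤ C * ‖x - y‖ := by
  have ha : ∀ x ∈ s, ∀ y ∈ s, (0 : E3) ∉ segment ℝ x y → ‖f x - f y‖ ≤ C * ‖x - y‖ := by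
    intro x hx y hy h
    have hsub : segment ℝ x y ⊆ s := hs.segment_subset hx hy
    have hne : ∀ w ∈ segment ℝ x y, w ≠ 0 := fun w hw hw0 => h (hw0 ▸ hw)
    exact (convex_segment x y).norm_image_sub_le_of_norm_hasFDerivWithin_le
      (fun w hw => (hd w (hsub hw) (hne w hw)).mono hsub) (fun w hw => hC w (hsub hw) (hne w hw))
      (right_mem_segment ℝ x y) (left_mem_segment ℝ x y)
  have hb : ∀ x ∈ s, ‖f x - f 0‖ ≤ C * ‖x‖ := by
    intro x hx
    rcases eq_or_ne x 0 with rfl | hx0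
    · simp
    have hmem : ∀ t ∈ Ioo (0 : ℝ) 1, t • x ∈ s := fun t ht => hs.smul_mem_of_zero_mem h0 hx
        ⟨ht.1.le, ht.2.le⟩
    have ht0 : Tendsto (fun t : ℝ => t • x) (𝓝[>] 0) (𝓝[s] 0) := by
      refine tendsto_nhdsWithin_iff.2 ⟨?_, ?_⟩
      · have : Tendsto (fun t : ℝ => t • x) (𝓝 0) (𝓝 ((0 : ℝ) • x)) :=
          (by fun_prop : Continuous fun t : ℝ => t • x).tendsto 0
        rw [zero_smul] at this
        exact this.mono_left nhdsWithin_le_nhds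
      · filter_upwards [Ioo_mem_nhdsGT (zero_lt_one (α := ℝ))] with t ht using hmem t ht
    have h1 : Tendsto (fun t : ℝ => ‖f x - f (t • x)‖) (𝓝[>] 0) (𝓝 ‖f x - f 0‖) :=
      (tendsto_const_nhds.sub ((hf 0 h0).tendsto.comp ht0)).norm
    have h2 : Tendsto (fun t : ℝ => C * ‖x - t • x‖) (𝓝[>] 0) (𝓝 (C * ‖x - 0‖)) :=
      ((tendsto_const_nhds.sub (ht0.mono_right nhdsWithin_le_nhds)).norm).const_mul C
    rw [sub_zero] at h2
    refine le_of_tendsto_of_tendsto h1 h2 ?_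
    filter_upwards [Ioo_mem_nhdsGT (zero_lt_one (α := ℝ))] with t ht
    refine ha x hx _ (hmem t ht) fun hz => ?_
    obtain ⟨a, b, ha, hb, hab, hz⟩ := hz
    rw [smul_smul, ← add_smul] at hz
    have : a + b * t ≠ 0 := by
      rcases hb.eq_or_lt with h | h
      · rw [← h] at hab ⊢; simp at hab; simp [hab]
      · have := mul_pos h ht.1; positivity
    exact (smul_ne_zero this hx0) hz
  -- if the segment contains the origin, then `‖x‖ + ‖y‖ = ‖x - y‖`
  by_cases h : (0 : E3) ∈ segment ℝ x y
  · have h1 := dist_add_dist_of_mem_segment h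
    rw [dist_zero_right, dist_zero_left, dist_eq_norm] at h1
    calc ‖f x - f y‖ = ‖(f x - f 0) - (f y - f 0)‖ := by rw [sub_sub_sub_cancel_right]
      _ ≤ ‖f x - f 0‖ + ‖f y - f 0‖ := norm_sub_le _ _
      _ ≤ C * ‖x‖ + C * ‖y‖ := add_le_add (hb x hx) (hb y hy)
      _ = C * ‖x - y‖ := by rw [← mul_add, h1]
  · exact ha x hx y hy h

/-! ### The space `X` -/

theorem convex_B (R : ℝ) : Convex ℝ (B R) := convex_closedBall _ _

theorem mem_B {x : E3} {R : ℝ} : x ∈ B R ↔ ‖x‖ ≤ R := by simp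

theorem SpaceX.mem (ξ : SpaceX) : MemX ξ.1 := ξ.2

theorem SpaceY.mem (f : SpaceY) : MemY f.1 := f.2

theorem SpaceX.hasFDerivWithinAt (ξ : SpaceX) {x : E3} (hx : x ∈ dotB 3) :
    HasFDerivWithinAt ξ.1 (grad ξ.1 x) (B 3) x :=
  (diffWithin_of_smooth ξ.mem.smooth hx).hasFDerivWithinAt

theorem SpaceX.norm_grad_le (ξ : SpaceX) {x : E3} (hx : x ∈ dotB 3) : ‖grad ξ.1 x‖ ≤ ‖ξ‖ :=
  le_ciSup (bddAboveX ξ) ⟨x, hx⟩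

theorem SpaceX.lipschitz (ξ : SpaceX) {x y : E3} (hx : x ∈ B 3) (hy : y ∈ B 3) :
    |ξ x - ξ y| ≤ ‖ξ‖ * ‖x - y‖ :=
  lipschitz_of_punctured_deriv (convex_B 3) zero_mem_B3 ξ.mem.cont
    (fun _ hx h0 => ξ.hasFDerivWithinAt ⟨hx, h0⟩) (fun _ hx h0 => ξ.norm_grad_le ⟨hx, h0⟩) hx hy

theorem SpaceX.abs_le (ξ : SpaceX) (x : E3) : |ξ x| ≤ ‖ξ‖ * ‖x‖ := by
  by_cases hx : x ∈ B 3
  · have := ξ.lipschitz hx zero_mem_B3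
    rwa [ξ.mem.map_zero, sub_zero, sub_zero] at this
  · rw [ξ.mem.zero_off x hx, abs_zero]; positivity

theorem SpaceX.sub_apply (ξ η : SpaceX) (x : E3) : (ξ - η) x = ξ x - η x := rfl
theorem SpaceX.add_apply (ξ η : SpaceX) (x : E3) : (ξ + η) x = ξ x + η x := rfl
theorem SpaceX.smul_apply (c : ℝ) (ξ : SpaceX) (x : E3) : (c • ξ) x = c * ξ x := rfl
theorem SpaceY.sub_apply (ξ η : SpaceY) (x : E3) : (ξ - η) x = ξ x - η x := rfl
theorem SpaceY.add_apply (ξ η : SpaceY) (x : E3) : (ξ + η) x = ξ x + η x := rfl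
theorem SpaceY.smul_apply (c : ℝ) (ξ : SpaceY) (x : E3) : (c • ξ) x = c * ξ x := rfl

theorem SpaceX.grad_sub (ξ η : SpaceX) {x : E3} (hx : x ∈ dotB 3) :
    grad (ξ - η).1 x = grad ξ.1 x - grad η.1 x :=
  fderivWithin_sub (uniqueDiff_B3 hx.1) (diffWithin_of_smooth ξ.mem.smooth hx)
    (diffWithin_of_smooth η.mem.smooth hx)

theorem SpaceX.continuousOn_grad (ξ : SpaceX) : ContinuousOn (grad ξ.1) (dotB 3) := by
  have hU : UniqueDiffOn ℝ (dotB 3) := by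
    intro x hx
    exact (uniqueDiff_B3 hx.1).mono_nhds (nhdsWithin_le_iff.2 (dotB_mem_nhdsWithin hx))
  have h := ξ.mem.smooth.continuousOn_fderivWithin hU le_rfl
  refine h.congr fun x hx => ?_
  exact fderivWithin_of_mem_nhdsWithin (dotB_mem_nhdsWithin hx) (uniqueDiff_B3 hx.1)
    (ξ.mem.smooth.differentiableOn one_ne_zero x hx)

/-! ### Radial vector fields and deformations -/

theorem norm_unitDir_le (x : E3) : ‖unitDir x‖ ≤ 1 := by
  rw [unitDir, norm_smul, norm_inv, norm_norm]
  exact inv_mul_le_one_of_le₀ le_rfl (norm_nonneg _)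

theorem norm_unitDir {x : E3} (hx : x ≠ 0) : ‖unitDir x‖ = 1 := by
  rw [unitDir, norm_smul, norm_inv, norm_norm, inv_mul_cancel₀ (norm_ne_zero_iff.2 hx)]

theorem norm_smul_unitDir (x : E3) : ‖x‖ • unitDir x = x := by
  rcases eq_or_ne x 0 with rfl | hx
  · simp
  · rw [unitDir, smul_smul, mul_inv_cancel₀ (norm_ne_zero_iff.2 hx), one_smul]

theorem unitDir_zero : unitDir 0 = 0 := by simp [unitDir]

theorem unitDir_smul {t : ℝ} (ht : 0 < t) (x : E3) : unitDir (t • x) = unitDir x := by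
  rw [unitDir, unitDir, norm_smul, Real.norm_of_nonneg ht.le, smul_smul, mul_inv]
  congr 1
  field_simp

/-- The derivative of `unitDir` away from the origin: `1 / |x|` times the projection onto the plane
perpendicular to `x`. -/
def dUnit (x : E3) : E3 →L[ℝ] E3 :=
  ‖x‖⁻¹ • (ContinuousLinearMap.id ℝ E3 - (innerSL ℝ (unitDir x)).smulRight (unitDir x))

theorem hasFDerivAt_unitDir {x : E3} (hx : x ≠ 0) : HasFDerivAt unitDir (dUnit x) x := by
  have hn : 0 < ‖x‖ := norm_pos_iff.2 hx
  have h1 : HasFDerivAt (fun x : E3 => ‖x‖) (innerSL ℝ (unitDir x)) x := by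
    have h := (hasStrictFDerivAt_norm_sq x).hasFDerivAt.sqrt (by positivity)
    simp only [Real.sqrt_sq (norm_nonneg _)] at h
    refine h.congr_fderiv ?_
    ext w
    simp [unitDir]
    field_simp
  have h2 : HasFDerivAt (fun x : E3 => ‖x‖⁻¹) (-(‖x‖ ^ 2)⁻¹ • innerSL ℝ (unitDir x)) x :=
    (hasDerivAt_inv hn.ne').comp_hasFDerivAt x h1
  refine (h2.smul (hasFDerivAt_id x)).congr_fderiv ?_
  ext1 w
  simp only [dUnit, unitDir, _root_.add_apply, _root_.smul_apply,
    ContinuousLinearMap.smulRight_apply, _root_.sub_apply, innerSL_apply_apply,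
    ContinuousLinearMap.id_apply, inner_smul_left, smul_sub, smul_smul, id]
  simp only [RCLike.conj_to_real, smul_eq_mul]
  rw [sub_eq_add_neg, ← neg_smul]
  congr 2
  field_simp

theorem norm_dUnit_le (x : E3) : ‖dUnit x‖ ≤ ‖x‖⁻¹ := by
  refine ContinuousLinearMap.opNorm_le_bound _ (by positivity) fun w => ?_
  rw [dUnit, _root_.smul_apply, norm_smul, norm_inv, norm_norm]
  gcongr
  simp only [_root_.sub_apply, ContinuousLinearMap.id_apply,
    ContinuousLinearMap.smulRight_apply, innerSL_apply_apply]
  rw [← sq_le_sq₀ (norm_nonneg _) (norm_nonneg _), norm_sub_sq_real, inner_smul_right,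
    norm_smul, real_inner_comm, mul_pow, Real.norm_eq_abs, sq_abs]
  have h1 : ‖unitDir x‖ ^ 2 ≤ 1 := pow_le_one₀ (norm_nonneg _) (norm_unitDir_le x)
  nlinarith [sq_nonneg (inner ℝ (unitDir x) w : ℝ)]

theorem continuousOn_unitDir : ContinuousOn unitDir {0}ᶜ := fun _ hx =>
  (hasFDerivAt_unitDir hx).continuousAt.continuousWithinAt

theorem continuousOn_dUnit : ContinuousOn dUnit {0}ᶜ := by
  unfold dUnit
  have h0 : Continuous fun a : E3 => (innerSL ℝ a).smulRight a :=
    isBoundedBilinearMap_smulRight.continuous.comp ((innerSL ℝ).continuous.prodMk continuous_id)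
  have h : ContinuousOn (fun x => (innerSL ℝ (unitDir x)).smulRight (unitDir x)) {0}ᶜ :=
    h0.comp_continuousOn continuousOn_unitDir
  exact (continuousOn_id.norm.inv₀ fun x hx => norm_ne_zero_iff.2 hx).smul
    (continuousOn_const.sub h)

/-- The radial vector field `ξ(x) x / |x|`. -/
def eta (ξ : SpaceX) (x : E3) : E3 := ξ x • unitDir x

/-- The derivative of `eta ξ` away from the origin. -/
def dEta (ξ : SpaceX) (x : E3) : E3 →L[ℝ] E3 :=
  (grad ξ.1 x).smulRight (unitDir x) + ξ x • dUnit x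

theorem deform_eq (ζ : SpaceX) (x : E3) : deform ζ x = x + eta ζ x := rfl

theorem eta_sub (ξ η : SpaceX) (x : E3) : eta (ξ - η) x = eta ξ x - eta η x := by
  simp only [eta, SpaceX.sub_apply, sub_smul]

theorem dEta_sub (ξ η : SpaceX) {x : E3} (hx : x ∈ dotB 3) :
    dEta (ξ - η) x = dEta ξ x - dEta η x := by
  unfold dEta
  rw [SpaceX.grad_sub _ _ hx, SpaceX.sub_apply]
  ext1 w
  simp only [_root_.add_apply, ContinuousLinearMap.smulRight_apply,
    _root_.sub_apply, _root_.smul_apply]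
  module

theorem norm_eta_le (ξ : SpaceX) (x : E3) : ‖eta ξ x‖ ≤ ‖ξ‖ * ‖x‖ := by
  rw [eta, norm_smul, Real.norm_eq_abs]
  calc _ ≤ ‖ξ‖ * ‖x‖ * 1 := by
        gcongr
        · exact ξ.abs_le x
        · exact norm_unitDir_le x
    _ = _ := mul_one _

theorem hasFDerivWithinAt_eta (ξ : SpaceX) {x : E3} (hx : x ∈ dotB 3) :
    HasFDerivWithinAt (eta ξ) (dEta ξ x) (B 3) x := by
  refine ((ξ.hasFDerivWithinAt hx).smul (hasFDerivAt_unitDir hx.2).hasFDerivWithinAt).congr_fderiv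
    ?_
  rw [dEta, add_comm]

theorem norm_dEta_le (ξ : SpaceX) {x : E3} (hx : x ∈ dotB 3) : ‖dEta ξ x‖ ≤ 2 * ‖ξ‖ := by
  have hn : 0 < ‖x‖ := norm_pos_iff.2 hx.2
  unfold dEta
  refine (norm_add_le _ _).trans ?_
  rw [ContinuousLinearMap.norm_smulRight_apply, norm_smul, Real.norm_eq_abs]
  calc _ ≤ ‖ξ‖ * 1 + (‖ξ‖ * ‖x‖) * ‖x‖⁻¹ := by
        gcongr
        · exact ξ.norm_grad_le hx
        · exact norm_unitDir_le x
        · exact ξ.abs_le x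
        · exact norm_dUnit_le x
    _ = 2 * ‖ξ‖ := by field_simp; ring

theorem continuousOn_dEta (ξ : SpaceX) : ContinuousOn (dEta ξ) (dotB 3) := by
  unfold dEta
  have hs : dotB 3 ⊆ {0}ᶜ := fun x hx => hx.2
  refine ContinuousOn.add ?_ ((ξ.mem.cont.mono sdiff_subset).smul (continuousOn_dUnit.mono hs))
  exact isBoundedBilinearMap_smulRight.continuous.comp_continuousOn
    (ξ.continuousOn_grad.prodMk (continuousOn_unitDir.mono hs))

theorem eta_zero (ξ : SpaceX) : eta ξ 0 = 0 := by simp [eta, unitDir_zero]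

theorem continuousOn_eta (ξ : SpaceX) : ContinuousOn (eta ξ) (B 3) := by
  intro x hx
  rcases eq_or_ne x 0 with rfl | h0
  · rw [ContinuousWithinAt, eta_zero]
    refine squeeze_zero_norm (fun x => norm_eta_le ξ x) ?_
    have : Continuous fun x : E3 => ‖ξ‖ * ‖x‖ := by fun_prop
    have h := this.tendsto 0
    rw [norm_zero, mul_zero] at h
    exact h.mono_left nhdsWithin_le_nhds
  · exact (hasFDerivWithinAt_eta ξ ⟨hx, h0⟩).continuousWithinAt

theorem eta_lipschitz (ξ : SpaceX) {x y : E3} (hx : x ∈ B 3) (hy : y ∈ B 3) :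
    ‖eta ξ x - eta ξ y‖ ≤ 2 * ‖ξ‖ * ‖x - y‖ :=
  lipschitz_of_punctured_deriv (convex_B 3) zero_mem_B3 (continuousOn_eta ξ)
    (fun _ hx h0 => hasFDerivWithinAt_eta ξ ⟨hx, h0⟩) (fun _ hx h0 => norm_dEta_le ξ ⟨hx, h0⟩) hx hy

/-- The derivative of the deformation `deform ζ` away from the origin. -/
def dDef (ζ : SpaceX) (x : E3) : E3 →L[ℝ] E3 := ContinuousLinearMap.id ℝ E3 + dEta ζ x

theorem hasFDerivWithinAt_deform (ζ : SpaceX) {x : E3} (hx : x ∈ dotB 3) :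
    HasFDerivWithinAt (deform ζ) (dDef ζ x) (B 3) x :=
  (hasFDerivWithinAt_id x _).add (hasFDerivWithinAt_eta ζ hx)

theorem continuousOn_dDef (ζ : SpaceX) : ContinuousOn (dDef ζ) (dotB 3) :=
  continuousOn_const.add (continuousOn_dEta ζ)

theorem continuousOn_deform (ζ : SpaceX) : ContinuousOn (deform ζ) (B 3) :=
  continuousOn_id.add (continuousOn_eta ζ)

theorem deform_zero (ζ : SpaceX) : deform ζ 0 = 0 := by rw [deform_eq, eta_zero, add_zero]

theorem norm_deform_sub_le (ζ ζ' : SpaceX) (x : E3) :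
    ‖deform ζ x - deform ζ' x‖ ≤ ‖ζ - ζ'‖ * ‖x‖ := by
  rw [deform_eq, deform_eq, add_sub_add_left_eq_sub, ← eta_sub]
  exact norm_eta_le _ _

theorem norm_dDef_sub_le (ζ ζ' : SpaceX) {x : E3} (hx : x ∈ dotB 3) :
    ‖dDef ζ x - dDef ζ' x‖ ≤ 2 * ‖ζ - ζ'‖ := by
  rw [dDef, dDef, add_sub_add_left_eq_sub, ← dEta_sub _ _ hx]
  exact norm_dEta_le _ hx

theorem norm_deform (ζ : SpaceX) (hζ : ‖ζ‖ < 1 / 3) (x : E3) : ‖deform ζ x‖ = ‖x‖ + ζ x := by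
  have h1 : deform ζ x = (‖x‖ + ζ x) • unitDir x := by
    rw [add_smul, norm_smul_unitDir]; rfl
  have h2 : 0 ≤ ‖x‖ + ζ x := by
    have := neg_abs_le (ζ x)
    nlinarith [ζ.abs_le x, norm_nonneg x, norm_nonneg ζ]
  rw [h1, norm_smul, Real.norm_of_nonneg h2]
  rcases eq_or_ne x 0 with rfl | hx
  · simp [ζ.mem.map_zero]
  · rw [norm_unitDir hx, mul_one]

theorem norm_deform_le (ζ : SpaceX) (x : E3) : ‖deform ζ x‖ ≤ (1 + ‖ζ‖) * ‖x‖ := by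
  rw [deform_eq, add_mul, one_mul]
  exact (norm_add_le _ _).trans (by gcongr; exact norm_eta_le ζ x)

theorem le_norm_deform (ζ : SpaceX) (hζ : ‖ζ‖ < 1 / 3) (x : E3) :
    (1 - ‖ζ‖) * ‖x‖ ≤ ‖deform ζ x‖ := by
  rw [norm_deform ζ hζ]
  linarith [neg_abs_le (ζ x), ζ.abs_le x]

theorem norm_dDef_le (ζ : SpaceX) (hζ : ‖ζ‖ < 1 / 3) {x : E3} (hx : x ∈ dotB 3) :
    ‖dDef ζ x‖ ≤ 2 := by
  unfold dDef
  refine (norm_add_le _ _).trans ?_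
  have := ContinuousLinearMap.norm_id_le (𝕜 := ℝ) (E := E3)
  linarith [norm_dEta_le ζ hx]

/-- Since `eta ζ` has Lipschitz constant `2 ‖ζ‖ < 2 / 3`, the deformation shrinks distances at most
by the factor `1 - 2 / 3`. -/
theorem deform_expand (ζ : SpaceX) (hζ : ‖ζ‖ < 1 / 3) {x y : E3} (hx : x ∈ B 3) (hy : y ∈ B 3) :
    ‖x - y‖ ≤ 3 * ‖deform ζ x - deform ζ y‖ := by
  have h1 := eta_lipschitz ζ hx hy
  have h2 : x - y = (deform ζ x - deform ζ y) - (eta ζ x - eta ζ y) := by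
    rw [deform_eq, deform_eq]; abel
  have h3 := norm_sub_le (deform ζ x - deform ζ y) (eta ζ x - eta ζ y)
  rw [← h2] at h3
  nlinarith [norm_nonneg (x - y)]

theorem injOn_deform (ζ : SpaceX) (hζ : ‖ζ‖ < 1 / 3) : InjOn (deform ζ) (B 3) := by
  intro x hx y hy h
  have := deform_expand ζ hζ hx hy
  rw [h, sub_self, norm_zero, mul_zero] at this
  exact sub_eq_zero.1 (norm_le_zero_iff.1 this)

theorem unitDir_deform (ζ : SpaceX) (hζ : ‖ζ‖ < 1 / 3) (x : E3) :
    unitDir (deform ζ x) = unitDir x := by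
  rcases eq_or_ne x 0 with rfl | hx
  · rw [deform_zero]
  have hn : 0 < ‖x‖ := norm_pos_iff.2 hx
  have h1 : deform ζ x = (1 + ζ x * ‖x‖⁻¹) • x := by
    rw [deform, unitDir, smul_smul, add_smul, one_smul]
  have h2 : 0 < 1 + ζ x * ‖x‖⁻¹ := by
    have h3 := ζ.abs_le x
    have h4 := neg_abs_le (ζ x)
    have : 0 < ‖x‖ + ζ x := by nlinarith
    have e : 1 + ζ x * ‖x‖⁻¹ = (‖x‖ + ζ x) * ‖x‖⁻¹ := by field_simp
    rw [e]; positivity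
  rw [h1, unitDir_smul h2]

/-- On each ray the deformation acts as `t ↦ t + ζ(t e)`, and the intermediate value theorem
applies. -/
theorem mem_image_deform (ζ : SpaceX) {y : E3} (hy : ‖y‖ ≤ 3 * (1 - ‖ζ‖)) :
    y ∈ deform ζ '' B 3 := by
  rcases eq_or_ne y 0 with rfl | hy0
  · exact ⟨0, zero_mem_B3, deform_zero ζ⟩
  set e := unitDir y with he
  have he1 : ‖e‖ = 1 := norm_unitDir hy0
  have hmem : ∀ t ∈ Icc (0 : ℝ) 3, t • e ∈ B 3 := fun t ht => by
    rw [mem_B, norm_smul, he1, mul_one, Real.norm_of_nonneg ht.1]; exact ht.2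
  have hc : ContinuousOn (fun t : ℝ => t + ζ (t • e)) (Icc 0 3) :=
    continuousOn_id.add (ζ.mem.cont.comp (by fun_prop) hmem)
  have hiv := intermediate_value_Icc (by norm_num : (0 : ℝ) ≤ 3) hc
  have h3 : ‖y‖ ∈ Icc ((fun t : ℝ => t + ζ (t • e)) 0) ((fun t : ℝ => t + ζ (t • e)) 3) := by
    constructor
    · simp [ζ.mem.map_zero]
    · have h1 := ζ.abs_le ((3 : ℝ) • e)
      rw [norm_smul, he1, Real.norm_of_nonneg (by norm_num)] at h1
      simp only
      linarith [neg_abs_le (ζ ((3 : ℝ) • e))]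
  obtain ⟨t, ht, hty⟩ := hiv h3
  have ht0 : 0 < t := by
    rcases ht.1.eq_or_lt with h | h
    · simp [← h, ζ.mem.map_zero] at hty
      exact absurd hty.symm (norm_ne_zero_iff.2 hy0)
    · exact h
  refine ⟨t • e, hmem t ht, ?_⟩
  have hu : unitDir (t • e) = e := by
    rw [unitDir_smul ht0, unitDir, he1, inv_one, one_smul]
  rw [deform, hu, ← add_smul]
  have : t + ζ (t • e) = ‖y‖ := hty
  rw [this, he, norm_smul_unitDir]

theorem B2_subset_image (ζ : SpaceX) (hζ : ‖ζ‖ < 1 / 3) : B 2 ⊆ deform ζ '' B 3 := fun y hy =>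
  mem_image_deform ζ (by have := mem_B.1 hy; linarith)

/-! ### The inverse of a deformation -/

theorem deformInv_mem (ζ : SpaceX) {y : E3} (hy : y ∈ deform ζ '' B 3) : deformInv ζ y ∈ B 3 :=
  Function.invFunOn_mem hy

theorem deform_deformInv (ζ : SpaceX) {y : E3} (hy : y ∈ deform ζ '' B 3) :
    deform ζ (deformInv ζ y) = y :=
  Function.invFunOn_eq hy

theorem deformInv_deform (ζ : SpaceX) (hζ : ‖ζ‖ < 1 / 3) {x : E3} (hx : x ∈ B 3) :
    deformInv ζ (deform ζ x) = x :=
  injOn_deform ζ hζ (deformInv_mem ζ ⟨x, hx, rfl⟩) hx (deform_deformInv ζ ⟨x, hx, rfl⟩)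

theorem deformInv_zero (ζ : SpaceX) (hζ : ‖ζ‖ < 1 / 3) : deformInv ζ 0 = 0 := by
  have := deformInv_deform ζ hζ zero_mem_B3
  rwa [deform_zero] at this

theorem norm_le_norm_deformInv (ζ : SpaceX) {y : E3} (hy : y ∈ deform ζ '' B 3) :
    ‖y‖ ≤ (1 + ‖ζ‖) * ‖deformInv ζ y‖ := by
  have := norm_deform_le ζ (deformInv ζ y)
  rwa [deform_deformInv ζ hy] at this

theorem norm_deformInv_le (ζ : SpaceX) (hζ : ‖ζ‖ < 1 / 3) {y : E3} (hy : y ∈ deform ζ '' B 3) :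
    (1 - ‖ζ‖) * ‖deformInv ζ y‖ ≤ ‖y‖ := by
  have := le_norm_deform ζ hζ (deformInv ζ y)
  rwa [deform_deformInv ζ hy] at this

theorem norm_deformInv_lt_three (ζ : SpaceX) (hζ : ‖ζ‖ < 1 / 3) {y : E3} (hy : y ∈ B 2) :
    ‖deformInv ζ y‖ < 3 := by
  have h1 := norm_deformInv_le ζ hζ (B2_subset_image ζ hζ hy)
  have h2 := mem_B.1 hy
  by_contra h
  push Not at h
  nlinarith

theorem norm_deformInv_le_two_mul (ζ : SpaceX) (hζ : ‖ζ‖ < 1 / 3) {y : E3} (hy : y ∈ B 2) :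
    ‖deformInv ζ y‖ ≤ 2 * ‖y‖ := by
  have h1 := norm_deformInv_le ζ hζ (B2_subset_image ζ hζ hy)
  nlinarith [norm_nonneg (deformInv ζ y)]

theorem unitDir_deformInv (ζ : SpaceX) (hζ : ‖ζ‖ < 1 / 3) {y : E3} (hy : y ∈ deform ζ '' B 3) :
    unitDir (deformInv ζ y) = unitDir y := by
  rw [← unitDir_deform ζ hζ, deform_deformInv ζ hy]

theorem deformInv_ne_zero (ζ : SpaceX) {y : E3} (hy : y ∈ deform ζ '' B 3) (h0 : y ≠ 0) :
    deformInv ζ y ≠ 0 := fun h => h0 (by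
  have := deform_deformInv ζ hy
  rwa [h, deform_zero, eq_comm] at this)

theorem image_deform_mem_nhds (ζ : SpaceX) (hζ : ‖ζ‖ < 1 / 3) {y : E3} (hy : y ∈ B 2) :
    deform ζ '' B 3 ∈ 𝓝 y := by
  have h2 := mem_B.1 hy
  refine mem_of_superset (closedBall_mem_nhds_of_mem (c := (0 : E3)) (ε := 3 * (1 - ‖ζ‖)) ?_) ?_
  · simp only [mem_ball, dist_zero_right]; linarith
  · intro w hw
    exact mem_image_deform ζ (by simpa using hw)

/-- Joint Lipschitz continuity of `(ζ, y) ↦ g_ζ⁻¹(y)`; the difference in `ζ` comes with a weight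
that vanishes at the origin. -/
theorem deformInv_sub_le (ζ ζ' : SpaceX) (hζ' : ‖ζ'‖ < 1 / 3) {y y' : E3}
    (hy : y ∈ deform ζ '' B 3) (hy' : y' ∈ deform ζ' '' B 3) :
    ‖deformInv ζ y - deformInv ζ' y'‖ ≤ 3 * (‖ζ - ζ'‖ * ‖deformInv ζ y‖ + ‖y - y'‖) := by
  refine (deform_expand ζ' hζ' (deformInv_mem ζ hy) (deformInv_mem ζ' hy')).trans ?_
  rw [deform_deformInv ζ' hy']
  gcongr
  have h1 := norm_deform_sub_le ζ' ζ (deformInv ζ y)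
  have h2 := norm_add_le (deform ζ' (deformInv ζ y) - deform ζ (deformInv ζ y)) (y - y')
  rw [deform_deformInv ζ hy, sub_add_sub_cancel] at h2
  rw [deform_deformInv ζ hy, norm_sub_rev ζ'] at h1
  linarith

/-! ### The deformed potential -/

theorem continuousAt_deformInv (ζ : SpaceX) (hζ : ‖ζ‖ < 1 / 3) {y : E3} (hy : y ∈ B 2) :
    ContinuousAt (deformInv ζ) y := by
  rw [ContinuousAt, tendsto_iff_norm_sub_tendsto_zero]
  have h : Tendsto (fun w => 3 * ‖w - y‖) (𝓝 y) (𝓝 0) := by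
    have : Continuous fun w : E3 => 3 * ‖w - y‖ := by fun_prop
    simpa using this.tendsto y
  refine squeeze_zero' (Eventually.of_forall fun _ => norm_nonneg _) ?_ h
  filter_upwards [image_deform_mem_nhds ζ hζ hy] with w hw
  simpa using deformInv_sub_le ζ ζ hζ hw (B2_subset_image ζ hζ hy)

/-- The derivative of a deformation differs from the identity by at most `2 / 3`; so covectors can
be recovered from their pullbacks with the constant `3`. -/
theorem norm_le_three_mul_comp (ζ : SpaceX) (hζ : ‖ζ‖ < 1 / 3) {x : E3} (hx : x ∈ dotB 3)
    (p : E3 →L[ℝ] ℝ) : ‖p‖ ≤ 3 * ‖p.comp (dDef ζ x)‖ := by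
  have h1 : p = p.comp (dDef ζ x) - p.comp (dEta ζ x) := by
    ext w; simp [dDef]
  have h2 : ‖p.comp (dEta ζ x)‖ ≤ ‖p‖ * (2 * ‖ζ‖) :=
    (p.opNorm_comp_le _).trans (by gcongr; exact norm_dEta_le ζ hx)
  have h3 := norm_sub_le (p.comp (dDef ζ x)) (p.comp (dEta ζ x))
  rw [← h1] at h3
  nlinarith [norm_nonneg p]

theorem dDef_injective (ζ : SpaceX) (hζ : ‖ζ‖ < 1 / 3) {x : E3} (hx : x ∈ dotB 3) :
    Function.Injective (dDef ζ x) := by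
  refine (injective_iff_map_eq_zero (dDef ζ x)).2 fun w hw => ?_
  have h1 : w = -(dEta ζ x w) := by
    have : w + dEta ζ x w = 0 := by simpa [dDef] using hw
    exact eq_neg_of_add_eq_zero_left this
  have h2 : ‖w‖ ≤ 2 * ‖ζ‖ * ‖w‖ := by
    conv_lhs => rw [h1, norm_neg]
    exact (ContinuousLinearMap.le_opNorm _ _).trans (by gcongr; exact norm_dEta_le ζ hx)
  have : ‖w‖ ≤ 0 := by nlinarith [norm_nonneg w]
  exact norm_le_zero_iff.1 this

section Pot
variable {U0 : E3 → ℝ} {φ : ℝ → ℝ}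

theorem potential_symm (hU : IsSteadyState φ U0) {A : E3 → E3} (hA : A ∈ symS) (x : E3) :
    U0 (A x) = U0 x := by
  obtain ⟨L, hL⟩ := symS_isometry hA
  exact hU.radial _ _ (by rw [hL, L.norm_map])

theorem hasFDerivAt_potential (hU : IsSteadyState φ U0) (x : E3) :
    HasFDerivAt U0 (fderiv ℝ U0 x) x :=
  ((hU.potential_smooth.differentiable two_ne_zero) x).hasFDerivAt

theorem continuous_fderiv_potential (hU : IsSteadyState φ U0) : Continuous (fderiv ℝ U0) :=
  hU.potential_smooth.continuous_fderiv two_ne_zero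

theorem hasFDerivAt_potential_gradient (hU : IsSteadyState φ U0) (x : E3) :
    HasFDerivAt U0 (innerSL ℝ (gradient U0 x)) x :=
  ((hU.potential_smooth.differentiable two_ne_zero) x).hasGradientAt.hasFDerivAt

theorem fderiv_potential_zero (hU : IsSteadyState φ U0) : fderiv ℝ U0 0 = 0 := by
  have h := hasFDerivAt_potential_gradient hU 0
  have h0 := gradient_zero_of_symm (fun A hA x => potential_symm hU hA x) h
  rw [h.fderiv, h0, map_zero]

/-- At the origin the deformation need not be differentiable, but `∇U₀` vanishes there and the
inverse deformation is Lipschitz continuous. -/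
theorem hasFDerivAt_defPot_zero (hU : IsSteadyState φ U0) (ζ : SpaceX) (hζ : ‖ζ‖ < 1 / 3) :
    HasFDerivAt (defPot U0 ζ) (0 : E3 →L[ℝ] ℝ) 0 := by
  have h0 : (0 : E3) ∈ B 2 := by simp
  have hc := continuousAt_deformInv ζ hζ h0
  rw [ContinuousAt, deformInv_zero ζ hζ] at hc
  have h1 := hasFDerivAt_potential hU 0
  rw [fderiv_potential_zero hU, hasFDerivAt_iff_isLittleO] at h1
  have h2 := h1.comp_tendsto hc
  rw [hasFDerivAt_iff_isLittleO]
  have h3 : ((fun x' : E3 => x' - 0) ∘ deformInv ζ) =O[𝓝 0] fun y : E3 => y - 0 := by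
    refine Asymptotics.IsBigO.of_bound 2 ?_
    filter_upwards [closedBall_mem_nhds (0 : E3) two_pos] with y hy
    simpa using norm_deformInv_le_two_mul ζ hζ hy
  refine (h2.trans_isBigO h3).congr_left fun y => ?_
  simp [defPot, deformInv_zero ζ hζ]

theorem deformInv_mem_dotB (ζ : SpaceX) (hζ : ‖ζ‖ < 1 / 3) {y : E3} (hy : y ∈ B 2) (h0 : y ≠ 0) :
    deformInv ζ y ∈ dotB 3 :=
  ⟨deformInv_mem ζ (B2_subset_image ζ hζ hy), deformInv_ne_zero ζ (B2_subset_image ζ hζ hy) h0⟩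

/-- The inverse function theorem at `y ≠ 0`. The derivative `p` of the deformed potential is
described by its pullback, which avoids inverting the derivative of the deformation. -/
theorem exists_hasFDerivAt_defPot (hU : IsSteadyState φ U0) (ζ : SpaceX) (hζ : ‖ζ‖ < 1 / 3) {y : E3}
    (hy : y ∈ B 2) (h0 : y ≠ 0) : ∃ p : E3 →L[ℝ] ℝ, HasFDerivAt (defPot U0 ζ) p y ∧
      p.comp (dDef ζ (deformInv ζ y)) = fderiv ℝ U0 (deformInv ζ y) := by
  have hx := deformInv_mem_dotB ζ hζ hy h0
  have hn : B 3 ∈ 𝓝 (deformInv ζ y) :=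
    closedBall_mem_nhds_of_mem (by simpa using norm_deformInv_lt_three ζ hζ hy)
  let e : E3 ≃L[ℝ] E3 :=
    (LinearEquiv.ofInjectiveEndo (dDef ζ (deformInv ζ y)).toLinearMap
      (dDef_injective ζ hζ hx)).toContinuousLinearEquiv
  have he : (e : E3 →L[ℝ] E3) = dDef ζ (deformInv ζ y) := by ext1 w; rfl
  have hg : HasFDerivAt (deform ζ) (e : E3 →L[ℝ] E3) (deformInv ζ y) := by
    rw [he]; exact (hasFDerivWithinAt_deform ζ hx).hasFDerivAt hn
  have hinv := hg.of_local_left_inverse (continuousAt_deformInv ζ hζ hy) (by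
    filter_upwards [image_deform_mem_nhds ζ hζ hy] with w hw using deform_deformInv ζ hw)
  refine ⟨_, (hasFDerivAt_potential hU _).comp y hinv, ?_⟩
  rw [← he]
  ext1 w
  simp

/-- The derivative of the deformed potential `U_ζ`. -/
def dPot (U0 : E3 → ℝ) (ζ : SpaceX) (y : E3) : E3 →L[ℝ] ℝ := fderiv ℝ (defPot U0 ζ) y

theorem hasFDerivAt_defPot (hU : IsSteadyState φ U0) (ζ : SpaceX) (hζ : ‖ζ‖ < 1 / 3) {y : E3}
    (hy : y ∈ B 2) : HasFDerivAt (defPot U0 ζ) (dPot U0 ζ y) y := by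
  rcases eq_or_ne y 0 with rfl | h0
  · exact (hasFDerivAt_defPot_zero hU ζ hζ).differentiableAt.hasFDerivAt
  · obtain ⟨p, hp, -⟩ := exists_hasFDerivAt_defPot hU ζ hζ hy h0
    exact hp.differentiableAt.hasFDerivAt

theorem dPot_zero (hU : IsSteadyState φ U0) (ζ : SpaceX) (hζ : ‖ζ‖ < 1 / 3) : dPot U0 ζ 0 = 0 :=
  (hasFDerivAt_defPot_zero hU ζ hζ).fderiv

theorem dPot_comp (hU : IsSteadyState φ U0) (ζ : SpaceX) (hζ : ‖ζ‖ < 1 / 3) {y : E3}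
    (hy : y ∈ B 2) (h0 : y ≠ 0) :
    (dPot U0 ζ y).comp (dDef ζ (deformInv ζ y)) = fderiv ℝ U0 (deformInv ζ y) := by
  obtain ⟨p, hp, hc⟩ := exists_hasFDerivAt_defPot hU ζ hζ hy h0
  rw [dPot, hp.fderiv, hc]

theorem norm_dPot_le (hU : IsSteadyState φ U0) (ζ : SpaceX) (hζ : ‖ζ‖ < 1 / 3) {y : E3}
    (hy : y ∈ B 2) : ‖dPot U0 ζ y‖ ≤ 3 * ‖fderiv ℝ U0 (deformInv ζ y)‖ := by
  rcases eq_or_ne y 0 with rfl | h0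
  · rw [dPot_zero hU ζ hζ, norm_zero]; positivity
  · rw [← dPot_comp hU ζ hζ hy h0]
    exact norm_le_three_mul_comp ζ hζ (deformInv_mem_dotB ζ hζ hy h0) _

/-! ### Joint continuity in the deformation and the point -/

theorem continuousOn_deformInv_uncurry :
    ContinuousOn (fun q : SpaceX × E3 => deformInv q.1 q.2) (ball 0 (1 / 3) ×ˢ B 2) := by
  rintro ⟨ζ₀, y₀⟩ ⟨hζ₀, hy₀⟩
  have hζ₀ : ‖ζ₀‖ < 1 / 3 := by simpa using hζ₀
  rw [ContinuousWithinAt, tendsto_iff_norm_sub_tendsto_zero]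
  have h : Tendsto (fun q : SpaceX × E3 => 3 * (‖q.1 - ζ₀‖ * 3 + ‖q.2 - y₀‖))
      (𝓝[ball 0 (1 / 3) ×ˢ B 2] (ζ₀, y₀)) (𝓝 0) := by
    have : Continuous fun q : SpaceX × E3 => 3 * (‖q.1 - ζ₀‖ * 3 + ‖q.2 - y₀‖) := by fun_prop
    have h := this.tendsto (ζ₀, y₀)
    simp only [sub_self, norm_zero, zero_mul, add_zero, mul_zero] at h
    exact h.mono_left nhdsWithin_le_nhds
  refine squeeze_zero' (Eventually.of_forall fun _ => norm_nonneg _) ?_ h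
  filter_upwards [self_mem_nhdsWithin] with q hq
  have hζ : ‖q.1‖ < 1 / 3 := by simpa using hq.1
  have hy := B2_subset_image q.1 hζ hq.2
  refine (deformInv_sub_le q.1 ζ₀ hζ₀ hy (B2_subset_image ζ₀ hζ₀ hy₀)).trans ?_
  gcongr
  exact mem_B.1 (deformInv_mem q.1 hy)

theorem continuousOn_deformInv (ζ : SpaceX) (hζ : ‖ζ‖ < 1 / 3) : ContinuousOn (deformInv ζ) (B 2) :=
  fun _ hy => (continuousAt_deformInv ζ hζ hy).continuousWithinAt

theorem continuousOn_defPot_uncurry (hU : IsSteadyState φ U0) :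
    ContinuousOn (fun q : SpaceX × E3 => defPot U0 q.1 q.2) (ball 0 (1 / 3) ×ˢ B 2) :=
  hU.potential_smooth.continuous.comp_continuousOn continuousOn_deformInv_uncurry

/-- Joint continuity of `∇U_ζ(y)`. At the origin it follows from the bound by `∇U₀`, elsewhere from
the equation satisfied by the pullback of `∇U_ζ`. -/
theorem continuousOn_dPot_uncurry (hU : IsSteadyState φ U0) :
    ContinuousOn (fun q : SpaceX × E3 => dPot U0 q.1 q.2) (ball 0 (1 / 3) ×ˢ B 2) := by
  rintro ⟨ζ₀, y₀⟩ hq₀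
  have hζ₀ : ‖ζ₀‖ < 1 / 3 := by simpa using hq₀.1
  have hy₀ : y₀ ∈ B 2 := hq₀.2
  set l := 𝓝[ball 0 (1 / 3) ×ˢ B 2] (ζ₀, y₀) with hl
  have hinv : Tendsto (fun q : SpaceX × E3 => deformInv q.1 q.2) l (𝓝 (deformInv ζ₀ y₀)) :=
    continuousOn_deformInv_uncurry (ζ₀, y₀) hq₀
  have hDU : Tendsto (fun q : SpaceX × E3 => fderiv ℝ U0 (deformInv q.1 q.2)) l
      (𝓝 (fderiv ℝ U0 (deformInv ζ₀ y₀))) :=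
    ((continuous_fderiv_potential hU).tendsto _).comp hinv
  rw [ContinuousWithinAt, tendsto_iff_norm_sub_tendsto_zero]
  rcases eq_or_ne y₀ 0 with rfl | h0
  · simp only [dPot_zero hU ζ₀ hζ₀, sub_zero]
    have h := (hDU.norm).const_mul 3
    rw [deformInv_zero ζ₀ hζ₀, fderiv_potential_zero hU, norm_zero, mul_zero] at h
    refine squeeze_zero' (Eventually.of_forall fun _ => norm_nonneg _) ?_ h
    filter_upwards [self_mem_nhdsWithin] with q hq
    exact norm_dPot_le hU q.1 (by simpa using hq.1) hq.2
  · have hx₀ := deformInv_mem_dotB ζ₀ hζ₀ hy₀ h0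
    have hne : ∀ᶠ q in l, q.2 ≠ 0 := by
      have : Tendsto (fun q : SpaceX × E3 => q.2) l (𝓝 y₀) :=
        (continuous_snd.tendsto (ζ₀, y₀)).mono_left nhdsWithin_le_nhds
      exact this.eventually_ne h0
    have hmem : ∀ᶠ q in l, ‖q.1‖ < 1 / 3 ∧ q.2 ∈ B 2 ∧ q.2 ≠ 0 := by
      filter_upwards [self_mem_nhdsWithin, hne] with q hq h
      exact ⟨by simpa using hq.1, hq.2, h⟩
    have hdot : Tendsto (fun q : SpaceX × E3 => deformInv q.1 q.2) l
        (𝓝[dotB 3] (deformInv ζ₀ y₀)) := by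
      refine tendsto_nhdsWithin_iff.2 ⟨hinv, ?_⟩
      filter_upwards [hmem] with q hq using deformInv_mem_dotB q.1 hq.1 hq.2.1 hq.2.2
    have hD : Tendsto (fun q : SpaceX × E3 => dDef ζ₀ (deformInv q.1 q.2)) l
        (𝓝 (dDef ζ₀ (deformInv ζ₀ y₀))) := (continuousOn_dDef ζ₀ _ hx₀).tendsto.comp hdot
    have hζ : Tendsto (fun q : SpaceX × E3 => ‖q.1 - ζ₀‖) l (𝓝 0) := by
      have : Continuous fun q : SpaceX × E3 => ‖q.1 - ζ₀‖ := by fun_prop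
      have h := this.tendsto (ζ₀, y₀)
      rw [sub_self, norm_zero] at h
      exact h.mono_left nhdsWithin_le_nhds
    set p₀ := dPot U0 ζ₀ y₀ with hp₀
    have hb : Tendsto (fun q : SpaceX × E3 =>
        3 * (‖fderiv ℝ U0 (deformInv q.1 q.2) - fderiv ℝ U0 (deformInv ζ₀ y₀)‖
          + ‖p₀‖ * (2 * ‖q.1 - ζ₀‖ + ‖dDef ζ₀ (deformInv q.1 q.2) - dDef ζ₀ (deformInv ζ₀ y₀)‖)))
        l (𝓝 0) := by
      have h1 := tendsto_iff_norm_sub_tendsto_zero.1 hDU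
      have h2 := tendsto_iff_norm_sub_tendsto_zero.1 hD
      have h3 := (h1.add (((hζ.const_mul 2).add h2).const_mul ‖p₀‖)).const_mul 3
      simpa using h3
    refine squeeze_zero' (Eventually.of_forall fun _ => norm_nonneg _) ?_ hb
    filter_upwards [hmem] with q ⟨hq1, hq2, hq3⟩
    have hx := deformInv_mem_dotB q.1 hq1 hq2 hq3
    have e : (dPot U0 q.1 q.2 - p₀).comp (dDef q.1 (deformInv q.1 q.2))
        = (fderiv ℝ U0 (deformInv q.1 q.2) - fderiv ℝ U0 (deformInv ζ₀ y₀))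
          - p₀.comp ((dDef q.1 (deformInv q.1 q.2) - dDef ζ₀ (deformInv q.1 q.2))
            + (dDef ζ₀ (deformInv q.1 q.2) - dDef ζ₀ (deformInv ζ₀ y₀))) := by
      rw [← dPot_comp hU q.1 hq1 hq2 hq3, ← dPot_comp hU ζ₀ hζ₀ hy₀ h0]
      ext w
      simp [hp₀]
    refine (norm_le_three_mul_comp q.1 hq1 hx _).trans ?_
    rw [e]
    gcongr
    refine (norm_sub_le _ _).trans ?_
    gcongr
    refine (p₀.opNorm_comp_le _).trans ?_
    gcongr
    exact (norm_add_le _ _).trans (by gcongr; exact norm_dDef_sub_le _ _ hx)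

/-- The derivative of the deformed potential with respect to the deformation:
`U_{ζ+sξ}(y) = U_ζ(y - s ξ(x_s) y/|y|)` with `x_s` the preimage of `y` under `g_{ζ+sξ}`. -/
theorem hasDerivAt_defPot_line (hU : IsSteadyState φ U0) (ζ ξ : SpaceX) (hζ : ‖ζ‖ < 1 / 3) {y : E3}
    (hy : y ∈ B 2) : HasDerivAt (fun s : ℝ => defPot U0 (ζ + s • ξ) y)
      (-(dPot U0 ζ y (unitDir y) * ξ (deformInv ζ y))) 0 := by
  have hline : Continuous fun s : ℝ => ζ + s • ξ := by fun_prop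
  have hev : ∀ᶠ s : ℝ in 𝓝 0, ‖ζ + s • ξ‖ < 1 / 3 :=
    (hline.norm.tendsto 0).eventually_lt_const (by simpa using hζ)
  have hx : Tendsto (fun s : ℝ => deformInv (ζ + s • ξ) y) (𝓝 0) (𝓝 (deformInv ζ y)) := by
    have h1 : Tendsto (fun q : SpaceX × E3 => deformInv q.1 q.2)
        (𝓝[ball 0 (1 / 3) ×ˢ B 2] (ζ, y)) (𝓝 (deformInv ζ y)) :=
      continuousOn_deformInv_uncurry (ζ, y) ⟨by simpa using hζ, hy⟩
    have h2 : Tendsto (fun s : ℝ => (ζ + s • ξ, y)) (𝓝 0) (𝓝[ball 0 (1 / 3) ×ˢ B 2] (ζ, y)) := by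
      refine tendsto_nhdsWithin_iff.2 ⟨?_, ?_⟩
      · have : Continuous fun s : ℝ => (ζ + s • ξ, y) := by fun_prop
        simpa using this.tendsto 0
      · filter_upwards [hev] with s hs
        exact ⟨by simpa using hs, hy⟩
    have h3 := h1.comp h2
    exact h3
  have hxB : ∀ᶠ s : ℝ in 𝓝 0, deformInv (ζ + s • ξ) y ∈ B 3 := by
    filter_upwards [hev] with s hs using deformInv_mem _ (B2_subset_image _ hs hy)
  have hξ : Tendsto (fun s : ℝ => ξ (deformInv (ζ + s • ξ) y)) (𝓝 0) (𝓝 (ξ (deformInv ζ y))) := by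
    have hxw : Tendsto (fun s : ℝ => deformInv (ζ + s • ξ) y) (𝓝 0)
        (𝓝[B 3] (deformInv ζ y)) := tendsto_nhdsWithin_iff.2 ⟨hx, hxB⟩
    have hc : Tendsto ξ.1 (𝓝[B 3] (deformInv ζ y)) (𝓝 (ξ.1 (deformInv ζ y))) :=
      ξ.mem.cont _ (deformInv_mem ζ (B2_subset_image ζ hζ hy))
    exact hc.comp hxw
  -- `s ↦ s ξ(x_s)` is differentiable at zero although `ξ(x_s)` is merely continuous
  have hys : HasDerivAt (fun s : ℝ => y - (s * ξ (deformInv (ζ + s • ξ) y)) • unitDir y)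
      (-(ξ (deformInv ζ y) • unitDir y)) 0 := by
    have h1 : HasDerivAt (fun s : ℝ => s * ξ (deformInv (ζ + s • ξ) y)) (ξ (deformInv ζ y)) 0 := by
      rw [hasDerivAt_iff_tendsto_slope]
      refine (hξ.mono_left nhdsWithin_le_nhds).congr' ?_
      filter_upwards [self_mem_nhdsWithin] with s hs
      have hs : s ≠ 0 := hs
      simp [slope_def_field, hs]
    exact (h1.smul_const (unitDir y)).const_sub y
  have hcomp : HasDerivAt (fun s : ℝ => defPot U0 ζ
      (y - (s * ξ (deformInv (ζ + s • ξ) y)) • unitDir y))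
      (dPot U0 ζ y (-(ξ (deformInv ζ y) • unitDir y))) 0 := by
    have h0 : y - ((0 : ℝ) * ξ (deformInv (ζ + (0 : ℝ) • ξ) y)) • unitDir y = y := by simp
    have hd : HasFDerivAt (defPot U0 ζ) (dPot U0 ζ y)
        (y - ((0 : ℝ) * ξ (deformInv (ζ + (0 : ℝ) • ξ) y)) • unitDir y) := by
      rw [h0]
      exact hasFDerivAt_defPot hU ζ hζ hy
    have h2 := hd.comp_hasDerivAt (0 : ℝ) hys
    exact h2
  refine (hcomp.congr_deriv ?_).congr_of_eventuallyEq ?_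
  · rw [map_neg, map_smul, smul_eq_mul, mul_comm]
  · filter_upwards [hev, hxB] with s hs hsB
    have hyi := B2_subset_image _ hs hy
    have h1 := deform_deformInv (ζ + s • ξ) hyi
    have h2 := unitDir_deformInv (ζ + s • ξ) hs hyi
    unfold defPot
    congr 1
    have h3 : deform ζ (deformInv (ζ + s • ξ) y)
        = y - (s * ξ (deformInv (ζ + s • ξ) y)) • unitDir y := by
      have h4 : deform (ζ + s • ξ) (deformInv (ζ + s • ξ) y)
          = deform ζ (deformInv (ζ + s • ξ) y)
            + (s * ξ (deformInv (ζ + s • ξ) y)) • unitDir (deformInv (ζ + s • ξ) y) := by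
        rw [deform, deform, SpaceX.add_apply, SpaceX.smul_apply, add_smul, add_assoc]
      rw [h1, h2] at h4
      rw [eq_sub_iff_add_eq]
      exact h4.symm
    rw [← h3, deformInv_deform ζ hζ hsB]

end Pot

/-! ### Symmetry of the deformed potential -/

theorem deform_symm (ζ : SpaceX) {A : E3 → E3} (hA : A ∈ symS) {x : E3} (hx : x ∈ B 3) :
    deform ζ (A x) = A (deform ζ x) := by
  obtain ⟨L, hL⟩ := symS_isometry hA
  rw [deform, ζ.mem.symm A hA x hx, hL, hL, deform, map_add, map_smul]
  simp [unitDir]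

theorem symS_mem_B {A : E3 → E3} (hA : A ∈ symS) {R : ℝ} {x : E3} (hx : x ∈ B R) : A x ∈ B R := by
  obtain ⟨L, hL⟩ := symS_isometry hA
  rw [mem_B, hL, L.norm_map]
  exact mem_B.1 hx

theorem deformInv_symm (ζ : SpaceX) (hζ : ‖ζ‖ < 1 / 3) {A : E3 → E3} (hA : A ∈ symS) {y : E3}
    (hy : y ∈ deform ζ '' B 3) : deformInv ζ (A y) = A (deformInv ζ y) := by
  have h1 := deformInv_mem ζ hy
  have h2 := deform_symm ζ hA h1
  rw [deform_deformInv ζ hy] at h2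
  rw [← h2, deformInv_deform ζ hζ (symS_mem_B hA h1)]

theorem defPot_symm {φ : ℝ → ℝ} {U0 : E3 → ℝ} (hU : IsSteadyState φ U0) (ζ : SpaceX)
    (hζ : ‖ζ‖ < 1 / 3) {A : E3 → E3} (hA : A ∈ symS) {y : E3} (hy : y ∈ deform ζ '' B 3) :
    defPot U0 ζ (A y) = defPot U0 ζ y := by
  rw [defPot, deformInv_symm ζ hζ hA hy, potential_symm hU hA, defPot]

theorem dPot_unitDir_symm {φ : ℝ → ℝ} {U0 : E3 → ℝ} (hU : IsSteadyState φ U0) (ζ : SpaceX)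
    (hζ : ‖ζ‖ < 1 / 3) {A : E3 → E3} (hA : A ∈ symS) {y : E3} (hy : y ∈ B 2) :
    dPot U0 ζ (A y) (unitDir (A y)) = dPot U0 ζ y (unitDir y) := by
  obtain ⟨L, hL⟩ := symS_isometry hA
  have h1 := hasFDerivAt_defPot hU ζ hζ (symS_mem_B hA hy)
  rw [hL] at h1 ⊢
  have h2 : HasFDerivAt (fun w => defPot U0 ζ (L w))
      ((dPot U0 ζ (L y)).comp (L.toContinuousLinearEquiv : E3 →L[ℝ] E3)) y :=
    h1.comp y (L.toContinuousLinearEquiv : E3 →L[ℝ] E3).hasFDerivAt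
  have h3 : (fun w => defPot U0 ζ (L w)) =ᶠ[𝓝 y] defPot U0 ζ := by
    filter_upwards [image_deform_mem_nhds ζ hζ hy] with w hw
    rw [← hL, defPot_symm hU ζ hζ hA hw]
  have h4 := (h2.congr_of_eventuallyEq h3.symm).unique (hasFDerivAt_defPot hU ζ hζ hy)
  rw [← h4]
  simp [unitDir]

/-! ### The distance to the axis -/

/-- The orthogonal projection onto the plane through the origin perpendicular to the third axis. -/
def planeProj : E3 →L[ℝ] E3 :=
  LinearMap.toContinuousLinearMap
    { toFun := fun x => !₂[x 0, x 1, 0]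
      map_add' := fun x y => by ext i; fin_cases i <;> simp
      map_smul' := fun c x => by ext i; fin_cases i <;> simp }

theorem cylRadius_eq (x : E3) : cylRadius x = ‖planeProj x‖ := by
  rw [EuclideanSpace.norm_eq]
  simp [cylRadius, planeProj, Fin.sum_univ_three]

theorem cylRadius_lipschitz (x y : E3) : |cylRadius x - cylRadius y| ≤ ‖x - y‖ := by
  rw [cylRadius_eq, cylRadius_eq]
  refine (abs_norm_sub_norm_le _ _).trans ?_
  rw [← map_sub]
  rw [EuclideanSpace.norm_eq, EuclideanSpace.norm_eq]
  refine Real.sqrt_le_sqrt ?_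
  simp only [Fin.sum_univ_three, planeProj]
  simp
  positivity

theorem continuous_cylRadius : Continuous cylRadius := by
  have : cylRadius = fun x => ‖planeProj x‖ := funext cylRadius_eq
  rw [this]; fun_prop

theorem norm_fderiv_cylRadius_le (x : E3) : ‖fderiv ℝ cylRadius x‖ ≤ 1 :=
  norm_fderiv_le_of_lip' ℝ zero_le_one (Eventually.of_forall fun y => by
    simpa using cylRadius_lipschitz y x)

theorem contDiffAt_cylRadius {x : E3} (hx : cylRadius x ≠ 0) : ContDiffAt ℝ 1 cylRadius x := by
  have : cylRadius = fun x => ‖planeProj x‖ := funext cylRadius_eq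
  rw [this]
  refine ContDiffAt.norm ℝ planeProj.contDiff.contDiffAt ?_
  intro h
  rw [cylRadius_eq, h, norm_zero] at hx
  exact hx rfl

theorem continuousAt_fderiv_cylRadius {x : E3} (hx : cylRadius x ≠ 0) :
    ContinuousAt (fderiv ℝ cylRadius) x :=
  (contDiffAt_cylRadius hx).continuousAt_fderiv one_ne_zero

/-! ### The densities induced by the deformed potentials -/

/-- `H` is a `C¹` function of `(c, u)` with partial derivatives `Hc` and `Hu`, where `Hc` vanishes
for `c = 0`, and everything vanishes above the cut-off energy. -/
structure IsDensityFun (H Hc Hu : ℝ → ℝ → ℝ) (E0 : ℝ) : Prop where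
  hasFDerivAt : ∀ p : ℝ × ℝ, HasFDerivAt (fun p : ℝ × ℝ => H p.1 p.2)
    (Hc p.1 p.2 • ContinuousLinearMap.fst ℝ ℝ ℝ + Hu p.1 p.2 • ContinuousLinearMap.snd ℝ ℝ ℝ) p
  continuous_left : Continuous fun p : ℝ × ℝ => Hc p.1 p.2
  continuous_right : Continuous fun p : ℝ × ℝ => Hu p.1 p.2
  left_zero : ∀ u, Hc 0 u = 0
  eq_zero : ∀ c u, E0 ≤ u → H c u = 0
  left_eq_zero : ∀ c u, E0 ≤ u → Hc c u = 0
  right_eq_zero : ∀ c u, E0 ≤ u → Hu c u = 0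

theorem IsDensityFun.continuous {H Hc Hu : ℝ → ℝ → ℝ} {E0 : ℝ} (hH : IsDensityFun H Hc Hu E0) :
    Continuous fun p : ℝ × ℝ => H p.1 p.2 :=
  continuous_iff_continuousAt.2 fun p => (hH.hasFDerivAt p).continuousAt

/-- The parameters `(γ, ζ)` with `‖ζ‖ < 1 / 3`. -/
def params : Set (ℝ × SpaceX) := {q | ‖q.2‖ < 1 / 3}

theorem isOpen_params : IsOpen params :=
  isOpen_lt (continuous_snd.norm) continuous_const

/-- The density induced by the deformed potential, extended by zero. -/
def rho (H : ℝ → ℝ → ℝ) (U0 : E3 → ℝ) (q : ℝ × SpaceX) : E3 → ℝ :=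
  (B 2).indicator fun y => H (q.1 * cylRadius y) (defPot U0 q.2 y)

/-- The gradient of `rho`. -/
def dRho (Hc Hu : ℝ → ℝ → ℝ) (U0 : E3 → ℝ) (q : ℝ × SpaceX) : E3 → (E3 →L[ℝ] ℝ) :=
  (B 2).indicator fun y =>
    (Hc (q.1 * cylRadius y) (defPot U0 q.2 y) * q.1) • fderiv ℝ cylRadius y
      + Hu (q.1 * cylRadius y) (defPot U0 q.2 y) • dPot U0 q.2 y

/-- The derivative of `u ↦ H` times the radial derivative of the deformed potential. -/
def radRho (Hu : ℝ → ℝ → ℝ) (U0 : E3 → ℝ) (q : ℝ × SpaceX) (y : E3) : ℝ :=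
  Hu (q.1 * cylRadius y) (defPot U0 q.2 y) * dPot U0 q.2 y (unitDir y)

/-- The derivative of the induced density with respect to the deformation. -/
def sigmaRho (Hu : ℝ → ℝ → ℝ) (U0 : E3 → ℝ) (q : ℝ × SpaceX) (ξ : SpaceX) (y : E3) : ℝ :=
  -(radRho Hu U0 q y * ξ (deformInv q.2 y))

section Rho

variable {φ : ℝ → ℝ} {U0 : E3 → ℝ} {E0 : ℝ} {H Hc Hu : ℝ → ℝ → ℝ}

/-- The threshold `4 / 3` exceeds all values of `(1 + ‖ζ‖) ‖x‖` with `‖x‖ ≤ 1`. -/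
theorem le_defPot (hE : ∀ x, 1 < ‖x‖ → E0 ≤ U0 x) (ζ : SpaceX) (hζ : ‖ζ‖ < 1 / 3) {y : E3}
    (hy : y ∈ B 2) (h : 4 / 3 ≤ ‖y‖) : E0 ≤ defPot U0 ζ y := by
  refine hE _ ?_
  have h1 := norm_le_norm_deformInv ζ (B2_subset_image ζ hζ hy)
  -- otherwise `‖y‖ ≤ 1 + ‖ζ‖ < 4 / 3`
  by_contra! hc
  nlinarith [norm_nonneg (deformInv ζ y), norm_nonneg ζ]

/-- The chain rule for `H(γ r(y), U(y))`, which also holds on the axis, where `r` is not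
differentiable. -/
theorem hasFDerivAt_density (hH : IsDensityFun H Hc Hu E0) (γ : ℝ) {U : E3 → ℝ} {U' : E3 →L[ℝ] ℝ}
    {y : E3}
    (hU : HasFDerivAt U U' y) :
    HasFDerivAt (fun y => H (γ * cylRadius y) (U y))
      ((Hc (γ * cylRadius y) (U y) * γ) • fderiv ℝ cylRadius y + Hu (γ * cylRadius y) (U y) • U')
        y := by
  by_cases h0 : cylRadius y = 0
  · -- On the axis the radius is merely Lipschitz, but the derivative of `H` in `c` vanishes there.
    have hp := (hH.hasFDerivAt (γ * cylRadius y, U y)).isLittleO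
    rw [hasFDerivAt_iff_isLittleO]
    simp only [h0, mul_zero, hH.left_zero, zero_mul, zero_smul, zero_add] at hp ⊢
    have ht : Tendsto (fun y' => (γ * cylRadius y', U y')) (𝓝 y) (𝓝 (0, U y)) := by
      have h1 : Tendsto (fun y' => γ * cylRadius y') (𝓝 y) (𝓝 0) := by
        have := (continuous_cylRadius.tendsto y).const_mul γ
        rwa [h0, mul_zero] at this
      exact h1.prodMk_nhds hU.continuousAt
    have hO : (fun y' => (γ * cylRadius y', U y') - (0, U y)) =O[𝓝 y] fun y' => y' - y := by
      have h1 : (fun y' => γ * cylRadius y' - 0) =O[𝓝 y] fun y' => y' - y := by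
        refine Asymptotics.IsBigO.of_bound |γ| (Eventually.of_forall fun y' => ?_)
        rw [sub_zero, norm_mul, Real.norm_eq_abs, Real.norm_eq_abs]
        have := cylRadius_lipschitz y' y
        rw [h0, sub_zero] at this
        gcongr
      exact h1.prod_left hU.isBigO_sub
    have h1 := (hp.comp_tendsto ht).trans_isBigO hO
    have h2 := hU.isLittleO.const_mul_left (Hu 0 (U y))
    refine (h1.add h2).congr_left fun y' => ?_
    simp
    ring
  · have h1 : HasFDerivAt cylRadius (fderiv ℝ cylRadius y) y :=
      ((contDiffAt_cylRadius h0).differentiableAt one_ne_zero).hasFDerivAt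
    have h2 := (h1.const_mul γ).prodMk hU
    have h3 := HasFDerivAt.comp y (hH.hasFDerivAt (γ * cylRadius y, U y)) h2
    refine h3.congr_fderiv ?_
    ext w
    simp
    ring

theorem rho_eq_zero (hH : IsDensityFun H Hc Hu E0) (hE : ∀ x, 1 < ‖x‖ → E0 ≤ U0 x)
    {q : ℝ × SpaceX} (hq : q ∈ params) {y : E3} (h : 4 / 3 ≤ ‖y‖) : rho H U0 q y = 0 := by
  unfold rho
  by_cases hy : y ∈ B 2
  · rw [indicator_of_mem hy, hH.eq_zero _ _ (le_defPot hE q.2 hq hy h)]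
  · rw [indicator_of_notMem hy]

theorem dRho_eq_zero (hH : IsDensityFun H Hc Hu E0) (hE : ∀ x, 1 < ‖x‖ → E0 ≤ U0 x)
    {q : ℝ × SpaceX} (hq : q ∈ params) {y : E3} (h : 4 / 3 ≤ ‖y‖) : dRho Hc Hu U0 q y = 0 := by
  unfold dRho
  by_cases hy : y ∈ B 2
  · rw [indicator_of_mem hy, hH.left_eq_zero _ _ (le_defPot hE q.2 hq hy h),
      hH.right_eq_zero _ _ (le_defPot hE q.2 hq hy h), zero_mul, zero_smul, zero_smul, add_zero]
  · rw [indicator_of_notMem hy]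

/-- The density is differentiable everywhere, also at the boundary of `B 2`: it vanishes for
`‖y‖ ≥ 4 / 3`. -/
theorem hasFDerivAt_rho (hU : IsSteadyState φ U0) (hH : IsDensityFun H Hc Hu E0)
    (hE : ∀ x, 1 < ‖x‖ → E0 ≤ U0 x) {q : ℝ × SpaceX} (hq : q ∈ params) (y : E3) :
    HasFDerivAt (rho H U0 q) (dRho Hc Hu U0 q y) y := by
  rcases lt_or_ge ‖y‖ 2 with h | h
  · have hy : y ∈ B 2 := mem_B.2 h.le
    have hn : B 2 ∈ 𝓝 y := closedBall_mem_nhds_of_mem (by simpa using h)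
    unfold dRho
    rw [indicator_of_mem hy]
    refine (hasFDerivAt_density hH q.1 (hasFDerivAt_defPot hU q.2 hq hy)).congr_of_eventuallyEq ?_
    filter_upwards [hn] with w hw
    rw [rho, indicator_of_mem hw]
  · rw [dRho_eq_zero hH hE hq (by linarith)]
    refine (hasFDerivAt_const (0 : ℝ) y).congr_of_eventuallyEq ?_
    have : ∀ᶠ w in 𝓝 y, 4 / 3 < ‖w‖ :=
      (continuous_norm.tendsto y).eventually_const_lt (by linarith)
    filter_upwards [this] with w hw using rho_eq_zero hH hE hq hw.le

theorem continuousOn_args (hU : IsSteadyState φ U0) :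
    ContinuousOn (fun p : (ℝ × SpaceX) × E3 => (p.1.1 * cylRadius p.2, defPot U0 p.1.2 p.2))
      (params ×ˢ B 2) := by
  have h1 : Continuous fun p : (ℝ × SpaceX) × E3 => p.1.1 * cylRadius p.2 :=
    (continuous_fst.comp continuous_fst).mul (continuous_cylRadius.comp continuous_snd)
  have h2 : ContinuousOn (fun p : (ℝ × SpaceX) × E3 => defPot U0 p.1.2 p.2) (params ×ˢ B 2) := by
    refine (continuousOn_defPot_uncurry hU).comp (f := fun p : (ℝ × SpaceX) × E3 => (p.1.2, p.2))
      (by fun_prop) ?_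
    rintro p ⟨hp, hy⟩
    exact ⟨by simpa [params] using hp, hy⟩
  exact h1.continuousOn.prodMk h2

theorem continuousOn_dPot_params (hU : IsSteadyState φ U0) :
    ContinuousOn (fun p : (ℝ × SpaceX) × E3 => dPot U0 p.1.2 p.2) (params ×ˢ B 2) := by
  refine (continuousOn_dPot_uncurry hU).comp (f := fun p : (ℝ × SpaceX) × E3 => (p.1.2, p.2))
    (by fun_prop) ?_
  rintro p ⟨hp, hy⟩
  exact ⟨by simpa [params] using hp, hy⟩

/-- Joint continuity of the gradient of the density. On the axis the derivative of the radius is not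
continuous, but it is bounded and its factor vanishes there. -/
theorem continuousOn_dRho_uncurry (hU : IsSteadyState φ U0) (hH : IsDensityFun H Hc Hu E0) :
    ContinuousOn (fun p : (ℝ × SpaceX) × E3 => dRho Hc Hu U0 p.1 p.2) (params ×ˢ B 2) := by
  have hA := continuousOn_args hU
  have hC : ContinuousOn (fun p : (ℝ × SpaceX) × E3 =>
      Hc (p.1.1 * cylRadius p.2) (defPot U0 p.1.2 p.2) * p.1.1) (params ×ˢ B 2) :=
    (hH.continuous_left.comp_continuousOn hA).mul (by fun_prop)
  have h2 : ContinuousOn (fun p : (ℝ × SpaceX) × E3 =>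
      Hu (p.1.1 * cylRadius p.2) (defPot U0 p.1.2 p.2) • dPot U0 p.1.2 p.2) (params ×ˢ B 2) :=
    (hH.continuous_right.comp_continuousOn hA).smul (continuousOn_dPot_params hU)
  have h1 : ContinuousOn (fun p : (ℝ × SpaceX) × E3 =>
      (Hc (p.1.1 * cylRadius p.2) (defPot U0 p.1.2 p.2) * p.1.1) • fderiv ℝ cylRadius p.2)
      (params ×ˢ B 2) := by
    intro p hp
    by_cases h0 : cylRadius p.2 = 0
    · have h := hC p hp
      rw [ContinuousWithinAt] at h ⊢
      rw [h0, mul_zero, hH.left_zero, zero_mul] at h ⊢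
      rw [zero_smul]
      refine squeeze_zero_norm (a := fun p' : (ℝ × SpaceX) × E3 =>
        ‖Hc (p'.1.1 * cylRadius p'.2) (defPot U0 p'.1.2 p'.2) * p'.1.1‖) (fun p' => ?_) ?_
      · rw [norm_smul]
        exact mul_le_of_le_one_right (norm_nonneg _) (norm_fderiv_cylRadius_le _)
      · simpa using h.norm
    · exact (hC p hp).smul
        ((continuousAt_fderiv_cylRadius h0).comp continuousAt_snd).continuousWithinAt
  refine (h1.add h2).congr ?_
  rintro p ⟨-, hy⟩
  show dRho Hc Hu U0 p.1 p.2 = _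
  rw [dRho, indicator_of_mem hy]
  rfl

theorem contDiff_rho (hU : IsSteadyState φ U0) (hH : IsDensityFun H Hc Hu E0)
    (hE : ∀ x, 1 < ‖x‖ → E0 ≤ U0 x) {q : ℝ × SpaceX} (hq : q ∈ params) :
    ContDiff ℝ 1 (rho H U0 q) := by
  refine contDiff_one_iff_hasFDerivAt.2 ⟨dRho Hc Hu U0 q, ?_, hasFDerivAt_rho hU hH hE hq⟩
  refine continuous_iff_continuousAt.2 fun y => ?_
  rcases lt_or_ge ‖y‖ 2 with h | h
  · have hn : B 2 ∈ 𝓝 y := closedBall_mem_nhds_of_mem (by simpa using h)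
    have h1 : ContinuousOn (dRho Hc Hu U0 q) (B 2) :=
      (continuousOn_dRho_uncurry hU hH).comp (f := fun y => (q, y)) (by fun_prop)
        fun y hy => ⟨hq, hy⟩
    exact h1.continuousAt hn
  · have : ∀ᶠ w in 𝓝 y, 4 / 3 < ‖w‖ :=
      (continuous_norm.tendsto y).eventually_const_lt (by linarith)
    refine (continuousAt_const (y := (0 : E3 →L[ℝ] ℝ))).congr ?_
    filter_upwards [this] with w hw using (dRho_eq_zero hH hE hq hw.le).symm

/-- Joint continuity of the radial derivative. At the origin the direction `y / |y|` is not
continuous, but `∇U_ζ` vanishes there. -/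
theorem continuousOn_radRho_uncurry (hU : IsSteadyState φ U0) (hH : IsDensityFun H Hc Hu E0) :
    ContinuousOn (fun p : (ℝ × SpaceX) × E3 => radRho Hu U0 p.1 p.2) (params ×ˢ B 2) := by
  refine (hH.continuous_right.comp_continuousOn (continuousOn_args hU)).mul ?_
  intro p hp
  have h := continuousOn_dPot_params hU p hp
  by_cases h0 : p.2 = 0
  · rw [ContinuousWithinAt] at h ⊢
    rw [h0, dPot_zero hU p.1.2 hp.1] at h ⊢
    refine squeeze_zero_norm (a := fun p' : (ℝ × SpaceX) × E3 => ‖dPot U0 p'.1.2 p'.2‖)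
      (fun p' => ?_) ?_
    · exact (ContinuousLinearMap.le_opNorm _ _).trans
        (mul_le_of_le_one_right (norm_nonneg _) (norm_unitDir_le _))
    · simpa using h.norm
  · have hu : ContinuousAt unitDir p.2 := (hasFDerivAt_unitDir h0).continuousAt
    exact h.clm_apply (hu.comp continuousAt_snd).continuousWithinAt

theorem continuousOn_radRho (hU : IsSteadyState φ U0) (hH : IsDensityFun H Hc Hu E0)
    {q : ℝ × SpaceX} (hq : q ∈ params) : ContinuousOn (radRho Hu U0 q) (B 2) :=
  (continuousOn_radRho_uncurry hU hH).comp (f := fun y => (q, y)) (by fun_prop)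
    fun y hy => ⟨hq, hy⟩

theorem continuousOn_sigmaRho (hU : IsSteadyState φ U0) (hH : IsDensityFun H Hc Hu E0)
    {q : ℝ × SpaceX} (hq : q ∈ params) (ξ : SpaceX) : ContinuousOn (sigmaRho Hu U0 q ξ) (B 2) := by
  refine ((continuousOn_radRho hU hH hq).mul ?_).neg
  exact ξ.mem.cont.comp (continuousOn_deformInv q.2 hq)
    fun y hy => deformInv_mem q.2 (B2_subset_image q.2 hq hy)

/-- A function that is jointly continuous in a parameter and a point of a compact set depends
continuously on the parameter, uniformly on that set. -/
theorem eventually_uniform_B2 {F : Type*} [NormedAddCommGroup F] {f : ℝ × SpaceX → E3 → F}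
    (hf : ContinuousOn (fun p : (ℝ × SpaceX) × E3 => f p.1 p.2) (params ×ˢ B 2)) {q₀ : ℝ × SpaceX}
    (hq₀ : q₀ ∈ params) {ε : ℝ} (hε : 0 < ε) :
    ∀ᶠ q in 𝓝 q₀, ∀ y ∈ B 2, ‖f q y - f q₀ y‖ ≤ ε := by
  obtain ⟨v, hv, h⟩ := (isCompact_closedBall (0 : E3) 2).mem_uniformity_of_prod hf hq₀
    (dist_mem_uniformity hε)
  rw [isOpen_params.nhdsWithin_eq hq₀] at hv
  filter_upwards [hv] with q hq y hy
  have := h q hq y hy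
  rw [mem_ofPred_eq, dist_eq_norm] at this
  exact this.le

theorem exists_uniform_bound_B2 {F : Type*} [NormedAddCommGroup F] {f : ℝ × SpaceX → E3 → F}
    (hf : ContinuousOn (fun p : (ℝ × SpaceX) × E3 => f p.1 p.2) (params ×ˢ B 2)) {q₀ : ℝ × SpaceX}
    (hq₀ : q₀ ∈ params) : ∃ M, 0 ≤ M ∧ ∀ᶠ q in 𝓝 q₀, ∀ y ∈ B 2, ‖f q y‖ ≤ M := by
  have hc : ContinuousOn (f q₀) (B 2) :=
    hf.comp (f := fun y => (q₀, y)) (by fun_prop) fun y hy => ⟨hq₀, hy⟩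
  obtain ⟨M, hM⟩ := (isCompact_closedBall (0 : E3) 2).exists_bound_of_continuousOn hc
  refine ⟨M + 1, by linarith [norm_nonneg (f q₀ 0), hM 0 (by simp)], ?_⟩
  filter_upwards [eventually_uniform_B2 hf hq₀ one_pos] with q hq y hy
  have h1 := norm_le_norm_add_norm_sub' (f q y) (f q₀ y)
  linarith [hq y hy, hM y hy]

/-- The derivative of the density is bounded by a multiple of `|y|` because `ξ` is. -/
theorem abs_sigmaRho_le {q : ℝ × SpaceX} (hq : q ∈ params) (ξ : SpaceX) {y : E3} (hy : y ∈ B 2) :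
    |sigmaRho Hu U0 q ξ y| ≤ |radRho Hu U0 q y| * (2 * ‖ξ‖ * ‖y‖) := by
  rw [sigmaRho, abs_neg, abs_mul]
  gcongr
  refine (ξ.abs_le _).trans ?_
  have := norm_deformInv_le_two_mul q.2 hq hy
  nlinarith [norm_nonneg ξ]

theorem abs_sigmaRho_sub_le {q q' : ℝ × SpaceX} (hq : q ∈ params) (hq' : q' ∈ params) (ξ : SpaceX)
    {y : E3} (hy : y ∈ B 2) :
    |sigmaRho Hu U0 q ξ y - sigmaRho Hu U0 q' ξ y|
      ≤ (|radRho Hu U0 q y - radRho Hu U0 q' y| + 3 * |radRho Hu U0 q' y| * ‖q.2 - q'.2‖)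
        * (2 * ‖ξ‖ * ‖y‖) := by
  have hi := B2_subset_image q.2 hq hy
  have hi' := B2_subset_image q'.2 hq' hy
  have e : sigmaRho Hu U0 q ξ y - sigmaRho Hu U0 q' ξ y
      = -((radRho Hu U0 q y - radRho Hu U0 q' y) * ξ (deformInv q.2 y)
        + radRho Hu U0 q' y * (ξ (deformInv q.2 y) - ξ (deformInv q'.2 y))) := by
    rw [sigmaRho, sigmaRho]; ring
  rw [e, abs_neg]
  have h2 := norm_deformInv_le_two_mul q.2 hq hy
  have h1 : |ξ (deformInv q.2 y)| ≤ 2 * ‖ξ‖ * ‖y‖ :=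
    (ξ.abs_le _).trans (by nlinarith [norm_nonneg ξ])
  have h3 : |ξ (deformInv q.2 y) - ξ (deformInv q'.2 y)| ≤ 3 * ‖q.2 - q'.2‖ * (2 * ‖ξ‖ * ‖y‖) := by
    refine (ξ.lipschitz (deformInv_mem _ hi) (deformInv_mem _ hi')).trans ?_
    have h4 := deformInv_sub_le q.2 q'.2 hq' hi hi'
    rw [sub_self, norm_zero, add_zero] at h4
    calc ‖ξ‖ * ‖deformInv q.2 y - deformInv q'.2 y‖
        ≤ ‖ξ‖ * (3 * (‖q.2 - q'.2‖ * (2 * ‖y‖))) := by gcongr; exact h4.trans (by gcongr)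
      _ = _ := by ring
  refine (abs_add_le _ _).trans ?_
  rw [abs_mul, abs_mul, add_mul]
  have h5 : |radRho Hu U0 q' y| * |ξ (deformInv q.2 y) - ξ (deformInv q'.2 y)|
      ≤ |radRho Hu U0 q' y| * (3 * ‖q.2 - q'.2‖ * (2 * ‖ξ‖ * ‖y‖)) := by gcongr
  have h6 : |radRho Hu U0 q y - radRho Hu U0 q' y| * |ξ (deformInv q.2 y)|
      ≤ |radRho Hu U0 q y - radRho Hu U0 q' y| * (2 * ‖ξ‖ * ‖y‖) := by gcongr
  linarith

/-- The derivative of the density along the line `ζ + s ξ`. -/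
theorem hasDerivAt_rho_line (hU : IsSteadyState φ U0) (hH : IsDensityFun H Hc Hu E0)
    (γ : ℝ) (ζ ξ : SpaceX) (hζ : ‖ζ‖ < 1 / 3) {y : E3} (hy : y ∈ B 2) :
    HasDerivAt (fun s : ℝ => rho H U0 (γ, ζ + s • ξ) y) (sigmaRho Hu U0 (γ, ζ) ξ y) 0 := by
  have h1 := hasDerivAt_defPot_line hU ζ ξ hζ hy
  have h2 : HasDerivAt (fun s : ℝ => (γ * cylRadius y, defPot U0 (ζ + s • ξ) y))
      (0, -(dPot U0 ζ y (unitDir y) * ξ (deformInv ζ y))) 0 :=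
    (hasDerivAt_const _ _).prodMk h1
  have h3 : HasFDerivAt (fun p : ℝ × ℝ => H p.1 p.2) _
      (γ * cylRadius y, defPot U0 (ζ + (0 : ℝ) • ξ) y) := hH.hasFDerivAt _
  have h4 := h3.comp_hasDerivAt (0 : ℝ) h2
  refine (h4.congr_deriv ?_).congr_of_eventuallyEq ?_
  · simp [sigmaRho, radRho]
    ring
  · exact Eventually.of_forall fun s => by
      show (B 2).indicator _ y = _
      rw [indicator_of_mem hy]
      rfl

theorem rho_symm (hU : IsSteadyState φ U0) {q : ℝ × SpaceX} (hq : q ∈ params) {A : E3 → E3}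
    (hA : A ∈ symS) {y : E3} (hy : y ∈ B 2) : rho H U0 q (A y) = rho H U0 q y := by
  rw [rho, indicator_of_mem hy, indicator_of_mem (symS_mem_B hA hy), cylRadius_symS hA,
    defPot_symm hU q.2 hq hA (B2_subset_image q.2 hq hy)]

theorem sigmaRho_symm (hU : IsSteadyState φ U0) {q : ℝ × SpaceX} (hq : q ∈ params) (ξ : SpaceX)
    {A : E3 → E3} (hA : A ∈ symS) {y : E3} (hy : y ∈ B 2) :
    sigmaRho Hu U0 q ξ (A y) = sigmaRho Hu U0 q ξ y := by
  have hi := B2_subset_image q.2 hq hy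
  rw [sigmaRho, sigmaRho, radRho, radRho, cylRadius_symS hA, defPot_symm hU q.2 hq hA hi,
    dPot_unitDir_symm hU q.2 hq hA hy, deformInv_symm q.2 hq hA hi,
    ξ.mem.symm A hA _ (deformInv_mem _ hi)]

end Rho

/-! ### Uniform limits along rays -/

section Ray

variable {V W Z : Type*} [NormedAddCommGroup V] [NormedAddCommGroup W] [NormedAddCommGroup Z]

/-- `F` is bounded on the punctured ball, and `F (t x)` converges as `t ↘ 0`, uniformly for `x` in
the unit sphere. -/
def HasRayLim (F : E3 → V) : Prop :=
  (∃ C, ∀ x ∈ dotB 3, ‖F x‖ ≤ C) ∧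
    ∃ f : E3 → V, TendstoUniformlyOn (fun (t : ℝ) x => F (t • x)) f (𝓝[>] 0) (sphere 0 1)

theorem HasRayLim.congr {F G : E3 → V} (hF : HasRayLim F) (h : ∀ x ∈ dotB 3, F x = G x) :
    HasRayLim G := by
  obtain ⟨⟨C, hC⟩, f, hf⟩ := hF
  refine ⟨⟨C, fun x hx => h x hx ▸ hC x hx⟩, f, hf.congr ?_⟩
  filter_upwards [eventually_small] with t ht x hx using h _ (smul_mem_dotB hx ht.1 ht.2)

theorem HasRayLim.add {F G : E3 → V} (hF : HasRayLim F) (hG : HasRayLim G) :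
    HasRayLim fun x => F x + G x := by
  obtain ⟨⟨C, hC⟩, f, hf⟩ := hF
  obtain ⟨⟨D, hD⟩, g, hg⟩ := hG
  exact ⟨⟨C + D, fun x hx => (norm_add_le _ _).trans (add_le_add (hC x hx) (hD x hx))⟩, _,
    hf.add hg⟩

theorem norm_rayLim_le {F f : E3 → V} {C : ℝ} (hC : ∀ x ∈ dotB 3, ‖F x‖ ≤ C)
    (hf : TendstoUniformlyOn (fun (t : ℝ) x => F (t • x)) f (𝓝[>] 0) (sphere 0 1)) {x : E3}
    (hx : x ∈ sphere (0 : E3) 1) : ‖f x‖ ≤ C := by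
  refine le_of_tendsto (hf.tendsto_at hx).norm ?_
  filter_upwards [eventually_small] with t ht using hC _ (smul_mem_dotB hx ht.1 ht.2)

/-- Products of functions with limits along rays, for products that are additive in both factors
and bounded by the product of the norms. -/
theorem HasRayLim.bilin {F : E3 → V} {G : E3 → W} (hF : HasRayLim F) (hG : HasRayLim G)
    (b : V → W → Z) (hl : ∀ v v' w, b (v - v') w = b v w - b v' w)
    (hr : ∀ v w w', b v (w - w') = b v w - b v w') (hb : ∀ v w, ‖b v w‖ ≤ ‖v‖ * ‖w‖) :
    HasRayLim fun x => b (F x) (G x) := by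
  obtain ⟨⟨C, hC⟩, f, hf⟩ := hF
  obtain ⟨⟨D, hD⟩, g, hg⟩ := hG
  obtain ⟨x₀⟩ := (inferInstance : Nonempty (dotB 3))
  have hC0 : 0 ≤ C := (norm_nonneg _).trans (hC x₀ x₀.2)
  have hD0 : 0 ≤ D := (norm_nonneg _).trans (hD x₀ x₀.2)
  refine ⟨⟨C * D, fun x hx => (hb _ _).trans
    (mul_le_mul (hC x hx) (hD x hx) (norm_nonneg _) hC0)⟩, fun x => b (f x) (g x), ?_⟩
  have hf' := Metric.tendstoUniformlyOn_iff.1 hf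
  have hg' := Metric.tendstoUniformlyOn_iff.1 hg
  rw [Metric.tendstoUniformlyOn_iff]
  intro ε hε
  filter_upwards [eventually_small, hf' (ε / (2 * (D + 1))) (by positivity),
    hg' (ε / (2 * (C + 1))) (by positivity)] with t ht h1 h2 x hx
  have h1 := h1 x hx
  have h2 := h2 x hx
  rw [dist_eq_norm] at h1 h2 ⊢
  have e : b (f x) (g x) - b (F (t • x)) (G (t • x))
      = b (f x) (g x - G (t • x)) + b (f x - F (t • x)) (G (t • x)) := by
    rw [hl, hr]; abel
  rw [e]
  calc _ ≤ ‖f x‖ * ‖g x - G (t • x)‖ + ‖f x - F (t • x)‖ * ‖G (t • x)‖ :=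
        (norm_add_le _ _).trans (add_le_add (hb _ _) (hb _ _))
    _ ≤ C * (ε / (2 * (C + 1))) + ε / (2 * (D + 1)) * D := by
        gcongr
        · exact norm_rayLim_le hC hf hx
        · exact hD _ (smul_mem_dotB hx ht.1 ht.2)
    _ < ε := by
        have a1 : C * (ε / (2 * (C + 1))) < ε / 2 := by
          rw [mul_div_assoc', div_lt_div_iff₀ (by positivity) (by positivity)]; nlinarith
        have a2 : ε / (2 * (D + 1)) * D < ε / 2 := by
          rw [div_mul_eq_mul_div, div_lt_div_iff₀ (by positivity) (by positivity)]; nlinarith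
        linarith

/-- A bounded function that is homogeneous of degree zero is constant along rays. -/
theorem HasRayLim.of_homogeneous {F : E3 → V} {C : ℝ} (hC : ∀ x ∈ dotB 3, ‖F x‖ ≤ C)
    (h : ∀ t : ℝ, 0 < t → ∀ x, F (t • x) = F x) : HasRayLim F := by
  refine ⟨⟨C, hC⟩, F, ?_⟩
  rw [Metric.tendstoUniformlyOn_iff]
  intro ε hε
  filter_upwards [eventually_small] with t ht x _
  rwa [h t ht.1, dist_self]

theorem HasRayLim.of_tendsto {F : E3 → V} {C : ℝ} (hC : ∀ x ∈ dotB 3, ‖F x‖ ≤ C) {v : V}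
    (h : Tendsto F (𝓝[dotB 3] 0) (𝓝 v)) : HasRayLim F := by
  refine ⟨⟨C, hC⟩, fun _ => v, ?_⟩
  rw [Metric.tendstoUniformlyOn_iff]
  intro ε hε
  obtain ⟨δ, hδ, hF⟩ := Metric.mem_nhdsWithin_iff.1 (h (ball_mem_nhds v hε))
  filter_upwards [eventually_small, Ioo_mem_nhdsGT hδ] with t ht ht' x hx
  have hx1 : ‖x‖ = 1 := by simpa using hx
  rw [dist_comm]
  refine hF ⟨?_, smul_mem_dotB hx ht.1 ht.2⟩
  rw [mem_ball_zero_iff, norm_smul, hx1, mul_one, Real.norm_of_nonneg ht.1.le]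
  exact ht'.2

end Ray

theorem hasRayLim_grad (ξ : SpaceX) : HasRayLim (grad ξ.1) :=
  ⟨⟨‖ξ‖, fun _ hx => ξ.norm_grad_le hx⟩, ξ.mem.lim⟩

theorem hasRayLim_unitDir : HasRayLim unitDir :=
  HasRayLim.of_homogeneous (fun x _ => norm_unitDir_le x) fun _ ht x => unitDir_smul ht x

/-- `ξ (t x) / t` is the mean of `∇ξ (s x) · x` over `0 < s < t`. -/
theorem hasRayLim_div (ξ : SpaceX) : HasRayLim fun x => ‖x‖⁻¹ * ξ x := by
  obtain ⟨G, hG⟩ := ξ.mem.lim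
  refine ⟨⟨‖ξ‖, fun x hx => ?_⟩, fun x => G x x, ?_⟩
  · have hn : 0 < ‖x‖ := norm_pos_iff.2 hx.2
    rw [norm_mul, norm_inv, norm_norm, inv_mul_le_iff₀ hn, mul_comm]
    exact ξ.abs_le x
  have hG' := Metric.tendstoUniformlyOn_iff.1 hG
  rw [Metric.tendstoUniformlyOn_iff]
  intro ε hε
  obtain ⟨δ, hδ, hδG⟩ := mem_nhdsGT_iff_exists_Ioo_subset.1 (hG' ε hε)
  filter_upwards [eventually_small, Ioo_mem_nhdsGT hδ] with t ht ht' x hx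
  have hx1 : ‖x‖ = 1 := by simpa using hx
  have hmem : ∀ s ∈ Ioo (0 : ℝ) t, s • x ∈ dotB 3 := fun s hs =>
    smul_mem_dotB hx hs.1 (hs.2.trans ht.2)
  have hcont : ContinuousOn (fun s : ℝ => ξ (s • x)) (Icc 0 t) := by
    refine ξ.mem.cont.comp (f := fun s : ℝ => s • x) (by fun_prop) fun s hs => ?_
    rw [mem_B, norm_smul, hx1, mul_one, Real.norm_of_nonneg hs.1]
    linarith [hs.2, ht.2]
  have hder : ∀ s ∈ Ioo (0 : ℝ) t, HasDerivAt (fun s : ℝ => ξ (s • x)) (grad ξ.1 (s • x) x) s := by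
    intro s hs
    have hlt : ‖s • x‖ < 3 := by
      rw [norm_smul, hx1, mul_one, Real.norm_of_nonneg hs.1.le]
      linarith [hs.2, ht.2]
    have h1 := (ξ.hasFDerivWithinAt (hmem s hs)).hasFDerivAt
      (closedBall_mem_nhds_of_mem (by simpa using hlt))
    have h2 : HasDerivAt (fun s : ℝ => s • x) ((1 : ℝ) • x) s := (hasDerivAt_id s).smul_const x
    rw [one_smul] at h2
    exact h1.comp_hasDerivAt s h2
  obtain ⟨s, hs, hs'⟩ := exists_hasDerivAt_eq_slope _ _ ht.1 hcont hder
  have e : ‖t • x‖⁻¹ * ξ (t • x) = grad ξ.1 (s • x) x := by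
    rw [hs', norm_smul, hx1, mul_one, Real.norm_of_nonneg ht.1.le, zero_smul, sub_zero]
    have : ξ.1 0 = 0 := ξ.mem.map_zero
    rw [this, sub_zero, div_eq_inv_mul]
  rw [e, dist_eq_norm, ← _root_.sub_apply]
  refine (ContinuousLinearMap.le_opNorm _ _).trans_lt ?_
  rw [hx1, mul_one, ← dist_eq_norm]
  exact hδG ⟨hs.1, hs.2.trans ht'.2⟩ x hx

theorem hasRayLim_eta (ξ : SpaceX) : HasRayLim fun x => ‖x‖⁻¹ • eta ξ x :=
  ((hasRayLim_div ξ).bilin hasRayLim_unitDir (fun a v => a • v) (fun _ _ _ => sub_smul _ _ _)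
    (fun _ _ _ => smul_sub _ _ _) (fun _ _ => norm_smul_le _ _)).congr fun x _ => by
      rw [eta, smul_smul]

theorem hasRayLim_dEta (ξ : SpaceX) : HasRayLim (dEta ξ) := by
  have h1 : HasRayLim fun x => (grad ξ.1 x).smulRight (unitDir x) :=
    (hasRayLim_grad ξ).bilin hasRayLim_unitDir (fun l v => l.smulRight v)
      (fun l l' v => by ext1 w; simp [sub_smul]) (fun l v v' => by ext1 w; simp [smul_sub])
      (fun l v => (ContinuousLinearMap.norm_smulRight_apply _ _).le)
  have h2 : HasRayLim fun x => ‖x‖ • dUnit x := by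
    refine HasRayLim.of_homogeneous (C := 1) (fun x hx => ?_) fun t ht x => ?_
    · rw [norm_smul, norm_norm]
      have hn : 0 < ‖x‖ := norm_pos_iff.2 hx.2
      exact (mul_le_mul_of_nonneg_left (norm_dUnit_le x) hn.le).trans (mul_inv_cancel₀ hn.ne').le
    · rw [dUnit, dUnit, unitDir_smul ht, norm_smul, smul_smul, smul_smul, Real.norm_of_nonneg ht.le]
      congr 1
      rcases eq_or_ne ‖x‖ 0 with h | h
      · simp [h]
      · field_simp
  refine (h1.add ((hasRayLim_div ξ).bilin h2 (fun a v => a • v)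
    (fun _ _ _ => by ext1 w; simp [sub_smul]) (fun _ _ _ => by ext1 w; simp [smul_sub])
    (fun a v => (norm_smul a v).le))).congr fun x hx => ?_
  have hn : ‖x‖ ≠ 0 := norm_ne_zero_iff.2 hx.2
  rw [dEta, smul_smul]
  congr 2
  field_simp

theorem hasRayLim_deform (ζ : SpaceX) : HasRayLim fun x => ‖x‖⁻¹ • deform ζ x :=
  (hasRayLim_unitDir.add (hasRayLim_eta ζ)).congr fun x _ => by
    rw [deform_eq, smul_add, unitDir]

theorem hasRayLim_dDef (ζ : SpaceX) : HasRayLim (dDef ζ) := by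
  have h : HasRayLim fun _ : E3 => ContinuousLinearMap.id ℝ E3 :=
    HasRayLim.of_homogeneous (C := 1) (fun _ _ => ContinuousLinearMap.norm_id_le) fun _ _ _ => rfl
  exact h.add (hasRayLim_dEta ζ)

/-- Near the origin the linear bound comes from differentiability, elsewhere from compactness. -/
theorem exists_linear_bound {G : E3 → E3} (hG : Continuous G) (h0 : G 0 = 0)
    (hd : DifferentiableAt ℝ G 0) (R : ℝ) : ∃ C, 0 ≤ C ∧ ∀ z, ‖z‖ ≤ R → ‖G z‖ ≤ C * ‖z‖ := by
  have h1 := hd.hasFDerivAt.isBigO_sub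
  simp only [h0, sub_zero] at h1
  obtain ⟨c, hc⟩ := h1.bound
  obtain ⟨δ, hδ, hc⟩ := Metric.eventually_nhds_iff.1 hc
  obtain ⟨M, hM⟩ := (isCompact_closedBall (0 : E3) R).exists_bound_of_continuousOn hG.continuousOn
  refine ⟨|c| + |M| / δ, by positivity, fun z hz => ?_⟩
  rw [add_mul]
  rcases lt_or_ge ‖z‖ δ with h | h
  · have := hc (y := z) (by simpa using h)
    have h2 : c * ‖z‖ ≤ |c| * ‖z‖ := by gcongr; exact le_abs_self c
    have : 0 ≤ |M| / δ * ‖z‖ := by positivity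
    linarith
  · have h2 := (hM z (by simpa using hz)).trans (le_abs_self M)
    have h3 : |M| ≤ |M| / δ * ‖z‖ := by
      rw [div_mul_eq_mul_div, le_div_iff₀ hδ]; gcongr
    have : 0 ≤ |c| * ‖z‖ := by positivity
    linarith

theorem norm_deform_le_two_mul (ζ : SpaceX) (hζ : ‖ζ‖ < 1 / 3) (x : E3) : ‖deform ζ x‖ ≤ 2 * ‖x‖ :=
  (norm_deform_le ζ x).trans (by nlinarith [norm_nonneg x])

/-- `G` is replaced by its derivative at the origin, up to an error `o(|x|)`. -/
theorem hasRayLim_comp_div {G : E3 → E3} (hG : Continuous G) (h0 : G 0 = 0)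
    (hd : DifferentiableAt ℝ G 0) (ζ : SpaceX) (hζ : ‖ζ‖ < 1 / 3) :
    HasRayLim fun x => ‖x‖⁻¹ • G (deform ζ x) := by
  obtain ⟨C, hC0, hC⟩ := exists_linear_bound hG h0 hd 6
  set A := fderiv ℝ G 0 with hA
  have hn : ∀ x ∈ dotB 3, 0 < ‖x‖ := fun x hx => norm_pos_iff.2 hx.2
  have h6 : ∀ x ∈ dotB 3, ‖deform ζ x‖ ≤ 6 := fun x hx =>
    (norm_deform_le_two_mul ζ hζ x).trans (by linarith [mem_B.1 hx.1])
  have h1 : HasRayLim fun x => A (‖x‖⁻¹ • deform ζ x) := by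
    refine (HasRayLim.of_homogeneous (F := fun _ : E3 => A) (C := ‖A‖) (fun _ _ => le_rfl)
      fun _ _ _ => rfl).bilin (hasRayLim_deform ζ) (fun (A : E3 →L[ℝ] E3) v => A v)
        (fun _ _ _ => rfl)
      (fun _ _ _ => map_sub _ _ _) (fun A v => A.le_opNorm v)
  have h2 : HasRayLim fun x => ‖x‖⁻¹ • (G (deform ζ x) - A (deform ζ x)) := by
    refine HasRayLim.of_tendsto (C := (C + ‖A‖) * 2) (v := 0) (fun x hx => ?_) ?_
    · rw [norm_smul, norm_inv, norm_norm, inv_mul_le_iff₀ (hn x hx)]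
      have a1 := hC _ (h6 x hx)
      have a2 := A.le_opNorm (deform ζ x)
      have a3 := norm_deform_le_two_mul ζ hζ x
      calc _ ≤ ‖G (deform ζ x)‖ + ‖A (deform ζ x)‖ := norm_sub_le _ _
        _ ≤ (C + ‖A‖) * ‖deform ζ x‖ := by linarith
        _ ≤ (C + ‖A‖) * (2 * ‖x‖) := by gcongr
        _ = _ := by ring
    · have ho := hd.hasFDerivAt.isLittleO
      simp only [h0, sub_zero] at ho
      have hg : Tendsto (deform ζ) (𝓝[dotB 3] 0) (𝓝 0) := by
        have := (continuousOn_deform ζ 0 zero_mem_B3).tendsto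
        rw [deform_zero] at this
        exact this.mono_left (nhdsWithin_mono _ sdiff_subset)
      have hO : (deform ζ) =O[𝓝[dotB 3] 0] fun x => x :=
        Asymptotics.IsBigO.of_bound 2 (Eventually.of_forall fun x => norm_deform_le_two_mul ζ hζ x)
      have h := ((ho.comp_tendsto hg).trans_isBigO hO).norm_right
      have h' := h.tendsto_inv_smul_nhds_zero
      exact h'
  refine (h1.add h2).congr fun x _ => ?_
  rw [map_smul, ← smul_add]
  congr 1
  abel

/-! ### Constructing elements of the space `Y` -/

/-- A function whose gradient is `O(|x|)` on the punctured ball is differentiable at the origin. -/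
theorem hasFDerivWithinAt_zero_of_bound {f : E3 → ℝ} {F : E3 → E3 →L[ℝ] ℝ} {C : ℝ}
    (hf : ContinuousOn f (B 3)) (hF : ∀ x ∈ dotB 3, HasFDerivWithinAt f (F x) (B 3) x)
    (hC : ∀ x ∈ dotB 3, ‖F x‖ ≤ C * ‖x‖) (hC0 : 0 ≤ C) :
    HasFDerivWithinAt f (0 : E3 →L[ℝ] ℝ) (B 3) 0 := by
  rw [hasFDerivWithinAt_iff_isLittleO, Asymptotics.isLittleO_iff]
  intro ε hε
  have hsmall : ∀ᶠ x in 𝓝 (0 : E3), C * ‖x‖ < ε := by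
    have : Continuous fun x : E3 => C * ‖x‖ := by fun_prop
    refine (this.tendsto 0).eventually_lt_const ?_
    simpa using hε
  filter_upwards [self_mem_nhdsWithin, nhdsWithin_le_nhds hsmall] with x hx hxs
  have hxn := mem_B.1 hx
  have hsub : B ‖x‖ ⊆ B 3 := closedBall_subset_closedBall hxn
  have h := lipschitz_of_punctured_deriv (convex_B ‖x‖) (f := f) (f' := F) (C := C * ‖x‖)
    (mem_B.2 (by simp)) (hf.mono hsub)
    (fun w hw h0 => (hF w ⟨hsub hw, h0⟩).mono hsub)
    (fun w hw h0 => (hC w ⟨hsub hw, h0⟩).trans (by gcongr; exact mem_B.1 hw))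
    (mem_B.2 le_rfl : x ∈ B ‖x‖) (mem_B.2 (by simp) : (0 : E3) ∈ B ‖x‖)
  simp only [_root_.zero_apply, sub_zero] at h ⊢
  exact h.trans (by gcongr)

theorem grad_eq {f : E3 → ℝ} {F : E3 →L[ℝ] ℝ} {x : E3} (hx : x ∈ B 3)
    (h : HasFDerivWithinAt f F (B 3) x) : grad f x = F := h.fderivWithin (uniqueDiff_B3 hx)

/-- A symmetric function whose gradient `F` is continuous on the punctured ball, and for which
`F(x) / |x|` has limits along rays, belongs to `Y`; the origin takes care of itself. -/
theorem MemY.of_hasFDerivWithinAt {f : E3 → ℝ} {F : E3 → E3 →L[ℝ] ℝ} (hoff : ∀ x, x ∉ B 3 → f x = 0)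
    (hsymm : ∀ A ∈ symS, ∀ x ∈ B 3, f (A x) = f x) (h0 : f 0 = 0) (hcont : ContinuousOn f (B 3))
    (hf : ∀ x ∈ dotB 3, HasFDerivWithinAt f (F x) (B 3) x) (hFc : ContinuousOn F (dotB 3))
    (hlim : HasRayLim fun x => ‖x‖⁻¹ • F x) : MemY f := by
  obtain ⟨⟨C, hC⟩, G, hG⟩ := hlim
  have hC' : ∀ x ∈ dotB 3, ‖F x‖ ≤ |C| * ‖x‖ := fun x hx => by
    have hn : 0 < ‖x‖ := norm_pos_iff.2 hx.2
    have := hC x hx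
    rw [norm_smul, norm_inv, norm_norm, inv_mul_le_iff₀ hn] at this
    rw [mul_comm]
    exact this.trans (by gcongr; exact le_abs_self C)
  have hz := hasFDerivWithinAt_zero_of_bound hcont hf hC' (abs_nonneg C)
  have hgz : grad f 0 = 0 := grad_eq zero_mem_B3 hz
  have hg : ∀ x ∈ dotB 3, grad f x = F x := fun x hx => grad_eq hx.1 (hf x hx)
  have hdiff : ∀ x ∈ B 3, HasFDerivWithinAt f (grad f x) (B 3) x := by
    intro x hx
    rcases eq_or_ne x 0 with rfl | hx0
    · rw [hgz]; exact hz
    · rw [hg x ⟨hx, hx0⟩]; exact hf x ⟨hx, hx0⟩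
  have hbdd : ∀ x ∈ B 3, ‖grad f x‖ ≤ |C| * ‖x‖ := by
    intro x hx
    rcases eq_or_ne x 0 with rfl | hx0
    · rw [hgz]; simp
    · rw [hg x ⟨hx, hx0⟩]; exact hC' x ⟨hx, hx0⟩
  have hgc : ContinuousOn (grad f) (B 3) := by
    intro x hx
    rcases eq_or_ne x 0 with rfl | hx0
    · rw [ContinuousWithinAt, hgz]
      have h1 : Tendsto (fun x : E3 => |C| * ‖x‖) (𝓝[B 3] 0) (𝓝 0) := by
        have : Continuous fun x : E3 => |C| * ‖x‖ := by fun_prop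
        have h := this.tendsto 0
        rw [norm_zero, mul_zero] at h
        exact h.mono_left nhdsWithin_le_nhds
      refine squeeze_zero_norm' ?_ h1
      filter_upwards [self_mem_nhdsWithin] with w hw using hbdd w hw
    · have h1 : ContinuousWithinAt (grad f) (dotB 3) x :=
        (hFc x ⟨hx, hx0⟩).congr hg (hg x ⟨hx, hx0⟩)
      exact h1.mono_of_mem_nhdsWithin (dotB_mem_nhdsWithin ⟨hx, hx0⟩)
  refine ⟨hoff, hcont, hsymm, h0, ?_, ⟨|C| + 1, by positivity, fun x hx => (hbdd x hx).trans
    (by gcongr; linarith)⟩, G, hG.congr ?_⟩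
  · rw [show (1 : WithTop ℕ∞) = 0 + 1 from rfl,
      contDiffOn_succ_iff_hasFDerivWithinAt_of_uniqueDiffOn fun x hx => uniqueDiff_B3 hx]
    exact ⟨by simp, grad f, contDiffOn_zero.2 hgc, hdiff⟩
  · filter_upwards [eventually_small] with t ht x hx
    have hx1 : ‖x‖ = 1 := by simpa using hx
    show ‖t • x‖⁻¹ • F (t • x) = t⁻¹ • grad f (t • x)
    rw [hg _ (smul_mem_dotB hx ht.1 ht.2), norm_smul, hx1, mul_one, Real.norm_of_nonneg ht.1.le]

/-! ### Norms in the space `Y` -/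

theorem SpaceY.norm_le (f : SpaceY) {M : ℝ} (h : ∀ x ∈ dotB 3, ‖grad f.1 x‖ ≤ M * ‖x‖) :
    ‖f‖ ≤ M :=
  ciSup_le fun x => (div_le_iff₀ (norm_pos_iff.2 x.2.2)).2 (h x x.2)

theorem SpaceY.norm_grad_le (f : SpaceY) {x : E3} (hx : x ∈ dotB 3) :
    ‖grad f.1 x‖ ≤ ‖f‖ * ‖x‖ :=
  (div_le_iff₀ (norm_pos_iff.2 hx.2)).1 (le_ciSup (bddAboveY f) ⟨x, hx⟩)

theorem SpaceY.hasFDerivWithinAt (f : SpaceY) {x : E3} (hx : x ∈ B 3) :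
    HasFDerivWithinAt f.1 (grad f.1 x) (B 3) x :=
  (f.mem.smooth.differentiableOn one_ne_zero x hx).hasFDerivWithinAt

/-- The norm of `Y` gives Lipschitz bounds on `B R` with a factor `R`. -/
theorem SpaceY.lipschitz (f : SpaceY) {R : ℝ} (hR0 : 0 ≤ R) (hR : R ≤ 3) {x x' : E3} (hx : x ∈ B R)
    (hx' : x' ∈ B R) : |f x - f x'| ≤ ‖f‖ * R * ‖x - x'‖ := by
  have hsub : B R ⊆ B 3 := closedBall_subset_closedBall hR
  exact lipschitz_of_punctured_deriv (convex_B R) (mem_B.2 (by simpa using hR0))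
    (f.mem.cont.mono hsub) (fun w hw _ => (f.hasFDerivWithinAt (hsub hw)).mono hsub)
    (fun w hw h0 => (f.norm_grad_le ⟨hsub hw, h0⟩).trans (by gcongr; exact mem_B.1 hw)) hx hx'

/-- Conversely, Lipschitz bounds on `B R` with a factor `R` control the norm of `Y`. In this way
estimates of the norm reduce to estimates of the values of the function at two points. -/
theorem SpaceY.norm_le_of_lipschitz (f : SpaceY) {M : ℝ} (hM : 0 ≤ M)
    (h : ∀ R, 0 ≤ R → R ≤ 3 → ∀ x ∈ B R, ∀ x' ∈ B R, |f x - f x'| ≤ M * R * ‖x - x'‖) :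
    ‖f‖ ≤ M := by
  -- in the interior, the bounds on `B R` are used with `R ↘ ‖x‖`
  have hint : ∀ x : E3, ‖x‖ < 3 → ‖grad f.1 x‖ ≤ M * ‖x‖ := by
    intro x hx
    have hB : x ∈ B 3 := mem_B.2 hx.le
    have hd := (f.hasFDerivWithinAt hB).hasFDerivAt
      (closedBall_mem_nhds_of_mem (by simpa using hx))
    have hR : ∀ R, ‖x‖ < R → R ≤ 3 → ‖grad f.1 x‖ ≤ M * R := by
      intro R hxR hR
      have hR0 : 0 ≤ R := (norm_nonneg x).trans hxR.le
      have hn : B R ∈ 𝓝 x := closedBall_mem_nhds_of_mem (by simpa using hxR)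
      refine hd.le_of_lip' (by positivity) ?_
      filter_upwards [hn] with w hw
      exact h R hR0 hR w hw x (mem_B.2 hxR.le)
    have ht : Tendsto (fun R : ℝ => M * R) (𝓝[>] ‖x‖) (𝓝 (M * ‖x‖)) :=
      ((by fun_prop : Continuous fun R : ℝ => M * R).tendsto _).mono_left nhdsWithin_le_nhds
    refine ge_of_tendsto ht ?_
    filter_upwards [Ioo_mem_nhdsGT hx] with R hR' using hR R hR'.1 hR'.2.le
  refine f.norm_le fun x hx => ?_
  have hxn := mem_B.1 hx.1
  have hgc : ContinuousOn (grad f.1) (B 3) :=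
    f.mem.smooth.continuousOn_fderivWithin (fun x hx => uniqueDiff_B3 hx) le_rfl
  -- pass to the boundary of the ball along a ray
  have ht : Tendsto (fun t : ℝ => t • x) (𝓝[<] 1) (𝓝[B 3] x) := by
    refine tendsto_nhdsWithin_iff.2 ⟨?_, ?_⟩
    · have := (by fun_prop : Continuous fun t : ℝ => t • x).tendsto 1
      rw [one_smul] at this
      exact this.mono_left nhdsWithin_le_nhds
    · filter_upwards [Ioo_mem_nhdsLT (zero_lt_one (α := ℝ))] with t ht
      rw [mem_B, norm_smul, Real.norm_of_nonneg ht.1.le]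
      nlinarith [ht.1, ht.2, norm_nonneg x]
  have h1 := ((hgc x hx.1).tendsto.comp ht).norm
  have h2 : Tendsto (fun t : ℝ => M * ‖t • x‖) (𝓝[<] 1) (𝓝 (M * ‖x‖)) :=
    (ht.mono_right nhdsWithin_le_nhds).norm.const_mul M
  refine le_of_tendsto_of_tendsto h1 h2 ?_
  filter_upwards [Ioo_mem_nhdsLT (zero_lt_one (α := ℝ))] with t ht
  refine hint _ ?_
  have hn : 0 < ‖x‖ := norm_pos_iff.2 hx.2
  rw [norm_smul, Real.norm_of_nonneg ht.1.le]
  nlinarith [ht.1, ht.2]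

/-- A function with the properties defining `Y`, as an element of `Y`. -/
def MemY.toY {f : E3 → ℝ} (h : MemY f) : SpaceY := ⟨f, h⟩

theorem grad_sub_toY {f g : E3 → ℝ} (hf : MemY f) (hg : MemY g) {F G : E3 →L[ℝ] ℝ} {x : E3}
    (hx : x ∈ B 3) (hF : HasFDerivWithinAt f F (B 3) x) (hG : HasFDerivWithinAt g G (B 3) x) :
    grad (hf.toY - hg.toY).1 x = F - G := grad_eq hx (hF.sub hG)

theorem grad_toY {f : E3 → ℝ} (hf : MemY f) {F : E3 →L[ℝ] ℝ} {x : E3}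
    (hx : x ∈ B 3) (hF : HasFDerivWithinAt f F (B 3) x) : grad hf.toY.1 x = F := grad_eq hx hF

/-! ### Composition of a potential with a deformation -/

/-- The gradient of a symmetric function is equivariant. -/
theorem gradient_symm {W : E3 → ℝ} {G : E3 → E3} (hW : ∀ z, HasFDerivAt W (innerSL ℝ (G z)) z)
    (hsymm : ∀ A ∈ symS, ∀ x, W (A x) = W x) {A : E3 → E3} (hA : A ∈ symS) (z : E3) :
    G (A z) = A (G z) := by
  obtain ⟨L, hL⟩ := symS_isometry hA
  have h1 : HasFDerivAt (fun w => W (L w))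
      ((innerSL ℝ (G (L z))).comp (L.toContinuousLinearEquiv : E3 →L[ℝ] E3)) z :=
    (hW (L z)).comp z (L.toContinuousLinearEquiv : E3 →L[ℝ] E3).hasFDerivAt
  have h2 : (fun w => W (L w)) = W := funext fun w => by rw [← hL, hsymm A hA]
  rw [h2] at h1
  have h3 := h1.unique (hW z)
  rw [hL, hL]
  refine ext_inner_right ℝ fun v => ?_
  have h4 := congrArg (fun l : E3 →L[ℝ] ℝ => l (L.symm v)) h3
  simp only [ContinuousLinearMap.comp_apply, innerSL_apply_apply] at h4
  have h5 : (L.toContinuousLinearEquiv : E3 →L[ℝ] E3) (L.symm v) = v := L.apply_symm_apply v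
  rw [h5] at h4
  rw [h4, ← L.inner_map_map, L.apply_symm_apply]

theorem norm_innerSL_comp_le (v : E3) (A : E3 →L[ℝ] E3) : ‖(innerSL ℝ v).comp A‖ ≤ ‖v‖ * ‖A‖ := by
  refine (ContinuousLinearMap.opNorm_comp_le _ _).trans ?_
  rw [innerSL_apply_norm]

/-- `W ∘ g_ζ - W 0` on the ball. -/
def compY (W : E3 → ℝ) (ζ : SpaceX) : E3 → ℝ := (B 3).indicator fun x => W (deform ζ x) - W 0

/-- `G(g_ζ(x)) · x / |x| ξ(x)` on the ball. -/
def pairY (G : E3 → E3) (ζ ξ : SpaceX) : E3 → ℝ :=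
  (B 3).indicator fun x => inner ℝ (G (deform ζ x)) (eta ξ x)

theorem hasFDerivWithinAt_compY {W : E3 → ℝ} {G : E3 → E3}
    (hW : ∀ z, HasFDerivAt W (innerSL ℝ (G z)) z) (ζ : SpaceX) {x : E3} (hx : x ∈ dotB 3) :
    HasFDerivWithinAt (compY W ζ) ((innerSL ℝ (G (deform ζ x))).comp (dDef ζ x)) (B 3) x := by
  have h := ((hW (deform ζ x)).comp_hasFDerivWithinAt x (hasFDerivWithinAt_deform ζ hx)).sub_const
      (W 0)
  exact h.congr (fun w hw => indicator_of_mem hw _) (indicator_of_mem hx.1 _)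

/-- Differentiability of the gradient `G` at the origin is what makes `∇(W ∘ g_ζ)(x) / |x|` converge
along rays. -/
theorem memY_compY {W : E3 → ℝ} {G : E3 → E3} (hW : ∀ z, HasFDerivAt W (innerSL ℝ (G z)) z)
    (hsymm : ∀ A ∈ symS, ∀ x, W (A x) = W x) (hG : Continuous G) (hd : DifferentiableAt ℝ G 0)
    (ζ : SpaceX) (hζ : ‖ζ‖ < 1 / 3) : MemY (compY W ζ) := by
  have hG0 : G 0 = 0 := gradient_zero_of_symm hsymm (hW 0)
  have hGg : ContinuousOn (fun x => G (deform ζ x)) (B 3) :=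
      hG.comp_continuousOn (continuousOn_deform ζ)
  refine MemY.of_hasFDerivWithinAt (fun x hx => indicator_of_notMem hx _) ?_ ?_ ?_
    (fun x hx => hasFDerivWithinAt_compY hW ζ hx) ?_ ?_
  · intro A hA x hx
    rw [compY, indicator_of_mem hx, indicator_of_mem (symS_mem_B hA hx), deform_symm ζ hA hx,
      hsymm A hA]
  · rw [compY, indicator_of_mem zero_mem_B3, deform_zero, sub_self]
  · have hWc : Continuous W := continuous_iff_continuousAt.2 fun z => (hW z).continuousAt
    exact ((hWc.comp_continuousOn (continuousOn_deform ζ)).sub continuousOn_const).congr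
      fun x hx => indicator_of_mem hx _
  · exact ((innerSL ℝ).continuous.comp_continuousOn (hGg.mono sdiff_subset)).clm_comp
      (continuousOn_dDef ζ)
  · refine ((hasRayLim_comp_div hG hG0 hd ζ hζ).bilin (hasRayLim_dDef ζ)
      (fun v A => (innerSL ℝ v).comp A) (fun v v' A => by ext1 w; simp)
      (fun v A A' => by ext1 w; simp) norm_innerSL_comp_le).congr fun x _ => ?_
    ext1 w
    simp

theorem hasFDerivWithinAt_pairY {G : E3 → E3} (hG : ContDiff ℝ 1 G) (ζ ξ : SpaceX) {x : E3}
    (hx : x ∈ dotB 3) : HasFDerivWithinAt (pairY G ζ ξ)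
      ((innerSL ℝ (eta ξ x)).comp ((fderiv ℝ G (deform ζ x)).comp (dDef ζ x))
        + (innerSL ℝ (G (deform ζ x))).comp (dEta ξ x)) (B 3) x := by
  have h1 : HasFDerivAt G (fderiv ℝ G (deform ζ x)) (deform ζ x) :=
    (hG.differentiable one_ne_zero _).hasFDerivAt
  have h := (h1.comp_hasFDerivWithinAt x (hasFDerivWithinAt_deform ζ hx)).inner ℝ
    (hasFDerivWithinAt_eta ξ hx)
  refine (h.congr (fun w hw => indicator_of_mem hw _) (indicator_of_mem hx.1 _)).congr_fderiv ?_
  ext1 w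
  simp [fderivInnerCLM_apply, real_inner_comm, add_comm]

/-- Here `G` has to be of class `C¹`, since its derivative enters the gradient of the function. -/
theorem memY_pairY {W : E3 → ℝ} {G : E3 → E3} (hW : ∀ z, HasFDerivAt W (innerSL ℝ (G z)) z)
    (hsymm : ∀ A ∈ symS, ∀ x, W (A x) = W x) (hG : ContDiff ℝ 1 G) (ζ ξ : SpaceX)
    (hζ : ‖ζ‖ < 1 / 3) : MemY (pairY G ζ ξ) := by
  have hG0 : G 0 = 0 := gradient_zero_of_symm hsymm (hW 0)
  have hGg : ContinuousOn (fun x => G (deform ζ x)) (B 3) :=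
    hG.continuous.comp_continuousOn (continuousOn_deform ζ)
  have hDGg : ContinuousOn (fun x => fderiv ℝ G (deform ζ x)) (B 3) :=
    (hG.continuous_fderiv one_ne_zero).comp_continuousOn (continuousOn_deform ζ)
  refine MemY.of_hasFDerivWithinAt (fun x hx => indicator_of_notMem hx _) ?_ ?_ ?_
    (fun x hx => hasFDerivWithinAt_pairY hG ζ ξ hx) ?_ ?_
  · intro A hA x hx
    rw [pairY, indicator_of_mem hx, indicator_of_mem (symS_mem_B hA hx), deform_symm ζ hA hx,
      gradient_symm hW hsymm hA]
    obtain ⟨L, hL⟩ := symS_isometry hA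
    have : eta ξ (A x) = L (eta ξ x) := by
      rw [eta, eta, ξ.mem.symm A hA x hx, hL]
      simp [unitDir]
    rw [this, hL, L.inner_map_map]
  · rw [pairY, indicator_of_mem zero_mem_B3, eta_zero, inner_zero_right]
  · exact (hGg.inner (continuousOn_eta ξ)).congr fun x hx => indicator_of_mem hx _
  · refine ContinuousOn.add ?_ ?_
    · exact ((innerSL ℝ).continuous.comp_continuousOn
        ((continuousOn_eta ξ).mono sdiff_subset)).clm_comp
        ((hDGg.mono sdiff_subset).clm_comp (continuousOn_dDef ζ))
    · exact ((innerSL ℝ).continuous.comp_continuousOn (hGg.mono sdiff_subset)).clm_comp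
        (continuousOn_dEta ξ)
  -- the two terms of the gradient, each divided by `‖x‖`
  · have h1 : HasRayLim fun x => fderiv ℝ G (deform ζ x) := by
      obtain ⟨C, hC⟩ := (isCompact_closedBall (0 : E3) 3).exists_bound_of_continuousOn hDGg
      exact HasRayLim.of_tendsto (fun x hx => hC x hx.1)
        ((hDGg 0 zero_mem_B3).tendsto.mono_left (nhdsWithin_mono _ sdiff_subset))
    have h2 : HasRayLim fun x => (fderiv ℝ G (deform ζ x)).comp (dDef ζ x) :=
      h1.bilin (hasRayLim_dDef ζ) (fun A B => A.comp B) (fun A A' B => by ext1 w; simp)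
        (fun A B B' => by ext1 w; simp) (fun A B => A.opNorm_comp_le B)
    have h3 := (hasRayLim_eta ξ).bilin h2
      (fun v A => (innerSL ℝ v).comp A) (fun v v' A => by ext1 w; simp)
      (fun v A A' => by ext1 w; simp) norm_innerSL_comp_le
    have h4 := (hasRayLim_comp_div hG.continuous hG0 (hG.differentiable one_ne_zero 0) ζ hζ).bilin
      (hasRayLim_dEta ξ)
      (fun v A => (innerSL ℝ v).comp A) (fun v v' A => by ext1 w; simp)
      (fun v A A' => by ext1 w; simp) norm_innerSL_comp_le
    refine (h3.add h4).congr fun x _ => ?_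
    ext1 w
    simp

/-- The norm of `Y` in terms of the fields `G` and `G'` alone; the values of `W` and `W'` do not
enter. -/
theorem norm_compY_sub_le {W W' : E3 → ℝ} {G G' : E3 → E3}
    (hW : ∀ z, HasFDerivAt W (innerSL ℝ (G z)) z) (hW' : ∀ z, HasFDerivAt W' (innerSL ℝ (G' z)) z)
    {ζ ζ' : SpaceX} (hζ : ‖ζ‖ < 1 / 3) (h : MemY (compY W ζ))
    (h' : MemY (compY W' ζ')) {c d : ℝ}
    (hd : ∀ x ∈ dotB 3, ‖G (deform ζ x) - G' (deform ζ' x)‖ ≤ d * ‖x‖)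
    (hc : ∀ x ∈ dotB 3, ‖G' (deform ζ' x)‖ ≤ c * ‖x‖) :
    ‖h.toY - h'.toY‖ ≤ 2 * d + 2 * c * ‖ζ - ζ'‖ := by
  refine SpaceY.norm_le _ fun x hx => ?_
  rw [grad_sub_toY h h' hx.1 (hasFDerivWithinAt_compY hW ζ hx)
    (hasFDerivWithinAt_compY hW' ζ' hx)]
  have e : (innerSL ℝ (G (deform ζ x))).comp (dDef ζ x) - (innerSL ℝ (G' (deform ζ' x))).comp
      (dDef ζ' x)
      = (innerSL ℝ (G (deform ζ x) - G' (deform ζ' x))).comp (dDef ζ x)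
        + (innerSL ℝ (G' (deform ζ' x))).comp (dDef ζ x - dDef ζ' x) := by
    ext1 w
    simp
  rw [e]
  have h1 := hd x hx
  have h2 := hc x hx
  calc _ ≤ ‖G (deform ζ x) - G' (deform ζ' x)‖ * ‖dDef ζ x‖
        + ‖G' (deform ζ' x)‖ * ‖dDef ζ x - dDef ζ' x‖ :=
        (norm_add_le _ _).trans (add_le_add (norm_innerSL_comp_le _ _) (norm_innerSL_comp_le _ _))
    _ ≤ (d * ‖x‖) * 2 + (c * ‖x‖) * (2 * ‖ζ - ζ'‖) := by
        refine add_le_add (mul_le_mul h1 (norm_dDef_le ζ hζ hx) (norm_nonneg _) ?_)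
          (mul_le_mul h2 (norm_dDef_sub_le _ _ hx) (norm_nonneg _) ?_)
        · exact (norm_nonneg _).trans h1
        · exact (norm_nonneg _).trans h2
    _ = _ := by ring

theorem norm_pairY_sub_le {G G' : E3 → E3} (hG : ContDiff ℝ 1 G) (hG' : ContDiff ℝ 1 G')
    {ζ ζ' ξ : SpaceX} (hζ : ‖ζ‖ < 1 / 3) (h : MemY (pairY G ζ ξ))
    (h' : MemY (pairY G' ζ' ξ)) {c d e : ℝ}
    (hd : ∀ x ∈ dotB 3, ‖G (deform ζ x) - G' (deform ζ' x)‖ ≤ d * ‖x‖)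
    (he : ∀ x ∈ dotB 3, ‖fderiv ℝ G (deform ζ x) - fderiv ℝ G' (deform ζ' x)‖ ≤ e)
    (hc : ∀ x ∈ dotB 3, ‖fderiv ℝ G' (deform ζ' x)‖ ≤ c) :
    ‖h.toY - h'.toY‖ ≤ (2 * e + 2 * c * ‖ζ - ζ'‖ + 2 * d) * ‖ξ‖ := by
  refine SpaceY.norm_le _ fun x hx => ?_
  rw [grad_sub_toY h h' hx.1 (hasFDerivWithinAt_pairY hG ζ ξ hx)
    (hasFDerivWithinAt_pairY hG' ζ' ξ hx)]
  have e1 : (innerSL ℝ (eta ξ x)).comp ((fderiv ℝ G (deform ζ x)).comp (dDef ζ x))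
        + (innerSL ℝ (G (deform ζ x))).comp (dEta ξ x)
        - ((innerSL ℝ (eta ξ x)).comp ((fderiv ℝ G' (deform ζ' x)).comp (dDef ζ' x))
        + (innerSL ℝ (G' (deform ζ' x))).comp (dEta ξ x))
      = (innerSL ℝ (eta ξ x)).comp
          ((fderiv ℝ G (deform ζ x) - fderiv ℝ G' (deform ζ' x)).comp (dDef ζ x)
            + (fderiv ℝ G' (deform ζ' x)).comp (dDef ζ x - dDef ζ' x))
        + (innerSL ℝ (G (deform ζ x) - G' (deform ζ' x))).comp (dEta ξ x) := by
    ext1 w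
    simp
    ring
  rw [e1]
  have h1 := hd x hx
  have h2 := he x hx
  have h3 := hc x hx
  have he0 : 0 ≤ e := (norm_nonneg _).trans h2
  have hc0 : 0 ≤ c := (norm_nonneg _).trans h3
  have h4 : ‖(fderiv ℝ G (deform ζ x) - fderiv ℝ G' (deform ζ' x)).comp (dDef ζ x)
            + (fderiv ℝ G' (deform ζ' x)).comp (dDef ζ x - dDef ζ' x)‖
      ≤ e * 2 + c * (2 * ‖ζ - ζ'‖) := by
    refine (norm_add_le _ _).trans (add_le_add ?_ ?_)
    · exact (ContinuousLinearMap.opNorm_comp_le _ _).trans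
        (mul_le_mul h2 (norm_dDef_le ζ hζ hx) (norm_nonneg _) he0)
    · exact (ContinuousLinearMap.opNorm_comp_le _ _).trans
        (mul_le_mul h3 (norm_dDef_sub_le _ _ hx) (norm_nonneg _) hc0)
  calc _ ≤ (‖ξ‖ * ‖x‖) * (e * 2 + c * (2 * ‖ζ - ζ'‖)) + (d * ‖x‖) * (2 * ‖ξ‖) := by
        refine (norm_add_le _ _).trans (add_le_add ?_ ?_)
        · exact (norm_innerSL_comp_le _ _).trans
            (mul_le_mul (norm_eta_le ξ x) h4 (norm_nonneg _) (by positivity))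
        · exact (norm_innerSL_comp_le _ _).trans
            (mul_le_mul h1 (norm_dEta_le ξ hx) (norm_nonneg _) ((norm_nonneg _).trans h1))
    _ = _ := by ring

theorem norm_compY_le {W : E3 → ℝ} {G : E3 → E3}
    (hW : ∀ z, HasFDerivAt W (innerSL ℝ (G z)) z) {ζ : SpaceX} (hζ : ‖ζ‖ < 1 / 3)
    (h : MemY (compY W ζ)) {c : ℝ} (hc : ∀ x ∈ dotB 3, ‖G (deform ζ x)‖ ≤ c * ‖x‖) :
    ‖h.toY‖ ≤ 2 * c := by
  refine SpaceY.norm_le _ fun x hx => ?_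
  rw [grad_toY h hx.1 (hasFDerivWithinAt_compY hW ζ hx)]
  have h2 := hc x hx
  calc _ ≤ (c * ‖x‖) * 2 := (norm_innerSL_comp_le _ _).trans
        (mul_le_mul h2 (norm_dDef_le ζ hζ hx) (norm_nonneg _) ((norm_nonneg _).trans h2))
    _ = _ := by ring

theorem norm_pairY_le {G : E3 → E3} (hG : ContDiff ℝ 1 G)
    {ζ ξ : SpaceX} (hζ : ‖ζ‖ < 1 / 3) (h : MemY (pairY G ζ ξ)) {c d : ℝ}
    (hd : ∀ x ∈ dotB 3, ‖G (deform ζ x)‖ ≤ d * ‖x‖)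
    (hc : ∀ x ∈ dotB 3, ‖fderiv ℝ G (deform ζ x)‖ ≤ c) :
    ‖h.toY‖ ≤ (2 * c + 2 * d) * ‖ξ‖ := by
  refine SpaceY.norm_le _ fun x hx => ?_
  rw [grad_toY h hx.1 (hasFDerivWithinAt_pairY hG ζ ξ hx)]
  have h1 := hd x hx
  have h3 := hc x hx
  have hc0 : 0 ≤ c := (norm_nonneg _).trans h3
  have h4 : ‖(fderiv ℝ G (deform ζ x)).comp (dDef ζ x)‖ ≤ c * 2 :=
    (ContinuousLinearMap.opNorm_comp_le _ _).trans
      (mul_le_mul h3 (norm_dDef_le ζ hζ hx) (norm_nonneg _) hc0)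
  calc _ ≤ (‖ξ‖ * ‖x‖) * (c * 2) + (d * ‖x‖) * (2 * ‖ξ‖) := by
        refine (norm_add_le _ _).trans (add_le_add ?_ ?_)
        · exact (norm_innerSL_comp_le _ _).trans
            (mul_le_mul (norm_eta_le ξ x) h4 (norm_nonneg _) (by positivity))
        · exact (norm_innerSL_comp_le _ _).trans
            (mul_le_mul h1 (norm_dEta_le ξ hx) (norm_nonneg _) ((norm_nonneg _).trans h1))
    _ = _ := by ring

/-! ### Estimates for symmetric fields near the origin -/

theorem pot_symm {σ : E3 → ℝ} (hs : ∀ A ∈ symS, ∀ y ∈ B 2, σ (A y) = σ y) :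
    ∀ A ∈ symS, ∀ z, pot σ (A z) = pot σ z := by
  intro A hA z
  obtain ⟨L, hL⟩ := symS_isometry hA
  rw [hL]
  exact pot_comp_isometry L (fun y hy => by rw [← hL, hs A hA y hy]) z

theorem field_zero {σ : E3 → ℝ} (hσ : ContinuousOn σ (B 2))
    (hs : ∀ A ∈ symS, ∀ y ∈ B 2, σ (A y) = σ y) : field σ 0 = 0 :=
  gradient_zero_of_symm (pot_symm hs) (hasFDerivAt_pot hσ 0)

/-- The constant in the estimates of the field of a `C¹` density. -/
def lipC : ℝ := 2 * ballVol + 4 * singC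

theorem lipC_nonneg : 0 ≤ lipC := by
  unfold lipC; linarith [ballVol_nonneg, singC_nonneg]

/-- The field of a symmetric `C¹` density vanishes linearly at the origin. -/
theorem norm_field_le {ρ : E3 → ℝ} (hρ : ContDiff ℝ 1 ρ) (h0 : ∀ y, y ∉ B 2 → ρ y = 0)
    (hs : ∀ A ∈ symS, ∀ y ∈ B 2, ρ (A y) = ρ y) {M : ℝ} (hM0 : 0 ≤ M)
    (hM : ∀ y, ‖fderiv ℝ ρ y‖ ≤ M) (z : E3) : ‖field ρ z‖ ≤ M * lipC * ‖z‖ := by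
  have hL : ∀ y y', |ρ y - ρ y'| ≤ M * ‖y - y'‖ := fun y y' =>
    convex_univ.norm_image_sub_le_of_norm_fderiv_le (𝕜 := ℝ)
      (fun x _ => (hρ.differentiable one_ne_zero) x) (fun x _ => hM x) (mem_univ y') (mem_univ y)
  have h := field_lipschitz hρ.continuous h0 hM0 hL 0 z
  rwa [field_zero hρ.continuous.continuousOn hs, sub_zero, sub_zero] at h

theorem norm_field_sub_le {ρ : E3 → ℝ} (hρ : ContDiff ℝ 1 ρ) (h0 : ∀ y, y ∉ B 2 → ρ y = 0)
    {M : ℝ} (hM0 : 0 ≤ M) (hM : ∀ y, ‖fderiv ℝ ρ y‖ ≤ M) (z z' : E3) :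
    ‖field ρ z' - field ρ z‖ ≤ M * lipC * ‖z' - z‖ := by
  have hL : ∀ y y', |ρ y - ρ y'| ≤ M * ‖y - y'‖ := fun y y' =>
    convex_univ.norm_image_sub_le_of_norm_fderiv_le (𝕜 := ℝ)
      (fun x _ => (hρ.differentiable one_ne_zero) x) (fun x _ => hM x) (mem_univ y') (mem_univ y)
  exact field_lipschitz hρ.continuous h0 hM0 hL z z'

/-- The constants in the estimates of the field of a density that is bounded by a multiple of
`|y|`. -/
def weightC : ℝ := 2 * ballVol + 2 * singC + 24 * singC

theorem weightC_nonneg : 0 ≤ weightC := by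
  unfold weightC; linarith [ballVol_nonneg, singC_nonneg]

/-- The field of a symmetric density that is bounded by a multiple of `|y|` vanishes linearly at the
origin. The radius `6` covers the values `g_ζ(x)`, for which `|g_ζ(x)| ≤ 2 |x| ≤ 6`. -/
theorem norm_field_le_of_weight {σ : E3 → ℝ} (hσ : ContinuousOn σ (B 2))
    (hs : ∀ A ∈ symS, ∀ y ∈ B 2, σ (A y) = σ y) {M : ℝ} (hM0 : 0 ≤ M)
    (hM : ∀ y ∈ B 2, |σ y| ≤ M * ‖y‖) {z : E3} (hz : ‖z‖ ≤ 6) :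
    ‖field σ z‖ ≤ M * weightC * ‖z‖ := by
  have h := field_weighted hσ hM0 hM (z := 0) (z' := z) (R := ‖z‖) (by simp) le_rfl
  rw [field_zero hσ hs, sub_zero, sub_zero] at h
  refine h.trans ?_
  have h1 : √‖z‖ ≤ 3 := by
    rw [show (3 : ℝ) = √9 by rw [show (9 : ℝ) = 3 ^ 2 by norm_num, Real.sqrt_sq (by norm_num)]]
    exact Real.sqrt_le_sqrt (by linarith)
  rw [show M * weightC * ‖z‖ = M * (weightC * ‖z‖) by ring]
  refine mul_le_mul_of_nonneg_left ?_ hM0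
  have h2 : 8 * singC * (‖z‖ * √‖z‖) ≤ 8 * singC * (‖z‖ * 3) := by
    have := singC_nonneg
    gcongr
  unfold weightC
  linarith

/-- The estimate for the field at two deformed points `z = g_{ζ'}(x)` and `z' = g_ζ(x)` with
`‖x‖ = r`, for which `|z' - z| ≤ ‖ζ - ζ'‖ r`. -/
theorem norm_field_sub_le_of_weight {σ : E3 → ℝ} (hσ : ContinuousOn σ (B 2)) {M : ℝ} (hM0 : 0 ≤ M)
    (hM : ∀ y ∈ B 2, |σ y| ≤ M * ‖y‖) {r δ ε : ℝ} (hr : r ≤ 3) (hδ : δ ≤ ε) (hδ0 : 0 ≤ δ)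
    (hε : √(3 * δ) ≤ ε) {z z' : E3} (hz : ‖z‖ ≤ 2 * r) (hz' : ‖z'‖ ≤ 2 * r)
    (hzz : ‖z' - z‖ ≤ δ * r) :
    ‖field σ z' - field σ z‖ ≤ M * weightC * ε * r := by
  have h := field_weighted hσ hM0 hM hz hz'
  have hr0 : 0 ≤ r := by linarith [norm_nonneg z]
  have hs := singC_nonneg
  have hb := ballVol_nonneg
  have hε0 : 0 ≤ ε := hδ0.trans hδ
  refine h.trans ?_
  rw [show M * weightC * ε * r = M * (weightC * ε * r) by ring]
  refine mul_le_mul_of_nonneg_left ?_ hM0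
  have h1 : √‖z' - z‖ ≤ ε :=
    (Real.sqrt_le_sqrt (hzz.trans (by nlinarith))).trans hε
  have h2 : ‖z' - z‖ ≤ ε * r := hzz.trans (by gcongr)
  have h3 : 8 * singC * (2 * r * √‖z' - z‖) ≤ 8 * singC * (2 * r * ε) := by gcongr
  have h4 : (2 * ballVol + 2 * singC) * ‖z' - z‖ ≤ (2 * ballVol + 2 * singC) * (ε * r) := by gcongr
  have h5 : 0 ≤ singC * (ε * r) := by positivity
  unfold weightC
  linarith

/-! ### The operator and its derivative as maps into `Y` -/

open Classical in
/-- `f` as an element of `Y` (zero if `f` does not belong to `Y`). -/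
def asY (f : E3 → ℝ) : SpaceY := if h : MemY f then h.toY else 0

theorem asY_eq {f : E3 → ℝ} (h : MemY f) : asY f = h.toY := dif_pos h

theorem asY_apply {f : E3 → ℝ} (h : MemY f) (x : E3) : asY f x = f x := by
  rw [asY_eq h]; rfl

theorem pot_add {σ τ : E3 → ℝ} (hσ : ContinuousOn σ (B 2)) (hτ : ContinuousOn τ (B 2)) (z : E3) :
    pot (fun y => σ y + τ y) z = pot σ z + pot τ z := by
  unfold pot
  rw [← integral_add (integrableOn_pot hσ z) (integrableOn_pot hτ z)]
  simp only [add_div]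

theorem pot_const_mul (c : ℝ) (σ : E3 → ℝ) (z : E3) : pot (fun y => c * σ y) z = c * pot σ z := by
  unfold pot
  rw [← integral_const_mul]
  simp only [mul_div_assoc]

/-- The operator `T`, where `q = (γ, ζ)`. -/
def opY (H : ℝ → ℝ → ℝ) (U0 : E3 → ℝ) (q : ℝ × SpaceX) : SpaceY :=
  asY (compY U0 0) + asY (compY (pot (rho H U0 q)) q.2)

/-- The derivative of `T` with respect to `ζ` in the direction `ξ`. -/
def dOpY (H Hu : ℝ → ℝ → ℝ) (U0 : E3 → ℝ) (q : ℝ × SpaceX) (ξ : SpaceX) : SpaceY :=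
  asY (compY (pot (sigmaRho Hu U0 q ξ)) q.2) + asY (pairY (field (rho H U0 q)) q.2 ξ)

section Op

variable {φ : ℝ → ℝ} {U0 : E3 → ℝ} {E0 : ℝ} {H Hc Hu : ℝ → ℝ → ℝ}

theorem memY_potential (hU : IsSteadyState φ U0) : MemY (compY U0 0) := by
  have hg : ContDiff ℝ 1 (gradient U0) := by
    have h1 : ContDiff ℝ 1 (fderiv ℝ U0) := hU.potential_smooth.fderiv_right (by norm_num)
    exact (InnerProductSpace.toDual ℝ E3).symm.toContinuousLinearEquiv.contDiff.comp h1
  exact memY_compY (hasFDerivAt_potential_gradient hU) (fun A hA x => potential_symm hU hA x)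
    hg.continuous (hg.differentiable one_ne_zero 0) 0 (by simp)

theorem rho_zero_off (q : ℝ × SpaceX) (y : E3) (hy : y ∉ B 2) : rho H U0 q y = 0 :=
  indicator_of_notMem hy _

theorem memY_pot_rho (hU : IsSteadyState φ U0) (hH : IsDensityFun H Hc Hu E0)
    (hE : ∀ x, 1 < ‖x‖ → E0 ≤ U0 x) {q : ℝ × SpaceX} (hq : q ∈ params) :
    MemY (compY (pot (rho H U0 q)) q.2) := by
  have hρ := contDiff_rho hU hH hE hq
  have hf := contDiff_field hρ (rho_zero_off q)
  exact memY_compY (fun z => hasFDerivAt_pot hρ.continuous.continuousOn z)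
    (pot_symm fun A hA y hy => rho_symm hU hq hA hy) hf.continuous
    (hf.differentiable one_ne_zero 0) q.2 hq

/-- The derivative of the density satisfies the assumption of the weighted estimates. -/
theorem exists_weight (hU : IsSteadyState φ U0) (hH : IsDensityFun H Hc Hu E0)
    {q : ℝ × SpaceX} (hq : q ∈ params) : ∃ R, 0 ≤ R ∧ (∀ y ∈ B 2, |radRho Hu U0 q y| ≤ R) ∧
      ∀ ξ : SpaceX, ∀ y ∈ B 2, |sigmaRho Hu U0 q ξ y| ≤ R * (2 * ‖ξ‖) * ‖y‖ := by
  obtain ⟨R, hR0, hR⟩ := exists_bound_B2 (continuousOn_radRho hU hH hq)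
  refine ⟨R, hR0, hR, fun ξ y hy => (abs_sigmaRho_le hq ξ hy).trans ?_⟩
  rw [show R * (2 * ‖ξ‖) * ‖y‖ = R * (2 * ‖ξ‖ * ‖y‖) by ring]
  exact mul_le_mul_of_nonneg_right (hR y hy) (by positivity)

theorem memY_pot_sigma (hU : IsSteadyState φ U0) (hH : IsDensityFun H Hc Hu E0)
    {q : ℝ × SpaceX} (hq : q ∈ params) (ξ : SpaceX) :
    MemY (compY (pot (sigmaRho Hu U0 q ξ)) q.2) := by
  have hσ := continuousOn_sigmaRho hU hH hq ξ
  obtain ⟨R, hR0, -, hR⟩ := exists_weight hU hH hq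
  exact memY_compY (fun z => hasFDerivAt_pot hσ z)
    (pot_symm fun A hA y hy => sigmaRho_symm hU hq ξ hA hy) (continuous_field hσ)
    (differentiableAt_field_zero hσ (by positivity) (hR ξ)) q.2 hq

theorem memY_pair_rho (hU : IsSteadyState φ U0) (hH : IsDensityFun H Hc Hu E0)
    (hE : ∀ x, 1 < ‖x‖ → E0 ≤ U0 x) {q : ℝ × SpaceX} (hq : q ∈ params) (ξ : SpaceX) :
    MemY (pairY (field (rho H U0 q)) q.2 ξ) := by
  have hρ := contDiff_rho hU hH hE hq
  exact memY_pairY (fun z => hasFDerivAt_pot hρ.continuous.continuousOn z)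
    (pot_symm fun A hA y hy => rho_symm hU hq hA hy) (contDiff_field hρ (rho_zero_off q)) q.2 ξ hq

theorem opY_apply (hU : IsSteadyState φ U0) (hH : IsDensityFun H Hc Hu E0)
    (hE : ∀ x, 1 < ‖x‖ → E0 ≤ U0 x) {q : ℝ × SpaceX} (hq : q ∈ params) {x : E3} (hx : x ∈ B 3) :
    opY H U0 q x = U0 x - U0 0 + (pot (rho H U0 q) (deform q.2 x) - pot (rho H U0 q) 0) := by
  have h0 : deform 0 x = x := by
    show x + (0 : ℝ) • unitDir x = x
    simp
  rw [opY, SpaceY.add_apply, asY_apply (memY_potential hU), asY_apply (memY_pot_rho hU hH hE hq),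
    compY, compY, indicator_of_mem hx, indicator_of_mem hx, h0]

theorem dOpY_apply (hU : IsSteadyState φ U0) (hH : IsDensityFun H Hc Hu E0)
    (hE : ∀ x, 1 < ‖x‖ → E0 ≤ U0 x) {q : ℝ × SpaceX} (hq : q ∈ params) (ξ : SpaceX) {x : E3}
    (hx : x ∈ B 3) : dOpY H Hu U0 q ξ x =
      pot (sigmaRho Hu U0 q ξ) (deform q.2 x) - pot (sigmaRho Hu U0 q ξ) 0
        + inner ℝ (field (rho H U0 q) (deform q.2 x)) (eta ξ x) := by
  rw [dOpY, SpaceY.add_apply, asY_apply (memY_pot_sigma hU hH hq ξ),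
    asY_apply (memY_pair_rho hU hH hE hq ξ), compY, pairY, indicator_of_mem hx, indicator_of_mem hx]

theorem SpaceY.ext_ball {f g : SpaceY} (h : ∀ x ∈ B 3, f x = g x) : f = g := by
  refine Subtype.ext (funext fun x => ?_)
  by_cases hx : x ∈ B 3
  · exact h x hx
  · rw [f.mem.zero_off x hx, g.mem.zero_off x hx]

theorem sigmaRho_add (q : ℝ × SpaceX) (ξ η : SpaceX) : sigmaRho Hu U0 q (ξ + η) =
    fun y => sigmaRho Hu U0 q ξ y + sigmaRho Hu U0 q η y := by
  funext y
  rw [sigmaRho, sigmaRho, sigmaRho, SpaceX.add_apply]; ring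

theorem sigmaRho_smul (q : ℝ × SpaceX) (c : ℝ) (ξ : SpaceX) : sigmaRho Hu U0 q (c • ξ) =
    fun y => c * sigmaRho Hu U0 q ξ y := by
  funext y
  rw [sigmaRho, sigmaRho, SpaceX.smul_apply]; ring

theorem eta_add (ξ η : SpaceX) (x : E3) : eta (ξ + η) x = eta ξ x + eta η x := by
  rw [eta, SpaceX.add_apply, add_smul]; rfl

theorem eta_smul (c : ℝ) (ξ : SpaceX) (x : E3) : eta (c • ξ) x = c • eta ξ x := by
  rw [eta, SpaceX.smul_apply, mul_smul]; rfl

theorem dOpY_add (hU : IsSteadyState φ U0) (hH : IsDensityFun H Hc Hu E0)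
    (hE : ∀ x, 1 < ‖x‖ → E0 ≤ U0 x) {q : ℝ × SpaceX} (hq : q ∈ params) (ξ η : SpaceX) :
    dOpY H Hu U0 q (ξ + η) = dOpY H Hu U0 q ξ + dOpY H Hu U0 q η := by
  refine SpaceY.ext_ball fun x hx => ?_
  have hξ := continuousOn_sigmaRho hU hH hq ξ
  have hη := continuousOn_sigmaRho hU hH hq η
  rw [SpaceY.add_apply]
  simp only [dOpY_apply hU hH hE hq _ hx]
  rw [sigmaRho_add, pot_add hξ hη, pot_add hξ hη, eta_add, inner_add_right]
  ring

theorem dOpY_smul (hU : IsSteadyState φ U0) (hH : IsDensityFun H Hc Hu E0)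
    (hE : ∀ x, 1 < ‖x‖ → E0 ≤ U0 x) {q : ℝ × SpaceX} (hq : q ∈ params) (c : ℝ) (ξ : SpaceX) :
    dOpY H Hu U0 q (c • ξ) = c • dOpY H Hu U0 q ξ := by
  refine SpaceY.ext_ball fun x hx => ?_
  rw [SpaceY.smul_apply]
  simp only [dOpY_apply hU hH hE hq _ hx]
  rw [sigmaRho_smul, pot_const_mul, pot_const_mul, eta_smul, inner_smul_right]
  ring

/-! ### Estimates for the densities -/

theorem fderiv_rho (hU : IsSteadyState φ U0) (hH : IsDensityFun H Hc Hu E0)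
    (hE : ∀ x, 1 < ‖x‖ → E0 ≤ U0 x) {q : ℝ × SpaceX} (hq : q ∈ params) (y : E3) :
    fderiv ℝ (rho H U0 q) y = dRho Hc Hu U0 q y := (hasFDerivAt_rho hU hH hE hq y).fderiv

theorem exists_dRho_bound (hU : IsSteadyState φ U0) (hH : IsDensityFun H Hc Hu E0)
    (hE : ∀ x, 1 < ‖x‖ → E0 ≤ U0 x) {q : ℝ × SpaceX} (hq : q ∈ params) :
    ∃ M, 0 ≤ M ∧ ∀ y, ‖fderiv ℝ (rho H U0 q) y‖ ≤ M := by
  have hc : ContinuousOn (dRho Hc Hu U0 q) (B 2) :=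
    (continuousOn_dRho_uncurry hU hH).comp (f := fun y => (q, y)) (by fun_prop)
      fun y hy => ⟨hq, hy⟩
  obtain ⟨M, hM⟩ := (isCompact_closedBall (0 : E3) 2).exists_bound_of_continuousOn hc
  have hM0 : 0 ≤ M := (norm_nonneg _).trans (hM 0 (by simp))
  refine ⟨M, hM0, fun y => ?_⟩
  rw [fderiv_rho hU hH hE hq]
  by_cases hy : y ∈ B 2
  · exact hM y hy
  · rw [dRho, indicator_of_notMem hy, norm_zero]; exact hM0

/-- The field of the density depends continuously on the parameters, together with its
derivative. -/
theorem field_rho_sub_le (hU : IsSteadyState φ U0) (hH : IsDensityFun H Hc Hu E0)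
    (hE : ∀ x, 1 < ‖x‖ → E0 ≤ U0 x) {q q' : ℝ × SpaceX} (hq : q ∈ params) (hq' : q' ∈ params)
    {ε : ℝ} (hε : 0 ≤ ε) (h : ∀ y ∈ B 2, ‖dRho Hc Hu U0 q y - dRho Hc Hu U0 q' y‖ ≤ ε) (z : E3) :
    ‖field (rho H U0 q) z - field (rho H U0 q') z‖ ≤ ε * lipC * ‖z‖ ∧
      ‖fderiv ℝ (field (rho H U0 q)) z - fderiv ℝ (field (rho H U0 q')) z‖ ≤ ε * lipC := by
  have hρ := contDiff_rho hU hH hE hq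
  have hρ' := contDiff_rho hU hH hE hq'
  have h0 : ∀ y, y ∉ B 2 → rho H U0 q y - rho H U0 q' y = 0 := fun y hy => by
    rw [rho_zero_off q y hy, rho_zero_off q' y hy, sub_zero]
  have hs : ∀ A ∈ symS, ∀ y ∈ B 2,
      rho H U0 q (A y) - rho H U0 q' (A y) = rho H U0 q y - rho H U0 q' y := fun A hA y hy => by
    rw [rho_symm hU hq hA hy, rho_symm hU hq' hA hy]
  have hd : ContDiff ℝ 1 fun y => rho H U0 q y - rho H U0 q' y := hρ.sub hρ'
  have hfd : ∀ y, ‖fderiv ℝ (fun y => rho H U0 q y - rho H U0 q' y) y‖ ≤ ε := by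
    intro y
    rw [((hasFDerivAt_rho hU hH hE hq y).fun_sub (hasFDerivAt_rho hU hH hE hq' y)).fderiv]
    by_cases hy : y ∈ B 2
    · exact h y hy
    · rw [dRho, dRho, indicator_of_notMem hy, indicator_of_notMem hy, sub_zero, norm_zero]
      exact hε
  have e : field (fun y => rho H U0 q y - rho H U0 q' y)
      = fun z => field (rho H U0 q) z - field (rho H U0 q') z :=
    funext fun z => field_sub hρ.continuous.continuousOn hρ'.continuous.continuousOn z
  have h1 := norm_field_le hd h0 hs hε hfd z
  have h2 := norm_fderiv_field_le hd h0 hε hfd z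
  rw [e] at h1 h2
  refine ⟨h1, ?_⟩
  have hf := (contDiff_field hρ (rho_zero_off q)).differentiable one_ne_zero z
  have hf' := (contDiff_field hρ' (rho_zero_off q')).differentiable one_ne_zero z
  rw [(hf.hasFDerivAt.fun_sub hf'.hasFDerivAt).fderiv] at h2
  exact h2

theorem norm_deform_le_six (ζ : SpaceX) (hζ : ‖ζ‖ < 1 / 3) {x : E3} (hx : x ∈ dotB 3) :
    ‖deform ζ x‖ ≤ 6 :=
  (norm_deform_le_two_mul ζ hζ x).trans (by linarith [mem_B.1 hx.1])

/-- The derivative of the operator is a bounded linear map. -/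
theorem exists_dOpY_bound (hU : IsSteadyState φ U0) (hH : IsDensityFun H Hc Hu E0)
    (hE : ∀ x, 1 < ‖x‖ → E0 ≤ U0 x) {q : ℝ × SpaceX} (hq : q ∈ params) :
    ∃ C, ∀ ξ, ‖dOpY H Hu U0 q ξ‖ ≤ C * ‖ξ‖ := by
  have hρ := contDiff_rho hU hH hE hq
  obtain ⟨R, hR0, -, hR⟩ := exists_weight hU hH hq
  obtain ⟨M, hM0, hM⟩ := exists_dRho_bound hU hH hE hq
  have hw := weightC_nonneg
  have hl := lipC_nonneg
  refine ⟨2 * (R * 2 * weightC * 2) + (2 * (M * lipC) + 2 * (M * lipC * 2)), fun ξ => ?_⟩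
  have hσ := continuousOn_sigmaRho hU hH hq ξ
  rw [dOpY, asY_eq (memY_pot_sigma hU hH hq ξ), asY_eq (memY_pair_rho hU hH hE hq ξ)]
  have h1 := norm_compY_le (fun z => hasFDerivAt_pot hσ z) hq (memY_pot_sigma hU hH hq ξ)
    (c := R * (2 * ‖ξ‖) * weightC * 2) fun x hx => by
      refine (norm_field_le_of_weight hσ (fun A hA y hy => sigmaRho_symm hU hq ξ hA hy)
        (by positivity) (hR ξ) (norm_deform_le_six q.2 hq hx)).trans ?_
      rw [mul_assoc _ 2]
      gcongr
      exact norm_deform_le_two_mul q.2 hq x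
  have h2 := norm_pairY_le (contDiff_field hρ (rho_zero_off q)) hq (memY_pair_rho hU hH hE hq ξ)
    (d := M * lipC * 2) (c := M * lipC)
    (fun x hx => by
      refine (norm_field_le hρ (rho_zero_off q) (fun A hA y hy => rho_symm hU hq hA hy) hM0
        hM _).trans ?_
      rw [mul_assoc _ 2]
      gcongr
      exact norm_deform_le_two_mul q.2 hq x)
    (fun x _ => norm_fderiv_field_le hρ (rho_zero_off q) hM0 hM _)
  refine (norm_add_le _ _).trans ((add_le_add h1 h2).trans (le_of_eq ?_))
  ring

end Op

section Op

variable {φ : ℝ → ℝ} {U0 : E3 → ℝ} {E0 : ℝ} {H Hc Hu : ℝ → ℝ → ℝ}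

/-! ### Continuity of the operator and of its derivative -/

theorem eventually_norm_snd_sub_le (q₀ : ℝ × SpaceX) {ε : ℝ} (hε : 0 < ε) :
    ∀ᶠ q in 𝓝 q₀, ‖q.2 - q₀.2‖ ≤ ε ∧ √(3 * ‖q.2 - q₀.2‖) ≤ ε := by
  have h1 : Continuous fun q : ℝ × SpaceX => ‖q.2 - q₀.2‖ := by fun_prop
  have h2 : Continuous fun q : ℝ × SpaceX => √(3 * ‖q.2 - q₀.2‖) := by fun_prop
  have e1 := (h1.tendsto q₀).eventually_lt_const (u := ε) (by simpa using hε)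
  have e2 := (h2.tendsto q₀).eventually_lt_const (u := ε) (by simpa using hε)
  filter_upwards [e1, e2] with q hq1 hq2 using ⟨hq1.le, hq2.le⟩

/-- Local estimate behind the continuity of the operator. Only the gradient of the density enters,
since the norm of `Y` does not see the values of the potential. -/
theorem exists_opY_sub_le (hU : IsSteadyState φ U0) (hH : IsDensityFun H Hc Hu E0)
    (hE : ∀ x, 1 < ‖x‖ → E0 ≤ U0 x) {q₀ : ℝ × SpaceX} (hq₀ : q₀ ∈ params) :
    ∃ C, ∀ ε > 0, ∀ᶠ q in 𝓝 q₀, ‖opY H U0 q - opY H U0 q₀‖ ≤ C * ε := by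
  have hρ₀ := contDiff_rho hU hH hE hq₀
  obtain ⟨M, hM0, hM⟩ := exists_dRho_bound hU hH hE hq₀
  have hl := lipC_nonneg
  refine ⟨2 * (2 * lipC + M * lipC) + 2 * (M * lipC * 2), fun ε hε => ?_⟩
  filter_upwards [isOpen_params.mem_nhds hq₀,
    eventually_uniform_B2 (continuousOn_dRho_uncurry hU hH) hq₀ hε,
    eventually_norm_snd_sub_le q₀ hε] with q hq hd ⟨hζ, _⟩
  have hρ := contDiff_rho hU hH hE hq
  have e : opY H U0 q - opY H U0 q₀
      = (memY_pot_rho hU hH hE hq).toY - (memY_pot_rho hU hH hE hq₀).toY := by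
    rw [opY, opY, asY_eq (memY_pot_rho hU hH hE hq), asY_eq (memY_pot_rho hU hH hE hq₀)]
    abel
  rw [e]
  refine (norm_compY_sub_le (fun z => hasFDerivAt_pot hρ.continuous.continuousOn z)
    (fun z => hasFDerivAt_pot hρ₀.continuous.continuousOn z) hq (memY_pot_rho hU hH hE hq)
    (memY_pot_rho hU hH hE hq₀) (d := (2 * lipC + M * lipC) * ε) (c := M * lipC * 2) ?_ ?_).trans ?_
  · intro x hx
    have h1 := (field_rho_sub_le hU hH hE hq hq₀ hε.le hd (deform q.2 x)).1
    have h2 := norm_field_sub_le hρ₀ (rho_zero_off q₀) hM0 hM (deform q₀.2 x) (deform q.2 x)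
    have h3 := norm_deform_sub_le q.2 q₀.2 x
    have h4 := norm_deform_le_two_mul q.2 hq x
    calc _ ≤ ε * lipC * ‖deform q.2 x‖ + M * lipC * ‖deform q.2 x - deform q₀.2 x‖ :=
          (norm_sub_le_norm_sub_add_norm_sub _ _ _).trans (add_le_add h1 h2)
      _ ≤ ε * lipC * (2 * ‖x‖) + M * lipC * (ε * ‖x‖) := by
          have h5 := h3.trans (mul_le_mul_of_nonneg_right hζ (norm_nonneg x))
          gcongr
      _ = _ := by ring
  · intro x hx
    refine (norm_field_le hρ₀ (rho_zero_off q₀) (fun A hA y hy => rho_symm hU hq₀ hA hy) hM0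
      hM _).trans ?_
    rw [mul_assoc _ 2]
    gcongr
    exact norm_deform_le_two_mul q₀.2 hq₀ x
  · have : 2 * (M * lipC * 2) * ‖q.2 - q₀.2‖ ≤ 2 * (M * lipC * 2) * ε := by gcongr
    linarith

theorem tendsto_zero_of_eventually_le {α : Type*} {l : Filter α} {f : α → ℝ} (hf : ∀ a, 0 ≤ f a)
    (h : ∃ C, ∀ ε > 0, ∀ᶠ a in l, f a ≤ C * ε) : Tendsto f l (𝓝 0) := by
  obtain ⟨C, hC⟩ := h
  rw [Metric.tendsto_nhds]
  intro ε hε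
  filter_upwards [hC (ε / (|C| + 1)) (by positivity)] with a ha
  rw [dist_zero_right, Real.norm_of_nonneg (hf a)]
  refine ha.trans_lt ?_
  rw [mul_div_assoc', div_lt_iff₀ (by positivity)]
  nlinarith [le_abs_self C]

theorem continuousOn_opY (hU : IsSteadyState φ U0) (hH : IsDensityFun H Hc Hu E0)
    (hE : ∀ x, 1 < ‖x‖ → E0 ≤ U0 x) : ContinuousOn (opY H U0) params := by
  intro q₀ hq₀
  refine ContinuousAt.continuousWithinAt ?_
  rw [ContinuousAt, tendsto_iff_norm_sub_tendsto_zero]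
  exact tendsto_zero_of_eventually_le (fun _ => norm_nonneg _) (exists_opY_sub_le hU hH hE hq₀)

/-- Local estimate behind the continuity of the derivative, uniformly for `ξ` in the unit ball. -/
theorem exists_dOpY_sub_le (hU : IsSteadyState φ U0) (hH : IsDensityFun H Hc Hu E0)
    (hE : ∀ x, 1 < ‖x‖ → E0 ≤ U0 x) {q₀ : ℝ × SpaceX} (hq₀ : q₀ ∈ params) :
    ∃ C, 0 ≤ C ∧ ∀ ε > 0, ∀ᶠ q in 𝓝 q₀, ∀ ξ,
      ‖dOpY H Hu U0 q ξ - dOpY H Hu U0 q₀ ξ‖ ≤ C * ε * ‖ξ‖ := by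
  have hρ₀ := contDiff_rho hU hH hE hq₀
  have hG₀ := contDiff_field hρ₀ (rho_zero_off q₀)
  obtain ⟨R, hR0, hR, hRσ⟩ := exists_weight hU hH hq₀
  obtain ⟨M, hM0, hM⟩ := exists_dRho_bound hU hH hE hq₀
  have hl := lipC_nonneg
  have hw := weightC_nonneg
  refine ⟨(2 * ((1 + 3 * R) * 2 * weightC * 2 + R * 2 * weightC) + 2 * (R * 2 * weightC * 2))
    + (2 * (lipC + 1) + 2 * (M * lipC) + 2 * (2 * lipC + M * lipC)), by positivity, fun ε hε => ?_⟩
  -- the derivative of the unperturbed field is uniformly continuous on compact sets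
  obtain ⟨δ, hδ, hδG⟩ := Metric.uniformContinuousOn_iff.1
    ((isCompact_closedBall (0 : E3) 6).uniformContinuousOn_of_continuous
      (hG₀.continuous_fderiv one_ne_zero).continuousOn) ε hε
  filter_upwards [isOpen_params.mem_nhds hq₀,
    eventually_uniform_B2 (continuousOn_dRho_uncurry hU hH) hq₀ hε,
    eventually_uniform_B2 (continuousOn_radRho_uncurry hU hH) hq₀ hε,
    eventually_norm_snd_sub_le q₀ hε, eventually_norm_snd_sub_le q₀ (show 0 < δ / 6 by positivity)]
    with q hq hd hr ⟨hζ, hζs⟩ ⟨hζδ, _⟩ ξ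
  have hρ := contDiff_rho hU hH hE hq
  have hσ := continuousOn_sigmaRho hU hH hq ξ
  have hσ₀ := continuousOn_sigmaRho hU hH hq₀ ξ
  have e : dOpY H Hu U0 q ξ - dOpY H Hu U0 q₀ ξ
      = ((memY_pot_sigma hU hH hq ξ).toY - (memY_pot_sigma hU hH hq₀ ξ).toY)
        + ((memY_pair_rho hU hH hE hq ξ).toY - (memY_pair_rho hU hH hE hq₀ ξ).toY) := by
    rw [dOpY, dOpY, asY_eq (memY_pot_sigma hU hH hq ξ), asY_eq (memY_pot_sigma hU hH hq₀ ξ),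
      asY_eq (memY_pair_rho hU hH hE hq ξ), asY_eq (memY_pair_rho hU hH hE hq₀ ξ)]
    abel
  have hsub : ∀ x, ‖deform q.2 x - deform q₀.2 x‖ ≤ ‖q.2 - q₀.2‖ * ‖x‖ := norm_deform_sub_le _ _
  have h2 := norm_deform_le_two_mul q.2 hq
  have h2' := norm_deform_le_two_mul q₀.2 hq₀
  have hξ := norm_nonneg ξ
  have hσsub : ∀ y ∈ B 2, |sigmaRho Hu U0 q ξ y - sigmaRho Hu U0 q₀ ξ y|
      ≤ ((1 + 3 * R) * 2 * ‖ξ‖ * ε) * ‖y‖ := by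
    intro y hy
    refine (abs_sigmaRho_sub_le hq hq₀ ξ hy).trans ?_
    have h1 := hr y hy
    rw [Real.norm_eq_abs] at h1
    calc _ ≤ (ε + 3 * R * ε) * (2 * ‖ξ‖ * ‖y‖) := by
          have h3 := hR y hy
          gcongr
      _ = _ := by ring
  have hA := norm_compY_sub_le (fun z => hasFDerivAt_pot hσ z) (fun z => hasFDerivAt_pot hσ₀ z) hq
    (memY_pot_sigma hU hH hq ξ) (memY_pot_sigma hU hH hq₀ ξ)
    (d := ((1 + 3 * R) * 2 * weightC * 2 + R * 2 * weightC) * ε * ‖ξ‖)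
    (c := R * 2 * weightC * 2 * ‖ξ‖) (by
      intro x hx
      have h3 := norm_field_le_of_weight (hσ.sub hσ₀) (fun A hA y hy => by
        show sigmaRho Hu U0 q ξ (A y) - sigmaRho Hu U0 q₀ ξ (A y) = _
        rw [sigmaRho_symm hU hq ξ hA hy, sigmaRho_symm hU hq₀ ξ hA hy]; rfl)
        (by positivity) hσsub (norm_deform_le_six q.2 hq hx)
      have h4 := norm_field_sub_le_of_weight hσ₀ (by positivity) (hRσ ξ) (mem_B.1 hx.1) hζ
        (norm_nonneg _) hζs (h2' x) (h2 x) (hsub x)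
      have h5 : field (sigmaRho Hu U0 q ξ - sigmaRho Hu U0 q₀ ξ) (deform q.2 x)
          = field (sigmaRho Hu U0 q ξ) (deform q.2 x) - field (sigmaRho Hu U0 q₀ ξ)
            (deform q.2 x) :=
        field_sub hσ hσ₀ _
      rw [h5] at h3
      calc _ ≤ (1 + 3 * R) * 2 * ‖ξ‖ * ε * weightC * ‖deform q.2 x‖
            + R * (2 * ‖ξ‖) * weightC * ε * ‖x‖ :=
            (norm_sub_le_norm_sub_add_norm_sub _ _ _).trans (add_le_add h3 h4)
        _ ≤ (1 + 3 * R) * 2 * ‖ξ‖ * ε * weightC * (2 * ‖x‖)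
            + R * (2 * ‖ξ‖) * weightC * ε * ‖x‖ := by
            have h6 := h2 x
            gcongr
        _ = _ := by ring) (by
      intro x hx
      refine (norm_field_le_of_weight hσ₀ (fun A hA y hy => sigmaRho_symm hU hq₀ ξ hA hy)
        (by positivity) (hRσ ξ) (norm_deform_le_six q₀.2 hq₀ hx)).trans ?_
      calc _ ≤ R * (2 * ‖ξ‖) * weightC * (2 * ‖x‖) := by
            have h6 := h2' x
            gcongr
        _ = _ := by ring)
  have hB := norm_pairY_sub_le (contDiff_field hρ (rho_zero_off q)) hG₀ hq
    (memY_pair_rho hU hH hE hq ξ) (memY_pair_rho hU hH hE hq₀ ξ)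
    (d := (2 * lipC + M * lipC) * ε) (e := (lipC + 1) * ε) (c := M * lipC) (by
      intro x hx
      have h3 := (field_rho_sub_le hU hH hE hq hq₀ hε.le hd (deform q.2 x)).1
      have h4 := norm_field_sub_le hρ₀ (rho_zero_off q₀) hM0 hM (deform q₀.2 x) (deform q.2 x)
      calc _ ≤ ε * lipC * ‖deform q.2 x‖ + M * lipC * ‖deform q.2 x - deform q₀.2 x‖ :=
            (norm_sub_le_norm_sub_add_norm_sub _ _ _).trans (add_le_add h3 h4)
        _ ≤ ε * lipC * (2 * ‖x‖) + M * lipC * (ε * ‖x‖) := by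
            have h5 := (hsub x).trans (mul_le_mul_of_nonneg_right hζ (norm_nonneg x))
            have h6 := h2 x
            gcongr
        _ = _ := by ring) (by
      intro x hx
      have h3 := (field_rho_sub_le hU hH hE hq hq₀ hε.le hd (deform q.2 x)).2
      have h4 := hδG (deform q.2 x) (mem_B.2 (norm_deform_le_six q.2 hq hx)) (deform q₀.2 x)
        (mem_B.2 (norm_deform_le_six q₀.2 hq₀ hx)) (by
          rw [dist_eq_norm]
          have h5 := (hsub x).trans
            (mul_le_mul hζδ (mem_B.1 hx.1) (norm_nonneg _) (by positivity))
          linarith)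
      rw [dist_eq_norm] at h4
      calc _ ≤ ε * lipC + ε :=
            (norm_sub_le_norm_sub_add_norm_sub _ _ _).trans (add_le_add h3 h4.le)
        _ = _ := by ring)
    (fun x _ => norm_fderiv_field_le hρ₀ (rho_zero_off q₀) hM0 hM _)
  rw [e]
  refine (norm_add_le _ _).trans ((add_le_add hA hB).trans ?_)
  calc _ ≤ 2 * (((1 + 3 * R) * 2 * weightC * 2 + R * 2 * weightC) * ε * ‖ξ‖)
        + 2 * (R * 2 * weightC * 2 * ‖ξ‖) * ε
        + (2 * ((lipC + 1) * ε) + 2 * (M * lipC) * ε + 2 * ((2 * lipC + M * lipC) * ε)) * ‖ξ‖ := by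
        gcongr
    _ = _ := by ring

open Classical in
/-- The derivative of the operator with respect to `ζ` as a bounded linear map. -/
def dOp (H Hu : ℝ → ℝ → ℝ) (U0 : E3 → ℝ) (q : ℝ × SpaceX) : SpaceX →L[ℝ] SpaceY :=
  if h : ∃ L : SpaceX →L[ℝ] SpaceY, ∀ ξ, L ξ = dOpY H Hu U0 q ξ then h.choose else 0

theorem dOp_apply (hU : IsSteadyState φ U0) (hH : IsDensityFun H Hc Hu E0)
    (hE : ∀ x, 1 < ‖x‖ → E0 ≤ U0 x) {q : ℝ × SpaceX} (hq : q ∈ params) (ξ : SpaceX) :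
    dOp H Hu U0 q ξ = dOpY H Hu U0 q ξ := by
  have h : ∃ L : SpaceX →L[ℝ] SpaceY, ∀ ξ, L ξ = dOpY H Hu U0 q ξ := by
    obtain ⟨C, hC⟩ := exists_dOpY_bound hU hH hE hq
    let l : SpaceX →ₗ[ℝ] SpaceY :=
      { toFun := dOpY H Hu U0 q
        map_add' := dOpY_add hU hH hE hq
        map_smul' := dOpY_smul hU hH hE hq }
    exact ⟨l.mkContinuous C hC, fun _ => rfl⟩
  rw [dOp, dif_pos h]
  exact h.choose_spec ξ

theorem continuousAt_dOp (hU : IsSteadyState φ U0) (hH : IsDensityFun H Hc Hu E0)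
    (hE : ∀ x, 1 < ‖x‖ → E0 ≤ U0 x) {q₀ : ℝ × SpaceX} (hq₀ : q₀ ∈ params) :
    ContinuousAt (dOp H Hu U0) q₀ := by
  rw [ContinuousAt, tendsto_iff_norm_sub_tendsto_zero]
  obtain ⟨C, hC0, hC⟩ := exists_dOpY_sub_le hU hH hE hq₀
  refine tendsto_zero_of_eventually_le (fun _ => norm_nonneg _) ⟨C, fun ε hε => ?_⟩
  filter_upwards [hC ε hε, isOpen_params.mem_nhds hq₀] with q h hq
  refine ContinuousLinearMap.opNorm_le_bound _ (by positivity) fun ξ => ?_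
  rw [_root_.sub_apply, dOp_apply hU hH hE hq, dOp_apply hU hH hE hq₀]
  exact h ξ

/-! ### Differentiability of the operator -/

theorem line_tendsto (γ : ℝ) (ζ ξ : SpaceX) :
    Tendsto (fun s : ℝ => (γ, ζ + s • ξ)) (𝓝 0) (𝓝 (γ, ζ)) := by
  have : Continuous fun s : ℝ => (γ, ζ + s • ξ) := by fun_prop
  simpa using this.tendsto 0

theorem eventually_line_mem (γ : ℝ) {ζ : SpaceX} (ξ : SpaceX) (hζ : ‖ζ‖ < 1 / 3) :
    ∀ᶠ s : ℝ in 𝓝 0, ((γ, ζ + s • ξ) : ℝ × SpaceX) ∈ params :=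
  (line_tendsto γ ζ ξ).eventually_mem (isOpen_params.mem_nhds hζ)

/-- Reduction of derivatives at `s` to derivatives at zero. -/
theorem hasDerivAt_of_shift {f g : ℝ → ℝ} {f' s : ℝ} (h : HasDerivAt g f' 0)
    (hfg : ∀ t, f t = g (t - s)) : HasDerivAt f f' s := by
  have h1 : HasDerivAt (fun t : ℝ => t - s) 1 s := (hasDerivAt_id s).sub_const s
  have h2 : HasDerivAt g f' (s - s) := by rwa [sub_self]
  have h3 := HasDerivAt.comp (h₂ := g) (h := fun t : ℝ => t - s) s h2 h1
  rw [mul_one] at h3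
  exact h3.congr_of_eventuallyEq (Eventually.of_forall hfg)

theorem continuousOn_rho_uncurry (hU : IsSteadyState φ U0) (hH : IsDensityFun H Hc Hu E0) :
    ContinuousOn (fun p : (ℝ × SpaceX) × E3 => rho H U0 p.1 p.2) (params ×ˢ B 2) := by
  refine (hH.continuous.comp_continuousOn (continuousOn_args hU)).congr ?_
  rintro p ⟨-, hy⟩
  show rho H U0 p.1 p.2 = _
  rw [rho, indicator_of_mem hy]
  rfl

theorem hasDerivAt_rho_line' (hU : IsSteadyState φ U0) (hH : IsDensityFun H Hc Hu E0)
    (γ : ℝ) (ζ ξ : SpaceX) (s : ℝ) (hs : ‖ζ + s • ξ‖ < 1 / 3) {y : E3} (hy : y ∈ B 2) :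
    HasDerivAt (fun s : ℝ => rho H U0 (γ, ζ + s • ξ) y) (sigmaRho Hu U0 (γ, ζ + s • ξ) ξ y) s := by
  have h := hasDerivAt_rho_line hU hH γ (ζ + s • ξ) ξ hs hy
  refine hasDerivAt_of_shift h fun t => ?_
  rw [add_assoc, ← add_smul, add_sub_cancel]

/-- The derivative of the potential, at a fixed point, along the line `ζ + s ξ`. -/
theorem hasDerivAt_pot_rho (hU : IsSteadyState φ U0) (hH : IsDensityFun H Hc Hu E0)
    (hE : ∀ x, 1 < ‖x‖ → E0 ≤ U0 x) (γ : ℝ) (ζ ξ : SpaceX) (hζ : ‖ζ‖ < 1 / 3) (z : E3) :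
    HasDerivAt (fun s : ℝ => pot (rho H U0 (γ, ζ + s • ξ)) z)
      (pot (sigmaRho Hu U0 (γ, ζ) ξ) z) 0 := by
  have hq : ((γ, ζ) : ℝ × SpaceX) ∈ params := hζ
  obtain ⟨R, hR0, hR⟩ := exists_uniform_bound_B2 (continuousOn_radRho_uncurry hU hH) hq
  have hev : ∀ᶠ s : ℝ in 𝓝 0, (∀ y ∈ B 2, ‖radRho Hu U0 (γ, ζ + s • ξ) y‖ ≤ R) ∧
      ((γ, ζ + s • ξ) : ℝ × SpaceX) ∈ params :=
    ((line_tendsto γ ζ ξ).eventually hR).and (eventually_line_mem γ ξ hζ)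
  have h0 : (0 : ℝ) • ξ = 0 := zero_smul ℝ ξ
  have hcont : ∀ s : ℝ, (γ, ζ + s • ξ) ∈ params → ContinuousOn (rho H U0 (γ, ζ + s • ξ)) (B 2) :=
    fun s hs => (contDiff_rho hU hH hE hs).continuous.continuousOn
  have h := hasDerivAt_integral_of_dominated_loc_of_deriv_le (μ := volume.restrict (B 2)) (𝕜 := ℝ)
    (F := fun s y => rho H U0 (γ, ζ + s • ξ) y / ‖z - y‖)
    (F' := fun s y => sigmaRho Hu U0 (γ, ζ + s • ξ) ξ y / ‖z - y‖) (x₀ := 0)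
    (bound := fun y => (R * (2 * ‖ξ‖ * 2)) / ‖z - y‖) hev ?_ ?_ ?_ ?_ ?_ ?_
  · have h2 := h.2
    simp only [h0, add_zero] at h2
    exact h2
  · filter_upwards [hev] with s hs using (integrableOn_pot (hcont s hs.2) z).aestronglyMeasurable
  · refine integrableOn_pot (hcont 0 ?_) z
    simpa using hq
  · refine (integrableOn_pot (continuousOn_sigmaRho hU hH (q := (γ, ζ + (0 : ℝ) • ξ)) ?_ ξ)
      z).aestronglyMeasurable
    simpa using hq
  · filter_upwards [ae_restrict_mem measurableSet_B2] with y hy s ⟨hs1, hs2⟩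
    rw [norm_div, norm_norm]
    gcongr
    refine (abs_sigmaRho_le hs2 ξ hy).trans ?_
    have h1 := hs1 y hy
    rw [Real.norm_eq_abs] at h1
    have h3 := mem_B.1 hy
    gcongr
  · exact integrableOn_pot continuousOn_const z
  · filter_upwards [ae_restrict_mem measurableSet_B2] with y hy s ⟨hs1, hs2⟩
    exact (hasDerivAt_rho_line' hU hH γ ζ ξ s hs2 hy).div_const _

theorem deform_line (ζ ξ : SpaceX) (s : ℝ) (x : E3) :
    deform (ζ + s • ξ) x = deform ζ x + s • eta ξ x := by
  rw [deform_eq, deform_eq, eta_add, eta_smul, add_assoc]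

/-- The derivative of the value at `x` along the line `ζ + s ξ`. Both the density and the point at
which its potential is evaluated depend on `s`, and the two contributions add up. -/
theorem hasDerivAt_opY_line_zero (hU : IsSteadyState φ U0) (hH : IsDensityFun H Hc Hu E0)
    (hE : ∀ x, 1 < ‖x‖ → E0 ≤ U0 x) (γ : ℝ) (ζ ξ : SpaceX) (hζ : ‖ζ‖ < 1 / 3) {x : E3}
    (hx : x ∈ B 3) : HasDerivAt (fun s : ℝ => opY H U0 (γ, ζ + s • ξ) x)
      (dOpY H Hu U0 (γ, ζ) ξ x) 0 := by
  have hq : ((γ, ζ) : ℝ × SpaceX) ∈ params := hζ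
  have hev := eventually_line_mem γ ξ hζ
  have hρ := (contDiff_rho hU hH hE hq).continuous.continuousOn (s := B 2)
  set z := deform ζ x with hz
  set v := eta ξ x with hv
  have h1 := hasDerivAt_pot_rho hU hH hE γ ζ ξ hζ z
  have h2 := hasDerivAt_pot_rho hU hH hE γ ζ ξ hζ 0
  have h3 : HasDerivAt (fun s : ℝ => pot (rho H U0 (γ, ζ)) (z + s • v))
      (inner ℝ (field (rho H U0 (γ, ζ)) z) v) 0 := by
    have hl : HasDerivAt (fun s : ℝ => z + s • v) v 0 := by
      have := ((hasDerivAt_id (0 : ℝ)).smul_const v).const_add z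
      rwa [one_smul] at this
    have hp := hasFDerivAt_pot hρ (z + (0 : ℝ) • v)
    have := hp.comp_hasDerivAt (0 : ℝ) hl
    rw [zero_smul, add_zero] at this
    exact this
  -- the mixed difference is `o(s)`: the density difference tends to zero, the point moves by `s v`
  have h4 : HasDerivAt (fun s : ℝ =>
      (pot (rho H U0 (γ, ζ + s • ξ)) (z + s • v) - pot (rho H U0 (γ, ζ)) (z + s • v))
        - (pot (rho H U0 (γ, ζ + s • ξ)) z - pot (rho H U0 (γ, ζ)) z)) 0 0 := by
    rw [hasDerivAt_iff_isLittleO, Asymptotics.isLittleO_iff]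
    intro ε hε
    set K := (2 * ballVol + 2 * singC) * ‖v‖ with hK
    have hK0 : 0 ≤ K := by
      have := ballVol_nonneg
      have := singC_nonneg
      positivity
    have hu : ∀ᶠ s : ℝ in 𝓝 0, ∀ y ∈ B 2,
        ‖rho H U0 (γ, ζ + s • ξ) y - rho H U0 (γ, ζ) y‖ ≤ ε / (K + 1) :=
          (line_tendsto γ ζ ξ).eventually
      (eventually_uniform_B2 (continuousOn_rho_uncurry hU hH) hq
        (show 0 < ε / (K + 1) by positivity))
    filter_upwards [hev, hu] with s hs hsu
    have hρs := (contDiff_rho hU hH hE hs).continuous.continuousOn (s := B 2)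
    have hb := pot_lipschitz (hρs.sub hρ) (M := ε / (K + 1)) (by positivity) hsu z (z + s • v)
    have e : ∀ w, pot (rho H U0 (γ, ζ + s • ξ) - rho H U0 (γ, ζ)) w
        = pot (rho H U0 (γ, ζ + s • ξ)) w - pot (rho H U0 (γ, ζ)) w := fun w => pot_sub hρs hρ w
    rw [e, e, add_sub_cancel_left, norm_smul] at hb
    simp only [zero_smul, add_zero, sub_self, sub_zero, smul_zero]
    rw [Real.norm_eq_abs, Real.norm_eq_abs]
    rw [Real.norm_eq_abs] at hb
    refine hb.trans ?_
    calc ε / (K + 1) * (2 * ballVol + 2 * singC) * (|s| * ‖v‖) = ε * (K / (K + 1)) * |s| := by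
          rw [hK]; ring
      _ ≤ ε * 1 * |s| := by
          gcongr
          exact div_le_one_of_le₀ (by linarith) (by positivity)
      _ = ε * |s| := by rw [mul_one]
  have h5 := ((((h1.sub h2).add h3).add h4).const_add (U0 x - U0 0 - pot (rho H U0 (γ, ζ)) z))
  refine (h5.congr_deriv ?_).congr_of_eventuallyEq ?_
  · rw [dOpY_apply hU hH hE hq ξ hx, add_zero]
  · filter_upwards [hev] with s hs
    rw [opY_apply hU hH hE hs hx]
    simp only [deform_line, Pi.add_apply, Pi.sub_apply]
    ring

theorem hasDerivAt_opY_line (hU : IsSteadyState φ U0) (hH : IsDensityFun H Hc Hu E0)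
    (hE : ∀ x, 1 < ‖x‖ → E0 ≤ U0 x) (γ : ℝ) (ζ ξ : SpaceX) (s : ℝ) (hs : ‖ζ + s • ξ‖ < 1 / 3)
      {x : E3}
    (hx : x ∈ B 3) : HasDerivAt (fun s : ℝ => opY H U0 (γ, ζ + s • ξ) x)
      (dOpY H Hu U0 (γ, ζ + s • ξ) ξ x) s := by
  have h := hasDerivAt_opY_line_zero hU hH hE γ (ζ + s • ξ) ξ hs hx
  refine hasDerivAt_of_shift h fun t => ?_
  rw [add_assoc, ← add_smul, add_sub_cancel]

/-- The mean value theorem is applied to the real functions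
`s ↦ T(γ, ζ + s ξ)(x) - T(γ, ζ + s ξ)(x')`, whose derivatives are known; continuity of the derivative in the operator norm makes the
estimate uniform in `x` and `x'`. -/
theorem hasFDerivAt_opY (hU : IsSteadyState φ U0) (hH : IsDensityFun H Hc Hu E0)
    (hE : ∀ x, 1 < ‖x‖ → E0 ≤ U0 x) (γ : ℝ) (ζ : SpaceX) (hζ : ‖ζ‖ < 1 / 3) :
    HasFDerivAt (fun ζ => opY H U0 (γ, ζ)) (dOp H Hu U0 (γ, ζ)) ζ := by
  have hq : ((γ, ζ) : ℝ × SpaceX) ∈ params := hζ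
  rw [hasFDerivAt_iff_isLittleO_nhds_zero, Asymptotics.isLittleO_iff]
  intro ε hε
  have hc : Tendsto (fun ζ' : SpaceX => dOp H Hu U0 (γ, ζ')) (𝓝 ζ) (𝓝 (dOp H Hu U0 (γ, ζ))) :=
    (continuousAt_dOp hU hH hE hq).tendsto.comp
      ((by fun_prop : Continuous fun ζ' : SpaceX => (γ, ζ')).tendsto ζ)
  have hp : ∀ᶠ ζ' : SpaceX in 𝓝 ζ, ‖ζ'‖ < 1 / 3 :=
      (continuous_norm.tendsto ζ).eventually_lt_const hζ
  obtain ⟨δ, hδ, hball⟩ := Metric.eventually_nhds_iff_ball.1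
    (hp.and (hc.eventually (closedBall_mem_nhds _ hε)))
  filter_upwards [ball_mem_nhds (0 : SpaceX) hδ] with ξ hξ
  have hline : ∀ s ∈ Icc (0 : ℝ) 1, ζ + s • ξ ∈ ball ζ δ := by
    intro s hs
    rw [mem_ball, dist_eq_norm, add_sub_cancel_left, norm_smul, Real.norm_of_nonneg hs.1]
    have : ‖ξ‖ < δ := by simpa using hξ
    nlinarith [hs.1, hs.2, norm_nonneg ξ]
  refine SpaceY.norm_le_of_lipschitz _ (by positivity) fun R hR0 hR x hx x' hx' => ?_
  have hsub : B R ⊆ B 3 := closedBall_subset_closedBall hR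
  set L := dOp H Hu U0 (γ, ζ) with hL
  have hder : ∀ s ∈ Icc (0 : ℝ) 1, HasDerivWithinAt (fun s : ℝ =>
      (opY H U0 (γ, ζ + s • ξ) x - opY H U0 (γ, ζ + s • ξ) x') - s * (L ξ x - L ξ x'))
      (((dOp H Hu U0 (γ, ζ + s • ξ) - L) ξ) x - ((dOp H Hu U0 (γ, ζ + s • ξ) - L) ξ) x')
      (Icc 0 1) s := by
    intro s hs
    have hps := (hball _ (hline s hs)).1
    have h1 := hasDerivAt_opY_line hU hH hE γ ζ ξ s hps (hsub hx)
    have h2 := hasDerivAt_opY_line hU hH hE γ ζ ξ s hps (hsub hx')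
    have h3 := (hasDerivAt_id s).mul_const (L ξ x - L ξ x')
    refine (((h1.sub h2).sub h3).congr_deriv ?_).hasDerivWithinAt
    have hps' : ((γ, ζ + s • ξ) : ℝ × SpaceX) ∈ params := hps
    rw [_root_.sub_apply, SpaceY.sub_apply, SpaceY.sub_apply, dOp_apply hU hH hE hps']
    ring
  have hbound : ∀ s ∈ Ico (0 : ℝ) 1,
      ‖((dOp H Hu U0 (γ, ζ + s • ξ) - L) ξ) x - ((dOp H Hu U0 (γ, ζ + s • ξ) - L) ξ) x'‖
        ≤ ε * ‖ξ‖ * R * ‖x - x'‖ := by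
    intro s hs
    have h1 := (hball _ (hline s ⟨hs.1, hs.2.le⟩)).2
    rw [dist_eq_norm] at h1
    refine (SpaceY.lipschitz _ hR0 hR hx hx').trans ?_
    gcongr
    exact (ContinuousLinearMap.le_opNorm _ _).trans (by gcongr)
  have h := norm_image_sub_le_of_norm_deriv_le_segment_01' hder hbound
  rw [Real.norm_eq_abs] at h
  refine le_of_eq_of_le (congrArg abs ?_) h
  simp only [SpaceY.sub_apply, one_smul, zero_smul, add_zero]
  ring

end Op

/-! ### The densities of the steady state family -/

/-- The densities of the steady state family satisfy the abstract assumptions. -/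
theorem isDensityFun_hFun {φ ψ : ℝ → ℝ} {E0 : ℝ} (hφ : IsEnergyProfile φ E0)
    (hψ : ContDiff ℝ 1 ψ) (m : ℝ) :
    IsDensityFun (hFun φ ψ E0 m) (hFunC φ ψ E0 m) (hFunU φ ψ E0 m) E0 where
  hasFDerivAt := hasFDerivAt_hFun hφ hψ m
  continuous_left := continuous_hFunC hφ hψ m
  continuous_right := continuous_hFunU hφ hψ m
  left_zero := hFunC_zero m
  eq_zero c _ hu := hFun_eq_zero hu m c
  left_eq_zero c _ hu := hFunC_eq_zero hu m c
  right_eq_zero c _ hu := hFunU_eq_zero hu m c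

/-- A lower bound of the potential on `B 3` serves as the fixed lower limit of the energy
integrals. -/
theorem exists_lt_potential {φ : ℝ → ℝ} {U0 : E3 → ℝ} (hU : IsSteadyState φ U0) :
    ∃ m, ∀ x ∈ B 3, m < U0 x := by
  obtain ⟨C, hC⟩ := (isCompact_closedBall (0 : E3) 3).exists_bound_of_continuousOn
    hU.potential_smooth.continuous.continuousOn
  refine ⟨-C - 1, fun x hx => ?_⟩
  have := neg_le_of_abs_le (hC x hx)
  linarith

section Final

variable {φ ψ : ℝ → ℝ} {E0 m : ℝ} {U0 : E3 → ℝ}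

theorem rho_hFun_eq (hψ : Continuous ψ) (hm : ∀ x ∈ B 3, m < U0 x) (γ : ℝ) (ζ : SpaceX)
    (hζ : ‖ζ‖ < 1 / 3) {y : E3} (hy : y ∈ B 2) :
    rho (hFun φ ψ E0 m) U0 (γ, ζ) y = defDensity φ ψ E0 U0 γ ζ y := by
  rw [rho, indicator_of_mem hy, defDensity, hDens_eq_hFun hψ]
  exact (hm _ (deformInv_mem ζ (B2_subset_image ζ hζ hy))).le

theorem hasDerivAt_hDens_defPot (hφ : IsEnergyProfile φ E0) (hψ : ContDiff ℝ 1 ψ)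
    (hm : ∀ x ∈ B 3, m < U0 x) (γ : ℝ) (ζ : SpaceX)
    (hζ : ‖ζ‖ < 1 / 3) {y : E3} (hy : y ∈ B 2) :
    HasDerivAt (fun u => hDens φ ψ E0 γ (cylRadius y) u)
      (hFunU φ ψ E0 m (γ * cylRadius y) (defPot U0 ζ y)) (defPot U0 ζ y) :=
  hasDerivAt_hDens hφ hψ (hm _ (deformInv_mem ζ (B2_subset_image ζ hζ hy))) γ _

theorem dKernel_eq (hφ : IsEnergyProfile φ E0) (hψ : ContDiff ℝ 1 ψ)
    (hm : ∀ x ∈ B 3, m < U0 x) (γ : ℝ) (ζ ξ : SpaceX) (hζ : ‖ζ‖ < 1 / 3) (x : E3) {y : E3}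
    (hy : y ∈ B 2) : dKernel φ ψ E0 U0 γ ζ ξ x y =
      -(sigmaRho (hFunU φ ψ E0 m) U0 (γ, ζ) ξ y / ‖deform ζ x - y‖
        - sigmaRho (hFunU φ ψ E0 m) U0 (γ, ζ) ξ y / ‖0 - y‖) := by
  have h : dhDens φ ψ E0 γ (cylRadius y) (defPot U0 ζ y)
      = hFunU φ ψ E0 m (γ * cylRadius y) (defPot U0 ζ y) :=
    (hasDerivAt_hDens_defPot hφ hψ hm γ ζ hζ hy).deriv
  rw [dKernel, h, unitDir_deformInv ζ hζ (B2_subset_image ζ hζ hy), zero_sub, norm_neg, sigmaRho,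
    radRho, dPot]
  ring

theorem fieldKernel_eq (hψ : Continuous ψ) (hm : ∀ x ∈ B 3, m < U0 x) (γ : ℝ) (ζ : SpaceX)
    (hζ : ‖ζ‖ < 1 / 3) (x : E3) {y : E3} (hy : y ∈ B 2) : fieldKernel φ ψ E0 U0 γ ζ x y =
      -(rho (hFun φ ψ E0 m) U0 (γ, ζ) y • newtonKer (deform ζ x - y)) := by
  rw [fieldKernel, rho_hFun_eq hψ hm γ ζ hζ hy, newtonKer, smul_smul, ← neg_smul]
  congr 1
  rw [div_eq_mul_inv, inv_pow]
  ring

theorem opT_eq (hψ : Continuous ψ) (hm : ∀ x ∈ B 3, m < U0 x) (γ : ℝ) (ζ : SpaceX)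
    (hζ : ‖ζ‖ < 1 / 3) (x : E3) : opT φ ψ E0 U0 γ ζ x = U0 x - U0 0 +
      (pot (rho (hFun φ ψ E0 m) U0 (γ, ζ)) (deform ζ x) - pot (rho (hFun φ ψ E0 m) U0 (γ, ζ))
        0) := by
  have h1 : ∀ z, pot (rho (hFun φ ψ E0 m) U0 (γ, ζ)) z
      = ∫ y in B 2, defDensity φ ψ E0 U0 γ ζ y / ‖z - y‖ := fun z =>
    setIntegral_congr_fun measurableSet_B2 fun y hy => by
      show _ / _ = _
      rw [rho_hFun_eq hψ hm γ ζ hζ hy]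
  rw [h1, h1, opT]
  simp only [zero_sub, norm_neg]
  ring

theorem opDT_eq (hφ : IsEnergyProfile φ E0) (hψ : ContDiff ℝ 1 ψ) (hU : IsSteadyState φ U0)
    (hm : ∀ x ∈ B 3, m < U0 x) (γ : ℝ) (ζ ξ : SpaceX) (hζ : ‖ζ‖ < 1 / 3) (x : E3) :
    opDT φ ψ E0 U0 γ ζ ξ x =
      pot (sigmaRho (hFunU φ ψ E0 m) U0 (γ, ζ) ξ) (deform ζ x)
        - pot (sigmaRho (hFunU φ ψ E0 m) U0 (γ, ζ) ξ) 0
        + inner ℝ (field (rho (hFun φ ψ E0 m) U0 (γ, ζ)) (deform ζ x)) (eta ξ x) := by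
  have hq : ((γ, ζ) : ℝ × SpaceX) ∈ params := hζ
  have hσ := continuousOn_sigmaRho hU (isDensityFun_hFun hφ hψ m) hq ξ
  have h1 : ∫ y in B 2, dKernel φ ψ E0 U0 γ ζ ξ x y
      = -(pot (sigmaRho (hFunU φ ψ E0 m) U0 (γ, ζ) ξ) (deform ζ x)
        - pot (sigmaRho (hFunU φ ψ E0 m) U0 (γ, ζ) ξ) 0) := by
    rw [pot, pot, ← integral_sub (integrableOn_pot hσ _) (integrableOn_pot hσ _), ← integral_neg]
    exact setIntegral_congr_fun measurableSet_B2 fun y hy => dKernel_eq hφ hψ hm γ ζ ξ hζ x hy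
  have h2 : ∫ y in B 2, fieldKernel φ ψ E0 U0 γ ζ x y
      = -field (rho (hFun φ ψ E0 m) U0 (γ, ζ)) (deform ζ x) := by
    rw [field, ← integral_neg]
    exact setIntegral_congr_fun measurableSet_B2 fun y hy =>
      fieldKernel_eq hψ.continuous hm γ ζ hζ x hy
  rw [opDT, h1, h2, inner_neg_left, eta, inner_smul_right]
  ring

end Final

end VlasovPoisson

end

theorem proposition3p1 (φ ψ : ℝ → ℝ) (E0 : ℝ) (U0 : E3 → ℝ)
    (hφ : IsEnergyProfile φ E0) (hU : IsSteadyState φ U0) (hψ : IsAngularProfile ψ)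
    (r : ℝ) (hr0 : 0 < r) (hr : r ≤ 1 / 3) :
    -- the deformations are invertible and their inverses are defined on `B 2`
    (∀ ζ ∈ ball (0 : SpaceX) r, InjOn (deform ζ) (B 3) ∧ B 2 ⊆ deform ζ '' B 3) ∧
    -- all the integrals converge, and the partial derivatives in the formula exist
    (∀ γ ∈ Ioo (-1 : ℝ) 1, ∀ ζ ∈ ball (0 : SpaceX) r,
      (∀ y ∈ B 2, DifferentiableAt ℝ (fun u => hDens φ ψ E0 γ (cylRadius y) u) (defPot U0 ζ y) ∧
        DifferentiableAt ℝ (defPot U0 ζ) y) ∧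
      ∀ x ∈ B 3,
        IntegrableOn (fun y => defDensity φ ψ E0 U0 γ ζ y / ‖deform ζ x - y‖) (B 2) ∧
        IntegrableOn (fieldKernel φ ψ E0 U0 γ ζ x) (B 2) ∧
        ∀ ξ : SpaceX, IntegrableOn (dKernel φ ψ E0 U0 γ ζ ξ x) (B 2)) ∧
    ∃ T : ℝ → SpaceX → SpaceY,
      (∀ γ ∈ Ioo (-1 : ℝ) 1, ∀ ζ ∈ ball (0 : SpaceX) r, ∀ x ∈ B 3,
        T γ ζ x = opT φ ψ E0 U0 γ ζ x) ∧
      ContinuousOn (fun q : ℝ × SpaceX => T q.1 q.2) (Ioo (-1 : ℝ) 1 ×ˢ ball (0 : SpaceX) r) ∧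
      ∃ D : ℝ → SpaceX → (SpaceX →L[ℝ] SpaceY),
        (∀ γ ∈ Ioo (-1 : ℝ) 1, ∀ ζ ∈ ball (0 : SpaceX) r, HasFDerivAt (T γ) (D γ ζ) ζ) ∧
        ContinuousOn (fun q : ℝ × SpaceX => D q.1 q.2)
          (Ioo (-1 : ℝ) 1 ×ˢ ball (0 : SpaceX) r) ∧
        ∀ γ ∈ Ioo (-1 : ℝ) 1, ∀ ζ ∈ ball (0 : SpaceX) r, ∀ ξ : SpaceX, ∀ x ∈ B 3,
          D γ ζ ξ x = opDT φ ψ E0 U0 γ ζ ξ x := by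
  have hb : ∀ ζ ∈ ball (0 : SpaceX) r, ‖ζ‖ < 1 / 3 := fun ζ hζ =>
    (mem_ball_zero_iff.1 hζ).trans_le hr
  have hψ1 : ContDiff ℝ 1 ψ := hψ.smooth.of_le (by norm_num)
  obtain ⟨m, hm⟩ := exists_lt_potential hU
  have hH := isDensityFun_hFun hφ hψ1 m
  have hE : ∀ x, 1 < ‖x‖ → E0 ≤ U0 x := fun x hx => le_potential_of_one_lt hφ hU hx
  have hsub : Ioo (-1 : ℝ) 1 ×ˢ ball (0 : SpaceX) r ⊆ params := fun q hq => hb q.2 hq.2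
  refine ⟨fun ζ hζ => ⟨injOn_deform ζ (hb ζ hζ), B2_subset_image ζ (hb ζ hζ)⟩,
    fun γ _ ζ hζ => ⟨fun y hy => ⟨?_, ?_⟩, fun x _ => ⟨?_, ?_, fun ξ => ?_⟩⟩,
    fun γ ζ => opY (hFun φ ψ E0 m) U0 (γ, ζ), fun γ _ ζ hζ x hx => ?_, ?_,
    fun γ ζ => dOp (hFun φ ψ E0 m) (hFunU φ ψ E0 m) U0 (γ, ζ), fun γ _ ζ hζ => ?_, ?_,
    fun γ _ ζ hζ ξ x hx => ?_⟩
  · exact (hasDerivAt_hDens_defPot hφ hψ1 hm γ ζ (hb ζ hζ) hy).differentiableAt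
  · exact (hasFDerivAt_defPot hU ζ (hb ζ hζ) hy).differentiableAt
  · have hρ := (contDiff_rho hU hH hE (q := (γ, ζ)) (hb ζ hζ)).continuous.continuousOn (s := B 2)
    refine (integrableOn_pot hρ (deform ζ x)).congr_fun (fun y hy => ?_) measurableSet_B2
    show _ / _ = _
    rw [rho_hFun_eq hψ1.continuous hm γ ζ (hb ζ hζ) hy]
  · have hρ := (contDiff_rho hU hH hE (q := (γ, ζ)) (hb ζ hζ)).continuous.continuousOn (s := B 2)
    exact (integrableOn_field hρ (deform ζ x)).neg.congr_fun
      (fun y hy => (fieldKernel_eq hψ1.continuous hm γ ζ (hb ζ hζ) x hy).symm) measurableSet_B2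
  · have hσ := continuousOn_sigmaRho hU hH (q := (γ, ζ)) (hb ζ hζ) ξ
    exact ((integrableOn_pot hσ (deform ζ x)).sub (integrableOn_pot hσ 0)).neg.congr_fun
      (fun y hy => (dKernel_eq hφ hψ1 hm γ ζ ξ (hb ζ hζ) x hy).symm) measurableSet_B2
  · rw [opY_apply hU hH hE (q := (γ, ζ)) (hb ζ hζ) hx, opT_eq hψ1.continuous hm γ ζ (hb ζ hζ)]
  · exact (continuousOn_opY hU hH hE).mono hsub
  · exact hasFDerivAt_opY hU hH hE γ ζ (hb ζ hζ)
  · exact fun q hq => (continuousAt_dOp hU hH hE (hsub hq)).continuousWithinAt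
  · rw [dOp_apply hU hH hE (q := (γ, ζ)) (hb ζ hζ),
      dOpY_apply hU hH hE (q := (γ, ζ)) (hb ζ hζ) ξ hx,
      opDT_eq hφ hψ1 hU hm γ ζ ξ (hb ζ hζ)]
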